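/- Let $G$ be a connected real linear reductive Lie group, i.e. a connected Lie group isomorphic to a closed subgroup of some $\mathrm{GL}(n,\mathbb{R})$ which is stable under transposition. Let $P\subsetneq G$ be a proper parabolic subgroup and $P^*$ an opposite parabolic subgroup: for some Cartan subspace $\mathfrak a$ of $\mathfrak g=\mathrm{Lie}(G)$, some set $\Delta$ of simple restricted roots of $\mathfrak a$ in $\mathfrak g$, with associated positive roots $\Sigma^+$, and some subset $\theta\subset\Delta$, the groups $P$ and $P^*$ are, up to a common conjugation in $G$, the normalizers in $G$ of $$\mathfrak g_0\oplus\bigoplus_{\alpha\in\Sigma^+}\mathfrak g_{\alpha}\oplus\bigoplus_{\alpha\in\Sigma^+\cap\mathrm{span}(\Delta\smallsetminus\theta)}\mathfrak g_{-\alpha}\quad\text{and}\quad \mathfrak g_0\oplus\bigoplus_{\alpha\in\Sigma^+}\mathfrak g_{-\alpha}\oplus\bigoplus_{\alpha\in\Sigma^+\cap\mathrm{span}(\Delta\smallsetminus\theta)}\mathfrak g_{\alpha}.$$ Let $P\times P^*$ act on $G$ by $(p,q)\cdot g=pgq^{-1}$, let $\Omega=PP^*\subset G$ be the open orbit of the identity,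 and let $\omega$ be a biinvariant volume form on $G$. For a connected smooth manifold $M$ with universal cover $\widetilde M$, a $(P\times P^*,\Omega)$-structure on $M$ is a pair $(\mathrm{dev},\mathrm{hol})$ where $\mathrm{hol}:\pi_1(M)\to P\times P^*$ is a group homomorphism and $\mathrm{dev}:\widetilde M\to\Omega$ is a $\mathrm{hol}$-equivariant local diffeomorphism. It is called complete if $\mathrm{dev}$ is a covering map (onto a union of connected components of $\Omega$). Its volume is the total mass of the measure on $M$ induced by pulling back $\omega$ by $\mathrm{dev}$. Then: 1. A closed connected manifold does not admit any $(P\times P^*,\Omega)$-structure. 2. A connected manifold does not admit any complete $(P\times P^*,\Omega)$-structure of finite volume with respect to $\omega$. 3. No discrete subgroup of $P\times P^*$ acts properly discontinuously and cocompactly on $G$ by left and right multiplication, or equivalently on $(G\times G)/\mathrm{Diag}(G)$. -/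

import Mathlib

open scoped Manifold ContDiff NNReal

noncomputable section

namespace BigCell

/-! ### Linear reductive groups, restricted roots, parabolic subgroups -/

section Parabolic

variable {E : Type*} [NormedAddCommGroup E] [NormedSpace ℝ E]
  {V : Type*} [NormedAddCommGroup V] [InnerProductSpace ℝ V] [FiniteDimensional ℝ V]
  {G : Type*} [TopologicalSpace G] [ChartedSpace E G] [Group G]

/-- `ρ` realizes the Lie group `G` as a closed subgroup of `GL(V)` stable under the adjoint
(the transpose, in an orthonormal basis). A connected Lie group with such a realization is a
connected real linear reductive Lie group; `g ↦ (ρ g)⁻ᵀ` is then a Cartan involution. -/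
structure IsLinearReductive (ρ : G →* (V →L[ℝ] V)ˣ) : Prop where
  contMDiff : ContMDiff 𝓘(ℝ, E) 𝓘(ℝ, V →L[ℝ] V) ∞ (fun g : G => (ρ g : V →L[ℝ] V))
  isClosedEmbedding : Topology.IsClosedEmbedding ρ
  adjoint_mem : ∀ g : G, ∃ h : G,
    (ρ h : V →L[ℝ] V) = ContinuousLinearMap.adjoint (ρ g : V →L[ℝ] V)

/-- The Lie algebra `𝔤` of `G`, seen in `End V`: the image of the differential of `ρ` at `1`. -/
def lieAlg (ρ : G →* (V →L[ℝ] V)ˣ) : Submodule ℝ (V →L[ℝ] V) :=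
  LinearMap.range
    (mfderiv 𝓘(ℝ, E) 𝓘(ℝ, V →L[ℝ] V) (fun g : G => (ρ g : V →L[ℝ] V)) 1 :
      E →L[ℝ] (V →L[ℝ] V)).toLinearMap

/-- A Cartan subspace `𝔞`: a maximal abelian subspace of the space `𝔭` of self-adjoint elements
of `𝔤` (the anti-fixed points of the Cartan involution). -/
def IsCartanSubspace (ρ : G →* (V →L[ℝ] V)ˣ) (𝔞 : Submodule ℝ (V →L[ℝ] V)) : Prop :=
  Maximal (fun 𝔟 : Submodule ℝ (V →L[ℝ] V) =>
    𝔟 ≤ lieAlg (E := E) ρ ∧ (∀ X ∈ 𝔟, ContinuousLinearMap.adjoint X = X) ∧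
      ∀ X ∈ 𝔟, ∀ Y ∈ 𝔟, X * Y = Y * X) 𝔞

/-- `𝔤_α = {X ∈ 𝔤 | [a, X] = α(a) X for all a ∈ 𝔞}`. -/
def rootSpace (ρ : G →* (V →L[ℝ] V)ˣ) (𝔞 : Submodule ℝ (V →L[ℝ] V))
    (α : Module.Dual ℝ 𝔞) : Submodule ℝ (V →L[ℝ] V) where
  carrier := {X | X ∈ lieAlg (E := E) ρ ∧
    ∀ a : 𝔞, (a : V →L[ℝ] V) * X - X * (a : V →L[ℝ] V) = α a • X}
  add_mem' := by
    rintro X Y ⟨hX, hX'⟩ ⟨hY, hY'⟩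
    refine ⟨Submodule.add_mem _ hX hY, fun a => ?_⟩
    rw [smul_add, ← hX' a, ← hY' a, mul_add, add_mul]
    abel
  zero_mem' := ⟨Submodule.zero_mem _, fun a => by simp⟩
  smul_mem' := by
    rintro c X ⟨hX, hX'⟩
    refine ⟨Submodule.smul_mem _ c hX, fun a => ?_⟩
    rw [smul_comm, ← hX' a, smul_sub, mul_smul_comm, smul_mul_assoc]

/-- The set `Σ` of restricted roots of `𝔞` in `𝔤`. -/
def restrictedRoots (ρ : G →* (V →L[ℝ] V)ˣ) (𝔞 : Submodule ℝ (V →L[ℝ] V)) :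
    Set (Module.Dual ℝ 𝔞) :=
  {α | α ≠ 0 ∧ rootSpace (E := E) ρ 𝔞 α ≠ ⊥}

/-- `Δ` is a set of simple restricted roots: linearly independent roots such that every root is a
linear combination of them with all coefficients nonnegative or all coefficients nonpositive. -/
structure IsSimpleSystem (ρ : G →* (V →L[ℝ] V)ˣ) (𝔞 : Submodule ℝ (V →L[ℝ] V))
    (Δ : Set (Module.Dual ℝ 𝔞)) : Prop where
  subset : Δ ⊆ restrictedRoots (E := E) ρ 𝔞
  linearIndepOn : LinearIndepOn ℝ id Δ
  nonneg_or_nonpos : ∀ α ∈ restrictedRoots (E := E) ρ 𝔞,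
    α ∈ Submodule.span ℝ≥0 Δ ∨ -α ∈ Submodule.span ℝ≥0 Δ

/-- The positive roots `Σ⁺` determined by `Δ`. -/
def positiveRoots (ρ : G →* (V →L[ℝ] V)ˣ) (𝔞 : Submodule ℝ (V →L[ℝ] V))
    (Δ : Set (Module.Dual ℝ 𝔞)) : Set (Module.Dual ℝ 𝔞) :=
  {α | α ∈ restrictedRoots (E := E) ρ 𝔞 ∧ α ∈ Submodule.span ℝ≥0 Δ}

/-- `𝔭_θ = 𝔤_0 ⊕ ⨁_{α ∈ Σ⁺} 𝔤_α ⊕ ⨁_{α ∈ Σ⁺ ∩ span(Δ ∖ θ)} 𝔤_{-α}`. -/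
def parabolicSubalgebra (ρ : G →* (V →L[ℝ] V)ˣ) (𝔞 : Submodule ℝ (V →L[ℝ] V))
    (Δ θ : Set (Module.Dual ℝ 𝔞)) : Submodule ℝ (V →L[ℝ] V) :=
  rootSpace (E := E) ρ 𝔞 0 ⊔
    (⨆ α ∈ positiveRoots (E := E) ρ 𝔞 Δ, rootSpace (E := E) ρ 𝔞 α) ⊔
    (⨆ α ∈ positiveRoots (E := E) ρ 𝔞 Δ ∩ (Submodule.span ℝ (Δ \ θ) : Set (Module.Dual ℝ 𝔞)),
      rootSpace (E := E) ρ 𝔞 (-α))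

/-- The opposite subalgebra
`𝔭_θ⁻ = 𝔤_0 ⊕ ⨁_{α ∈ Σ⁺} 𝔤_{-α} ⊕ ⨁_{α ∈ Σ⁺ ∩ span(Δ ∖ θ)} 𝔤_α`. -/
def oppositeParabolicSubalgebra (ρ : G →* (V →L[ℝ] V)ˣ) (𝔞 : Submodule ℝ (V →L[ℝ] V))
    (Δ θ : Set (Module.Dual ℝ 𝔞)) : Submodule ℝ (V →L[ℝ] V) :=
  rootSpace (E := E) ρ 𝔞 0 ⊔
    (⨆ α ∈ positiveRoots (E := E) ρ 𝔞 Δ, rootSpace (E := E) ρ 𝔞 (-α)) ⊔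
    (⨆ α ∈ positiveRoots (E := E) ρ 𝔞 Δ ∩ (Submodule.span ℝ (Δ \ θ) : Set (Module.Dual ℝ 𝔞)),
      rootSpace (E := E) ρ 𝔞 α)

/-- The normalizer in `G` of a subspace `𝔮` of `End V`, for the adjoint action
`X ↦ ρ(g) X ρ(g)⁻¹`. -/
def adNormalizer (ρ : G →* (V →L[ℝ] V)ˣ) (𝔮 : Submodule ℝ (V →L[ℝ] V)) : Subgroup G where
  carrier := {g | ∀ X : V →L[ℝ] V, (ρ g : V →L[ℝ] V) * X * (ρ g⁻¹ : V →L[ℝ] V) ∈ 𝔮 ↔ X ∈ 𝔮}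
  one_mem' := by intro X; simp
  mul_mem' := by
    intro a b ha hb X
    have h := ha ((ρ b : V →L[ℝ] V) * X * (ρ b⁻¹ : V →L[ℝ] V))
    rw [hb X] at h
    simpa only [mul_inv_rev, map_mul, Units.val_mul, mul_assoc] using h
  inv_mem' := by
    intro a ha X
    rw [← ha]
    simp [mul_assoc]

/-- `P` and `Q` are opposite parabolic subgroups of `G`: up to a common conjugation, they are the
standard parabolic subgroup `P_θ` and its opposite `P_θ⁻` (the normalizers in `G` of `𝔭_θ` and of
`𝔭_θ⁻`) for a subset `θ` of the simple restricted roots. Every parabolic subgroup occurs as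
such a `P`; it is the whole of `G` exactly if `θ` is empty. -/
def AreOppositeParabolics (ρ : G →* (V →L[ℝ] V)ˣ) (P Q : Subgroup G) : Prop :=
  ∃ (𝔞 : Submodule ℝ (V →L[ℝ] V)) (Δ θ : Set (Module.Dual ℝ 𝔞)) (g : G),
    IsCartanSubspace (E := E) ρ 𝔞 ∧ IsSimpleSystem (E := E) ρ 𝔞 Δ ∧ θ ⊆ Δ ∧
    P = (adNormalizer ρ (parabolicSubalgebra (E := E) ρ 𝔞 Δ θ)).map
      (MulAut.conj g).toMonoidHom ∧
    Q = (adNormalizer ρ (oppositeParabolicSubalgebra (E := E) ρ 𝔞 Δ θ)).map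
      (MulAut.conj g).toMonoidHom

end Parabolic

/-! ### Geometric structures -/

/-- The big cell `Ω = P Q`. -/
def bigCell {G : Type*} [Group G] (P Q : Subgroup G) : Set G :=
  {g | ∃ p ∈ P, ∃ q ∈ Q, g = p * q}

section Structures

variable {F : Type*} [NormedAddCommGroup F] [NormedSpace ℝ F]
  {M : Type*} [TopologicalSpace M] [ChartedSpace F M]
  {N : Type*} [TopologicalSpace N] [ChartedSpace F N]

variable (F) in
/-- `π : N → M` is a smooth universal covering of `M`. -/
structure IsUniversalCover (π : N → M) : Prop where
  simplyConnected : SimplyConnectedSpace N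
  isCoveringMap : IsCoveringMap π
  surjective : Function.Surjective π
  isLocalDiffeomorph : IsLocalDiffeomorph 𝓘(ℝ, F) 𝓘(ℝ, F) ∞ π

/-- The group of deck transformations of `π`; for a universal covering of a connected manifold `M`
this is the fundamental group of `M` acting on the universal cover. -/
def deckGroup {M N : Type*} [TopologicalSpace N] (π : N → M) : Subgroup (N ≃ₜ N) where
  carrier := {φ | ∀ x, π (φ x) = π x}
  one_mem' := fun _ => rfl
  mul_mem' := by
    intro a b ha hb x
    exact (ha (b x)).trans (hb x)
  inv_mem' := by
    intro a ha x
    have h := ha (a⁻¹ x)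
    have h' : a (a⁻¹ x) = x := a.apply_symm_apply x
    rw [h'] at h
    exact h.symm

variable {E : Type*} [NormedAddCommGroup E] [NormedSpace ℝ E]
  {G : Type*} [TopologicalSpace G] [ChartedSpace E G] [Group G]

variable (E F) in
/-- A `(P × Q, Ω)`-structure on `M`, where `Ω = P Q` and `(p, q) ∈ P × Q` acts by `g ↦ p g q⁻¹`:
a holonomy representation and an equivariant local diffeomorphism from the universal cover
`π : N → M` to `Ω` (an open subset of `G`). -/
structure BigCellStructure (P Q : Subgroup G) (π : N → M) where
  hol : deckGroup π →* P × Q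
  dev : N → bigCell P Q
  isLocalDiffeomorph :
    IsLocalDiffeomorph 𝓘(ℝ, F) 𝓘(ℝ, E) ∞ (fun x : N => (dev x : G))
  equivariant : ∀ (φ : deckGroup π) (x : N),
    (dev ((φ : N ≃ₜ N) x) : G) = ((hol φ).1 : G) * (dev x : G) * ((hol φ).2 : G)⁻¹

/-- The structure is complete if the developing map is a covering map. (`Ω` need not be connected,
and a covering map is not required to meet all of its components.) -/
def BigCellStructure.IsComplete {P Q : Subgroup G} {π : N → M}
    (S : BigCellStructure F E P Q π) : Prop :=
  IsCoveringMap S.dev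

open MeasureTheory in
/-- `ν` is the measure on `M` induced by the Haar measure `μ` of `G` (the measure of the invariant
volume form): wherever `π` and `dev` are both injective on an open set `U` of the universal cover,
the `ν`-measure of `π(U)` is the `μ`-measure of `dev(U)`. -/
def BigCellStructure.IsInducedMeasure {P Q : Subgroup G} {π : N → M}
    [MeasurableSpace G] [MeasurableSpace M]
    (S : BigCellStructure F E P Q π) (μ : Measure G) (ν : Measure M) : Prop :=
  ∀ U : Set N, IsOpen U → Set.InjOn π U → Set.InjOn S.dev U →
    ν (π '' U) = μ ((fun x : N => (S.dev x : G)) '' U)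

open MeasureTheory in
/-- The structure has finite volume. -/
def BigCellStructure.HasFiniteVolume {P Q : Subgroup G} {π : N → M}
    [MeasurableSpace G] [MeasurableSpace M]
    (S : BigCellStructure F E P Q π) (μ : Measure G) : Prop :=
  ∃ ν : Measure M, S.IsInducedMeasure μ ν ∧ ν Set.univ < ⊤

end Structures

/-! ### Discrete group actions -/

/-- The action of `Γ` on `X` is properly discontinuous and cocompact. -/
def ActsProperlyCocompactly (Γ X : Type*) [Group Γ] [TopologicalSpace X] [MulAction Γ X] : Prop :=
  ProperlyDiscontinuousSMul Γ X ∧ CompactSpace (MulAction.orbitRel.Quotient Γ X)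

/-- The action of `G × G` on `G` by left and right multiplication, `(a, b) • g = a g b⁻¹`. -/
@[reducible] def leftRightAction (G : Type*) [Group G] : MulAction (G × G) G where
  smul a g := a.1 * g * a.2⁻¹
  one_smul g := show (1 : G) * g * (1 : G)⁻¹ = g by simp
  mul_smul a b g := show (a.1 * b.1) * g * (a.2 * b.2)⁻¹ = a.1 * (b.1 * g * b.2⁻¹) * a.2⁻¹ by
    simp [mul_assoc]

/-- `Γ ⊆ G × G` acts properly discontinuously and cocompactly on `G` by left and right
multiplication. -/
def ActsProperlyCocompactlyOnGroup {G : Type*} [Group G] [TopologicalSpace G]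
    (Γ : Subgroup (G × G)) : Prop :=
  letI : MulAction (G × G) G := leftRightAction G
  ActsProperlyCocompactly Γ G

/-- The diagonal subgroup of `G × G`. -/
def diagSubgroup (G : Type*) [Group G] : Subgroup (G × G) :=
  ((MonoidHom.id G).prod (MonoidHom.id G)).range

end BigCell

end

section

open scoped Manifold ContDiff NNReal Topology
open Filter NormedSpace

namespace BigCell

/-! ### Traces of operators restricted to subspaces of a Euclidean space. -/

section InnerProduct

variable {W : Type*} [NormedAddCommGroup W] [InnerProductSpace ℝ W] [FiniteDimensional ℝ W]

/-! The big cell carries a flow that commutes with P × P* and multiplies the biinvariant volume by a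
constant c ≠ 1. Any quotient of finite volume on which this flow is defined would have its total
volume multiplied by c, which is absurd.

The flow is p q ↦ p a(t) q, where a(t) = exp(tK) is a one-parameter subgroup of L = P ∩ P*. It is
well defined exactly because a centralizes L. Since L may be disconnected, K has to be chosen
canonically: it represents, for the trace form, the functional x ↦ tr(ad x) on the nilradical of
Lie(P). Hence P moves K only by elements of the nilradical, P* only by elements of the opposite one,
and L fixes it (`IsPosTrace.exists_gradingElement`, `IsGradingElement.comm_of_mem`). Conjugation by
a(t)⁻¹ contracts a closed subgroup U of P with P = U L, nontrivial because P is proper. The outcome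
is recorded in `ContractingPair`, and the rest of the proof uses only this together with the
unimodularity of G (`modularCharacter_eq_one`).

In the coordinates (u, q) ↦ u q⁻¹ of U × P* on Ω, the volume of G is a left Haar measure and the
flow is a right translation, so it scales volume by a constant. Followed by left translation by
a(t)⁻¹, it becomes (u, q) ↦ (a(t)⁻¹ u a(t), q). A contraction of a nontrivial factor cannot preserve
a Haar measure, so c ≠ 1 (`ContractingPair.exists_measure_flow_image`).

For a structure on M, flow lines lift through `dev`: for all times if `dev` is a covering, and for a
uniform short time if M is compact. The lifted flow commutes with deck transformations, descends to
M and scales a finite measure (`BigCellStructure.false_of_hasFlowLift`). For a discrete group Γ the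
flow acts on the Γ-invariant open set Ω ⊂ G, and a weight function replaces a fundamental domain
(`eq_one_of_map_eq_smul`), so no freeness is required. -/

theorem trace_restrict_eq_sum {U : Submodule ℝ W} {T : W →ₗ[ℝ] W} (h : ∀ x ∈ U, T x ∈ U) :
    LinearMap.trace ℝ U (T.restrict h) =
      ∑ i, inner ℝ ((stdOrthonormalBasis ℝ U i : U) : W) (T (stdOrthonormalBasis ℝ U i : U)) := by
  rw [LinearMap.trace_eq_sum_inner _ (stdOrthonormalBasis ℝ U)]
  rfl

/-- An orthonormal basis of U computes both traces, and an operator and its adjoint have the same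
diagonal entries. This is what makes the grading element self-adjoint. -/
theorem trace_restrict_adjoint {U : Submodule ℝ W} {T T' : W →ₗ[ℝ] W}
    (hadj : ∀ x y, inner ℝ (T x) y = inner ℝ x (T' y))
    (h : ∀ x ∈ U, T x ∈ U) (h' : ∀ x ∈ U, T' x ∈ U) :
    LinearMap.trace ℝ U (T.restrict h) = LinearMap.trace ℝ U (T'.restrict h') := by
  rw [trace_restrict_eq_sum, trace_restrict_eq_sum]
  refine Finset.sum_congr rfl fun i _ => ?_
  rw [← hadj, real_inner_comm]

/-- For an adjoint pair `T`, `S` with `T` preserving `U`, the trace of `T S - S T` on `U` is the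
squared Hilbert-Schmidt norm of the part of `S` that leads from `U` to its complement. -/
theorem trace_restrict_commutator {U : Submodule ℝ W} {T T' C : W →ₗ[ℝ] W}
    (hadj : ∀ x y, inner ℝ (T x) y = inner ℝ x (T' y))
    (h : ∀ x ∈ U, T x ∈ U) (hC : ∀ x ∈ U, C x ∈ U) (hCT : ∀ x, C x = T (T' x) - T' (T x)) :
    0 ≤ LinearMap.trace ℝ U (C.restrict hC) ∧
      (LinearMap.trace ℝ U (C.restrict hC) = 0 → ∀ x ∈ U, T' x ∈ U) := by
  set b := stdOrthonormalBasis ℝ U with hb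
  -- The trace is the sum of ‖T' b‖² − ‖T b‖². The compressions of T and T' to U are transposes of
  -- each other and T maps U into U, so the sum of ‖T b‖² is that of the squared projections of T'
  -- b; Pythagoras leaves the components orthogonal to U.
  have key : LinearMap.trace ℝ U (C.restrict hC) =
      ∑ i, ‖T' (b i) - U.starProjection (T' (b i))‖ ^ 2 := by
    rw [trace_restrict_eq_sum hC]
    have h1 : ∀ i, inner ℝ ((b i : U) : W) (C (b i)) = ‖T' (b i)‖ ^ 2 - ‖T (b i)‖ ^ 2 := by
      intro i
      rw [hCT, inner_sub_right, ← hadj, real_inner_self_eq_norm_sq, real_inner_comm, hadj,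
        real_inner_self_eq_norm_sq]
    have h2 : ∑ i, ‖T (b i)‖ ^ 2 = ∑ i, ‖U.starProjection (T' (b i))‖ ^ 2 := by
      have h3 : ∀ i, ‖T (b i)‖ ^ 2 = ∑ j, (inner ℝ ((b j : U) : W) (T (b i))) ^ 2 := by
        intro i
        have := b.sum_sq_norm_inner_right (⟨T (b i), h _ (b i).2⟩ : U)
        simp only [Submodule.coe_inner, Real.norm_eq_abs, sq_abs] at this
        rw [this]; rfl
      have h4 : ∀ j, ‖U.starProjection (T' (b j))‖ ^ 2 =
          ∑ i, (inner ℝ ((b j : U) : W) (T (b i))) ^ 2 := by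
        intro j
        have := b.sum_sq_norm_inner_right (U.orthogonalProjectionOnto (T' (b j)))
        simp only [Submodule.coe_inner, Real.norm_eq_abs, sq_abs] at this
        rw [Submodule.starProjection_apply, ← Submodule.coe_norm, ← this]
        refine Finset.sum_congr rfl fun i _ => ?_
        have h6 : inner ℝ ((b i : U) : W) ((U.orthogonalProjectionOnto (T' (b j)) : U) : W) =
            inner ℝ ((b i : U) : W) (T' (b j)) :=
          Submodule.inner_orthogonalProjectionOnto_eq_of_mem_left (b i) _
        rw [h6, ← hadj, real_inner_comm]
      simp_rw [h3, h4]
      rw [Finset.sum_comm]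
    have h5 : ∀ i, ‖T' (b i) - U.starProjection (T' (b i))‖ ^ 2 =
        ‖T' (b i)‖ ^ 2 - ‖U.starProjection (T' (b i))‖ ^ 2 := by
      intro i
      have := Submodule.norm_sq_eq_add_norm_sq_starProjection (T' (b i)) U
      rw [Submodule.starProjection_orthogonal_val] at this
      linarith
    simp_rw [h5, ← hb, h1, Finset.sum_sub_distrib, h2]
  rw [key]
  refine ⟨Finset.sum_nonneg fun i _ => by positivity, fun h0 x hx => ?_⟩
  rw [Finset.sum_eq_zero_iff_of_nonneg fun i _ => by positivity] at h0
  have h1 : ∀ i, T' (b i) ∈ U := by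
    intro i
    have h2 := h0 i (Finset.mem_univ i)
    rw [sq_eq_zero_iff, norm_eq_zero, sub_eq_zero] at h2
    rw [h2]
    exact Submodule.starProjection_apply_mem _ _
  have h3 : (⟨x, hx⟩ : U) ∈ Submodule.comap (T' ∘ₗ U.subtype) U := by
    have h4 : (⊤ : Submodule ℝ U) ≤ Submodule.comap (T' ∘ₗ U.subtype) U := by
      rw [← b.toBasis.span_eq, Submodule.span_le]
      rintro _ ⟨i, rfl⟩
      simpa using h1 i
    exact h4 trivial
  simpa using h3

end InnerProduct

/-! ### Real *-algebras with a positive trace, and their commutator maps. -/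

section PositiveTrace

variable {A : Type*} [Ring A] [Algebra ℝ A]

/-- The commutator map `y ↦ x y - y x`. -/
def adMap (x : A) : A →ₗ[ℝ] A := LinearMap.mulLeft ℝ x - LinearMap.mulRight ℝ x

theorem adMap_apply (x y : A) : adMap x y = x * y - y * x := rfl

theorem adMap_commutator (x y z : A) :
    adMap (adMap x y) z = adMap x (adMap y z) - adMap y (adMap x z) := by
  simp only [adMap_apply]; noncomm_ring

theorem adMap_neg (x : A) : adMap (-x) = -adMap x := by
  ext y; simp only [adMap_apply, LinearMap.neg_apply]; noncomm_ring

variable [StarRing A]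

/-- A positive trace on a real `*`-algebra. -/
structure IsPosTrace (tr : A →ₗ[ℝ] ℝ) : Prop where
  map_mul_comm : ∀ x y, tr (x * y) = tr (y * x)
  map_star : ∀ x, tr (star x) = tr x
  pos : ∀ x, x ≠ 0 → 0 < tr (star x * x)

variable {tr : A →ₗ[ℝ] ℝ}

namespace IsPosTrace

theorem eq_zero (h : IsPosTrace tr) {x : A} (hx : tr (star x * x) = 0) : x = 0 := by
  by_contra hne
  exact (h.pos x hne).ne hx.symm

/-- `tr([x, y] z) = tr(x [y, z])`. -/
theorem adMap_mul (h : IsPosTrace tr) (x y z : A) : tr (adMap x y * z) = tr (x * adMap y z) := by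
  simp only [adMap_apply, sub_mul, mul_sub, map_sub]
  rw [mul_assoc x y z, mul_assoc y x z, h.map_mul_comm y (x * z), mul_assoc x z y]

/-- For the form tr(x* y), passing to the adjoint turns ad z into ad z*. Self-adjoint elements thus
act by symmetric, hence diagonalizable, operators. -/
theorem adjoint (h : IsPosTrace tr) (z x y : A) :
    tr (star (adMap z x) * y) = tr (star x * adMap (star z) y) := by
  simp only [adMap_apply, star_sub, star_mul, sub_mul, mul_sub, map_sub]
  rw [mul_assoc (star x), mul_assoc (star z), h.map_mul_comm (star z), mul_assoc]

variable [StarModule ℝ A]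

/-- The inner product `⟨x, y⟩ = tr(x* y)`. -/
noncomputable abbrev core (h : IsPosTrace tr) : InnerProductSpace.Core ℝ A where
  inner x y := tr (star x * y)
  conj_inner_symm x y := by
    change tr (star y * x) = tr (star x * y)
    rw [← h.map_star, star_mul, star_star]
  re_inner_nonneg x := by
    change 0 ≤ tr (star x * x)
    by_cases hx : x = 0
    · simp [hx]
    · exact (h.pos x hx).le
  add_left x y z := by
    change tr (star (x + y) * z) = tr (star x * z) + tr (star y * z)
    rw [star_add, add_mul, map_add]
  smul_left x y r := by
    change tr (star (r • x) * y) = r * tr (star x * y)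
    simp
  definite x hx := h.eq_zero hx

variable [FiniteDimensional ℝ A]

theorem iSup_eigenspace (h : IsPosTrace tr) {H : A} (hH : star H = H) :
    ⨆ κ : ℝ, Module.End.eigenspace (adMap H) κ = ⊤ := by
  let : NormedAddCommGroup A := h.core.toNormedAddCommGroup
  let : InnerProductSpace ℝ A := InnerProductSpace.ofCore h.core.toCore
  have hs : (adMap H).IsSymmetric := by
    intro x y
    have := h.adjoint H x y
    rw [hH] at this
    exact this
  have h1 := hs.orthogonalComplement_iSup_eigenspaces_eq_bot
  exact Submodule.orthogonal_eq_bot_iff.1 h1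

theorem trace_restrict_star (h : IsPosTrace tr) {U : Submodule ℝ A} {z : A}
    (h₁ : ∀ x ∈ U, adMap z x ∈ U) (h₂ : ∀ x ∈ U, adMap (star z) x ∈ U) :
    LinearMap.trace ℝ U ((adMap z).restrict h₁) =
      LinearMap.trace ℝ U ((adMap (star z)).restrict h₂) := by
  let : NormedAddCommGroup A := h.core.toNormedAddCommGroup
  let : InnerProductSpace ℝ A := InnerProductSpace.ofCore h.core.toCore
  exact trace_restrict_adjoint (fun x y => h.adjoint z x y) h₁ h₂

/-- The case T = ad x, T' = ad x* of `trace_restrict_commutator`; it is the source of the positivity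
of the grading element on the positive part. -/
theorem trace_restrict_adMap_star (h : IsPosTrace tr) {U : Submodule ℝ A} {x : A}
    (h₁ : ∀ y ∈ U, adMap x y ∈ U) (h₂ : ∀ y ∈ U, adMap (adMap x (star x)) y ∈ U) :
    0 ≤ LinearMap.trace ℝ U ((adMap (adMap x (star x))).restrict h₂) ∧
      (LinearMap.trace ℝ U ((adMap (adMap x (star x))).restrict h₂) = 0 →
        ∀ y ∈ U, adMap (star x) y ∈ U) := by
  let : NormedAddCommGroup A := h.core.toNormedAddCommGroup
  let : InnerProductSpace ℝ A := InnerProductSpace.ofCore h.core.toCore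
  exact trace_restrict_commutator (fun y z => h.adjoint x y z) h₁ h₂
    (fun y => adMap_commutator x _ y)

theorem exists_riesz (h : IsPosTrace tr) (L : Submodule ℝ A) (τ : A →ₗ[ℝ] ℝ) :
    ∃ x ∈ L, ∀ z ∈ L, tr (star x * z) = τ z := by
  let : NormedAddCommGroup A := h.core.toNormedAddCommGroup
  let : InnerProductSpace ℝ A := InnerProductSpace.ofCore h.core.toCore
  have : FiniteDimensional ℝ L := inferInstance
  let f : L →L[ℝ] ℝ := LinearMap.toContinuousLinearMap (τ ∘ₗ L.subtype)
  refine ⟨((InnerProductSpace.toDual ℝ L).symm f : L), Submodule.coe_mem _, fun z hz => ?_⟩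
  exact InnerProductSpace.toDual_symm_apply (𝕜 := ℝ) (E := L) (x := ⟨z, hz⟩) (y := f)

end IsPosTrace

end PositiveTrace

/-! ### The grading of a *-stable Lie algebra by a self-adjoint element. -/

section Grading

variable {A : Type*} [Ring A] [Algebra ℝ A] [StarRing A] [StarModule ℝ A] [FiniteDimensional ℝ A]
  {tr : A →ₗ[ℝ] ℝ} {𝔤 : Submodule ℝ A} {H : A}

/-- The part of degree `κ` of `𝔤` for the grading by `ad H`. -/
def gradedPart (𝔤 : Submodule ℝ A) (H : A) (κ : ℝ) : Submodule ℝ A :=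
  𝔤 ⊓ Module.End.eigenspace (adMap H) κ

/-- The sum of the parts of nonnegative degree. -/
def nonnegPart (𝔤 : Submodule ℝ A) (H : A) : Submodule ℝ A :=
  ⨆ (κ : ℝ) (_ : 0 ≤ κ), gradedPart 𝔤 H κ

/-- The sum of the parts of positive degree. -/
def posPart (𝔤 : Submodule ℝ A) (H : A) : Submodule ℝ A :=
  ⨆ (κ : ℝ) (_ : 0 < κ), gradedPart 𝔤 H κ

theorem mem_gradedPart {κ : ℝ} {x : A} : x ∈ gradedPart 𝔤 H κ ↔ x ∈ 𝔤 ∧ adMap H x = κ • x := by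
  rw [gradedPart, Submodule.mem_inf, Module.End.mem_eigenspace_iff]

theorem gradedPart_le (κ : ℝ) : gradedPart 𝔤 H κ ≤ 𝔤 := inf_le_left

theorem gradedPart_le_nonnegPart {κ : ℝ} (hκ : 0 ≤ κ) : gradedPart 𝔤 H κ ≤ nonnegPart 𝔤 H :=
  le_iSup₂_of_le κ hκ le_rfl

theorem gradedPart_le_posPart {κ : ℝ} (hκ : 0 < κ) : gradedPart 𝔤 H κ ≤ posPart 𝔤 H :=
  le_iSup₂_of_le κ hκ le_rfl

theorem nonnegPart_le : nonnegPart 𝔤 H ≤ 𝔤 := iSup₂_le fun κ _ => gradedPart_le κ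

theorem posPart_le : posPart 𝔤 H ≤ 𝔤 := iSup₂_le fun κ _ => gradedPart_le κ

theorem posPart_le_nonnegPart : posPart 𝔤 H ≤ nonnegPart 𝔤 H :=
  iSup₂_le fun _ hκ => gradedPart_le_nonnegPart hκ.le

theorem mem_gradedPart_neg {κ : ℝ} {x : A} :
    x ∈ gradedPart 𝔤 (-H) κ ↔ x ∈ gradedPart 𝔤 H (-κ) := by
  rw [mem_gradedPart, mem_gradedPart, adMap_neg, LinearMap.neg_apply, neg_smul, neg_eq_iff_eq_neg]

theorem star_mem_gradedPart (hst : ∀ x ∈ 𝔤, star x ∈ 𝔤) (hH : star H = H) {κ : ℝ} {x : A}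
    (hx : x ∈ gradedPart 𝔤 H κ) : star x ∈ gradedPart 𝔤 H (-κ) := by
  rw [mem_gradedPart] at hx ⊢
  refine ⟨hst x hx.1, ?_⟩
  have h := congrArg star hx.2
  simp only [adMap_apply, star_sub, star_mul, hH, star_smul, star_trivial] at h
  rw [adMap_apply, neg_smul, ← h, neg_sub]

theorem star_mem_posPart (hst : ∀ x ∈ 𝔤, star x ∈ 𝔤) (hH : star H = H) {x : A}
    (hx : x ∈ posPart 𝔤 H) : star x ∈ posPart 𝔤 (-H) := by
  have h : posPart 𝔤 H ≤ (posPart 𝔤 (-H)).comap (starLinearEquiv ℝ (A := A)).toLinearMap := by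
    refine iSup₂_le fun κ hκ x hx => ?_
    refine gradedPart_le_posPart hκ (mem_gradedPart_neg.2 ?_)
    exact star_mem_gradedPart hst hH hx
  exact h hx

theorem star_mem_nonnegPart (hst : ∀ x ∈ 𝔤, star x ∈ 𝔤) (hH : star H = H) {x : A}
    (hx : x ∈ nonnegPart 𝔤 H) : star x ∈ nonnegPart 𝔤 (-H) := by
  have h : nonnegPart 𝔤 H ≤ (nonnegPart 𝔤 (-H)).comap (starLinearEquiv ℝ (A := A)).toLinearMap := by
    refine iSup₂_le fun κ hκ x hx => ?_
    refine gradedPart_le_nonnegPart hκ (mem_gradedPart_neg.2 ?_)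
    exact star_mem_gradedPart hst hH hx
  exact h hx

theorem adMap_mem_gradedPart (hbr : ∀ x ∈ 𝔤, ∀ y ∈ 𝔤, adMap x y ∈ 𝔤) {κ κ' : ℝ} {x y : A}
    (hx : x ∈ gradedPart 𝔤 H κ) (hy : y ∈ gradedPart 𝔤 H κ') :
    adMap x y ∈ gradedPart 𝔤 H (κ + κ') := by
  rw [mem_gradedPart] at hx hy ⊢
  refine ⟨hbr x hx.1 y hy.1, ?_⟩
  have h := adMap_commutator H x y
  rw [hx.2, hy.2] at h
  have h2 : adMap (κ • x) y = κ • adMap x y := by simp [adMap_apply, smul_sub]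
  rw [h2, map_smul] at h
  rw [add_smul, h, sub_add_cancel]

theorem adMap_mem_posPart (hbr : ∀ x ∈ 𝔤, ∀ y ∈ 𝔤, adMap x y ∈ 𝔤) {x y : A}
    (hx : x ∈ nonnegPart 𝔤 H) (hy : y ∈ posPart 𝔤 H) : adMap x y ∈ posPart 𝔤 H := by
  have h : nonnegPart 𝔤 H ≤ (posPart 𝔤 H).comap
      ((LinearMap.mul ℝ A).flip y - LinearMap.mul ℝ A y) := by
    refine iSup₂_le fun κ hκ x hx => ?_
    have h' : posPart 𝔤 H ≤ (posPart 𝔤 H).comap (adMap x) :=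
      iSup₂_le fun κ' hκ' y hy =>
        gradedPart_le_posPart (add_pos_of_nonneg_of_pos hκ hκ') (adMap_mem_gradedPart hbr hx hy)
    exact h' hy
  exact h hx

theorem adMap_mem_nonnegPart (hbr : ∀ x ∈ 𝔤, ∀ y ∈ 𝔤, adMap x y ∈ 𝔤) {x y : A}
    (hx : x ∈ nonnegPart 𝔤 H) (hy : y ∈ nonnegPart 𝔤 H) : adMap x y ∈ nonnegPart 𝔤 H := by
  have h : nonnegPart 𝔤 H ≤ (nonnegPart 𝔤 H).comap
      ((LinearMap.mul ℝ A).flip y - LinearMap.mul ℝ A y) := by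
    refine iSup₂_le fun κ hκ x hx => ?_
    have h' : nonnegPart 𝔤 H ≤ (nonnegPart 𝔤 H).comap (adMap x) :=
      iSup₂_le fun κ' hκ' y hy =>
        gradedPart_le_nonnegPart (add_nonneg hκ hκ') (adMap_mem_gradedPart hbr hx hy)
    exact h' hy
  exact h hx

namespace IsPosTrace

/-- Parts whose degrees do not add up to `0` are orthogonal for the trace form. -/
theorem trace_mul_eq_zero (h : IsPosTrace tr) {κ κ' : ℝ} (hκ : κ + κ' ≠ 0) {x y : A}
    (hx : x ∈ gradedPart 𝔤 H κ) (hy : y ∈ gradedPart 𝔤 H κ') : tr (x * y) = 0 := by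
  rw [mem_gradedPart] at hx hy
  have h1 := h.adMap_mul x H y
  have h2 : adMap x H = -(κ • x) := by
    rw [← hx.2, adMap_apply, adMap_apply, neg_sub]
  rw [h2, hy.2] at h1
  simp only [neg_mul, smul_mul_assoc, map_neg, map_smul, mul_smul_comm, smul_eq_mul] at h1
  have h3 : (κ + κ') * tr (x * y) = 0 := by linarith
  exact (mul_eq_zero.1 h3).resolve_left hκ

theorem trace_mul_posPart (h : IsPosTrace tr) {x y : A} (hx : x ∈ posPart 𝔤 H)
    (hy : y ∈ nonnegPart 𝔤 H) : tr (x * y) = 0 := by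
  have h1 : posPart 𝔤 H ≤ LinearMap.ker (tr ∘ₗ (LinearMap.mul ℝ A).flip y) := by
    refine iSup₂_le fun κ hκ x hx => ?_
    have h2 : nonnegPart 𝔤 H ≤ LinearMap.ker (tr ∘ₗ LinearMap.mul ℝ A x) :=
      iSup₂_le fun κ' hκ' y hy =>
        h.trace_mul_eq_zero (add_pos_of_pos_of_nonneg hκ hκ').ne' hx hy
    exact h2 hy
  exact h1 hx

/-- The diagonalizable map ad H preserves 𝔤, so 𝔤 is the sum of its graded parts, which are then
sorted by the sign of the degree. -/
theorem le_sup (h : IsPosTrace tr) (hbr : ∀ x ∈ 𝔤, ∀ y ∈ 𝔤, adMap x y ∈ 𝔤)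
    (hHg : H ∈ 𝔤) (hH : star H = H) : 𝔤 ≤ nonnegPart 𝔤 H ⊔ posPart 𝔤 (-H) := by
  have h1 := Submodule.eq_iSup_inf_genEigenspace (f := adMap H) (p := 𝔤) 1
    (fun x hx => hbr H hHg x hx) (h.iSup_eigenspace hH)
  refine h1.le.trans (iSup_le fun κ => ?_)
  rcases le_or_gt 0 κ with hκ | hκ
  · exact (gradedPart_le_nonnegPart hκ).trans le_sup_left
  · refine le_trans ?_ le_sup_right
    intro x hx
    refine gradedPart_le_posPart (neg_pos.2 hκ) (mem_gradedPart_neg.2 ?_)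
    rw [neg_neg]
    exact hx

theorem nonnegPart_le_sup : nonnegPart 𝔤 H ≤ gradedPart 𝔤 H 0 ⊔ posPart 𝔤 H := by
  refine iSup₂_le fun κ hκ => ?_
  rcases hκ.eq_or_lt with rfl | hκ
  · exact _root_.le_sup_left
  · exact (gradedPart_le_posPart hκ).trans le_sup_right

/-- The positive part is the orthogonal of the nonnegative part for the trace form. -/
theorem mem_posPart_iff (h : IsPosTrace tr) (hbr : ∀ x ∈ 𝔤, ∀ y ∈ 𝔤, adMap x y ∈ 𝔤)
    (hst : ∀ x ∈ 𝔤, star x ∈ 𝔤) (hHg : H ∈ 𝔤) (hH : star H = H) {x : A} :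
    x ∈ posPart 𝔤 H ↔ x ∈ 𝔤 ∧ ∀ y ∈ nonnegPart 𝔤 H, tr (x * y) = 0 := by
  refine ⟨fun hx => ⟨posPart_le hx, fun y hy => h.trace_mul_posPart hx hy⟩, ?_⟩
  rintro ⟨hx, hxy⟩
  obtain ⟨p, hp, n', hn', rfl⟩ := Submodule.mem_sup.1 (h.le_sup hbr hHg hH hx)
  obtain ⟨l, hl, n, hn, rfl⟩ := Submodule.mem_sup.1 (nonnegPart_le_sup hp)
  -- The involution reverses degrees, so the star of the part of nonpositive degree is an admissible
  -- test element. Testing against it gives tr(w* w) = 0 for w = l + n'.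
  have h1 : star (l + n') ∈ nonnegPart 𝔤 H := by
    rw [star_add]
    refine add_mem (gradedPart_le_nonnegPart le_rfl ?_) (posPart_le_nonnegPart ?_)
    · simpa using star_mem_gradedPart hst hH hl
    · have := star_mem_posPart (H := -H) hst (by simp [hH]) hn'
      rwa [neg_neg] at this
  have h2 := hxy _ h1
  have h3 : l + n + n' = n + (l + n') := by abel
  rw [h3, add_mul, map_add, h.trace_mul_posPart hn h1, zero_add, h.map_mul_comm] at h2
  rw [h3, h.eq_zero h2, add_zero]
  exact hn

end IsPosTrace

end Grading

/-! ### A canonical grading element for a parabolic subalgebra. -/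

section GradingElement

variable {A : Type*} [Ring A] [Algebra ℝ A]

/-- The trace of ad x on U makes sense only when ad x preserves U. Composing with a linear
projection onto U gives a functional on the whole algebra, to which the Riesz theorem applies. -/
theorem exists_restrict_trace [FiniteDimensional ℝ A] (U : Submodule ℝ A) :
    ∃ τ : A →ₗ[ℝ] ℝ, ∀ (x : A) (hx : ∀ y ∈ U, adMap x y ∈ U),
      τ x = LinearMap.trace ℝ U ((adMap x).restrict hx) := by
  obtain ⟨π, hπ⟩ := LinearMap.exists_leftInverse_of_injective U.subtype U.ker_subtype
  refine ⟨{ toFun := fun x => LinearMap.trace ℝ U (π ∘ₗ adMap x ∘ₗ U.subtype)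
            map_add' := fun x y => ?_
            map_smul' := fun r x => ?_ }, fun x hx => ?_⟩
  · rw [← map_add]
    congr 1
    ext z
    simp only [LinearMap.comp_apply, LinearMap.add_apply, ← map_add]
    congr 2
    simp only [adMap_apply]; noncomm_ring
  · rw [← map_smul]
    congr 1
    ext z
    simp only [LinearMap.comp_apply, LinearMap.smul_apply, ← map_smul]
    congr 2
    simp [adMap_apply, smul_sub]
  · change LinearMap.trace ℝ U (π ∘ₗ adMap x ∘ₗ U.subtype) = _
    congr 1
    ext z
    have h1 : ∀ w : U, π (w : A) = w := fun w => LinearMap.congr_fun hπ w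
    have h2 := h1 ((adMap x).restrict hx z)
    simp only [LinearMap.comp_apply, Submodule.subtype_apply]
    rw [← h2]
    rfl

theorem adMap_units_conj (p : Aˣ) (x y : A) :
    adMap (p * x * ↑p⁻¹) (p * y * ↑p⁻¹) = p * adMap x y * ↑p⁻¹ := by
  simp only [adMap_apply, mul_sub, sub_mul]
  simp [mul_assoc]

/-- Conjugation by a unit that preserves a subspace, as an automorphism of the subspace. -/
def conjEquiv (p : Aˣ) (U : Submodule ℝ A) (hU : ∀ x, (p : A) * x * ↑p⁻¹ ∈ U ↔ x ∈ U) : U ≃ₗ[ℝ] U where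
  toFun x := ⟨p * x * ↑p⁻¹, (hU x).2 x.2⟩
  invFun x := ⟨↑p⁻¹ * x * p, (hU _).1 (by simp [mul_assoc])⟩
  map_add' x y := by ext; simp [mul_add, add_mul]
  map_smul' r x := by ext; simp
  left_inv x := by ext; simp [mul_assoc]
  right_inv x := by ext; simp [mul_assoc]

theorem trace_restrict_conj (p : Aˣ) (U : Submodule ℝ A)
    (hU : ∀ x, (p : A) * x * ↑p⁻¹ ∈ U ↔ x ∈ U) {x : A} (hx : ∀ y ∈ U, adMap x y ∈ U)
    (hx' : ∀ y ∈ U, adMap (p * x * ↑p⁻¹) y ∈ U) :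
    LinearMap.trace ℝ U ((adMap (p * x * ↑p⁻¹)).restrict hx') =
      LinearMap.trace ℝ U ((adMap x).restrict hx) := by
  rw [← LinearMap.trace_conj' ((adMap x).restrict hx) (conjEquiv p U hU)]
  congr 1
  ext y
  rw [LinearEquiv.conj_apply_apply]
  obtain ⟨z, rfl⟩ := (conjEquiv p U hU).surjective y
  rw [LinearEquiv.symm_apply_apply]
  exact adMap_units_conj p x z

variable [StarRing A] [StarModule ℝ A] [FiniteDimensional ℝ A]
  {tr : A →ₗ[ℝ] ℝ} {𝔤 : Submodule ℝ A} {H : A}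

/-- On U the map ad [x, y] is a commutator of operators, and commutators have trace zero. -/
theorem trace_restrict_adMap_adMap [FiniteDimensional ℝ A] {U : Submodule ℝ A} {x y : A}
    (hx : ∀ z ∈ U, adMap x z ∈ U) (hy : ∀ z ∈ U, adMap y z ∈ U)
    (hxy : ∀ z ∈ U, adMap (adMap x y) z ∈ U) :
    LinearMap.trace ℝ U ((adMap (adMap x y)).restrict hxy) = 0 := by
  have h : (adMap (adMap x y)).restrict hxy + (adMap y).restrict hy ∘ₗ (adMap x).restrict hx =
      (adMap x).restrict hx ∘ₗ (adMap y).restrict hy := by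
    ext z
    have := adMap_commutator x y (z : A)
    exact eq_sub_iff_add_eq.1 this
  have h2 := congrArg (LinearMap.trace ℝ U) h
  rw [map_add, LinearMap.trace_comp_comm' ((adMap y).restrict hy)] at h2
  exact left_eq_add.1 ((add_comm _ _).trans h2).symm

/-- For a self-adjoint `H` in a `*`-stable Lie algebra `𝔤` there is a self-adjoint `H₀` whose
grading defines the same nonnegative and nonpositive parts, and which is moved by the normalizers of
these parts only by elements of positive, respectively negative, degree. -/
theorem IsPosTrace.exists_gradingElement (h : IsPosTrace tr)
    (hbr : ∀ x ∈ 𝔤, ∀ y ∈ 𝔤, adMap x y ∈ 𝔤) (hst : ∀ x ∈ 𝔤, star x ∈ 𝔤)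
    (hHg : H ∈ 𝔤) (hH : star H = H) :
    ∃ H₀ ∈ 𝔤, star H₀ = H₀ ∧ nonnegPart 𝔤 H = nonnegPart 𝔤 H₀ ∧
      nonnegPart 𝔤 (-H) = nonnegPart 𝔤 (-H₀) ∧ posPart 𝔤 H = posPart 𝔤 H₀ ∧
      ∀ p : Aˣ, (∀ x, (p : A) * x * ↑p⁻¹ ∈ 𝔤 ↔ x ∈ 𝔤) →
        (∀ x, (p : A) * x * ↑p⁻¹ ∈ nonnegPart 𝔤 H ↔ x ∈ nonnegPart 𝔤 H) →
        (p : A) * H₀ * ↑p⁻¹ - H₀ ∈ posPart 𝔤 H := by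
  set U := posPart 𝔤 H with hU
  -- On the nonnegative part, τ is the trace of the adjoint action on the nilradical U. It is
  -- determined by the parabolic subalgebra alone and is invariant under its normalizer, which is
  -- why its dual element H₀ is canonical while H is not.
  obtain ⟨τ, hτ⟩ := exists_restrict_trace U
  have hpres : ∀ x ∈ nonnegPart 𝔤 H, ∀ y ∈ U, adMap x y ∈ U :=
    fun x hx y hy => adMap_mem_posPart hbr hx hy
  have hL : gradedPart 𝔤 H 0 ≤ nonnegPart 𝔤 H := gradedPart_le_nonnegPart le_rfl
  have hHL : H ∈ gradedPart 𝔤 H 0 := mem_gradedPart.2 ⟨hHg, by simp [adMap_apply]⟩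
  have hLstar : ∀ z ∈ gradedPart 𝔤 H 0, star z ∈ gradedPart 𝔤 H 0 := fun z hz => by
    simpa using star_mem_gradedPart hst hH hz
  have hLbr : ∀ z ∈ gradedPart 𝔤 H 0, ∀ w ∈ gradedPart 𝔤 H 0, adMap z w ∈ gradedPart 𝔤 H 0 :=
    fun z hz w hw => by simpa using adMap_mem_gradedPart hbr hz hw
  obtain ⟨H₀, hH₀, hr⟩ := h.exists_riesz (gradedPart 𝔤 H 0) τ
  have hH₀g : H₀ ∈ 𝔤 := gradedPart_le _ hH₀
  -- `H₀` is self-adjoint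
  have hs : star H₀ = H₀ := by
    have h1 : ∀ z ∈ gradedPart 𝔤 H 0, tr (H₀ * z) = tr (star H₀ * z) := by
      intro z hz
      rw [hr z hz, hτ z (hpres z (hL hz)),
        h.trace_restrict_star _ (hpres _ (hL (hLstar z hz))), ← hτ, ← hr _ (hLstar z hz),
        ← h.map_star, star_mul, h.map_mul_comm]
    have h2 : star H₀ - H₀ ∈ gradedPart 𝔤 H 0 := sub_mem (hLstar _ hH₀) hH₀
    have h3 : tr ((star H₀ - H₀) * star (star H₀ - H₀)) = 0 := by
      rw [sub_mul, map_sub, h1 _ (hLstar _ h2), sub_self]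
    rw [h.map_mul_comm] at h3
    exact sub_eq_zero.1 (h.eq_zero h3)
  have hrL : ∀ z ∈ gradedPart 𝔤 H 0, tr (H₀ * z) = τ z := fun z hz => by rw [← hr z hz, hs]
  -- `H₀` commutes with the part of degree `0`
  have hcomm : ∀ z ∈ gradedPart 𝔤 H 0, adMap H₀ z = 0 := by
    intro z hz
    have hw := hLbr _ hH₀ z hz
    have h1 : tr (adMap H₀ z * star (adMap H₀ z)) = 0 := by
      rw [h.adMap_mul, hrL _ (hLbr z hz _ (hLstar _ hw)),
        hτ _ (hpres _ (hL (hLbr z hz _ (hLstar _ hw))))]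
      exact trace_restrict_adMap_adMap (hpres z (hL hz)) (hpres _ (hL (hLstar _ hw))) _
    rw [h.map_mul_comm] at h1
    exact h.eq_zero h1
  -- `ad H₀` has positive eigenvalues on the positive part
  have hpos : ∀ κ : ℝ, 0 < κ → ∀ (lam : ℝ) (x : A), x ∈ gradedPart 𝔤 H κ → x ≠ 0 →
      adMap H₀ x = lam • x → 0 < lam := by
    intro κ hκ lam x hx hx0 hlam
    have hxs := star_mem_gradedPart hst hH hx
    have hc : adMap x (star x) ∈ gradedPart 𝔤 H 0 := by
      simpa using adMap_mem_gradedPart hbr hx hxs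
    have hxn : x ∈ nonnegPart 𝔤 H := gradedPart_le_nonnegPart hκ.le hx
    -- The eigenvalue has the sign of τ([x, x*]), a trace of the form handled by
    -- `trace_restrict_adMap_star`.
    have h1 : lam * tr (star x * x) = τ (adMap x (star x)) := by
      rw [← hrL _ hc, ← h.adMap_mul, hlam, smul_mul_assoc, map_smul, smul_eq_mul,
        h.map_mul_comm x]
    obtain ⟨h2, h3⟩ := h.trace_restrict_adMap_star (U := U) (hpres x hxn) (hpres _ (hL hc))
    rw [← hτ] at h2 h3
    -- If the trace vanished, ad x* would preserve U, so [x, x*] would lie both in U and in degree 0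
    -- and hence be zero. But tr(H [x, x*]) = κ tr(x* x) > 0.
    have h4 : τ (adMap x (star x)) ≠ 0 := by
      intro h0
      have h5 := h3 h0 x (gradedPart_le_posPart hκ hx)
      have h6 : adMap (star x) x = -adMap x (star x) := by simp [adMap_apply]
      rw [h6] at h5
      have h7 : tr (-adMap x (star x) * star (-adMap x (star x))) = 0 :=
        h.trace_mul_posPart h5 (hL (hLstar _ (neg_mem hc)))
      rw [h.map_mul_comm] at h7
      have h8 : adMap x (star x) = 0 := neg_eq_zero.1 (h.eq_zero h7)
      have h9 := h.adMap_mul H x (star x)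
      rw [h8, mul_zero, map_zero, (mem_gradedPart.1 hx).2, smul_mul_assoc, map_smul, smul_eq_mul,
        h.map_mul_comm x] at h9
      exact (mul_pos hκ (h.pos x hx0)).ne' h9
    have h10 : 0 < lam * tr (star x * x) := by
      rw [h1]; exact lt_of_le_of_ne h2 (Ne.symm h4)
    exact pos_of_mul_pos_left h10 (h.pos x hx0).le
  have hUle : U ≤ posPart 𝔤 H₀ := by
    refine iSup₂_le fun κ hκ => ?_
    have h1 := Submodule.eq_iSup_inf_genEigenspace (f := adMap H₀) (p := gradedPart 𝔤 H κ) 1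
      (fun x hx => by simpa using adMap_mem_gradedPart hbr hH₀ hx) (h.iSup_eigenspace hs)
    refine h1.le.trans (iSup_le fun lam x hx => ?_)
    by_cases hx0 : x = 0
    · rw [hx0]; exact zero_mem _
    have hlam : adMap H₀ x = lam • x := Module.End.mem_eigenspace_iff.1 hx.2
    exact gradedPart_le_posPart (hpos κ hκ lam x hx.1 hx0 hlam)
      (mem_gradedPart.2 ⟨gradedPart_le _ hx.1, hlam⟩)
  have hLle : gradedPart 𝔤 H 0 ≤ gradedPart 𝔤 H₀ 0 := fun z hz =>
    mem_gradedPart.2 ⟨gradedPart_le _ hz, by rw [hcomm z hz, zero_smul]⟩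
  have hNle : posPart 𝔤 (-H) ≤ posPart 𝔤 (-H₀) := by
    intro x hx
    have h1 := star_mem_posPart (H := -H) hst (by simp [hH]) hx
    rw [neg_neg] at h1
    simpa using star_mem_posPart hst hs (hUle h1)
  have hPle : nonnegPart 𝔤 H ≤ nonnegPart 𝔤 H₀ :=
    IsPosTrace.nonnegPart_le_sup.trans (sup_le (hLle.trans (gradedPart_le_nonnegPart le_rfl))
      (hUle.trans posPart_le_nonnegPart))
  have hPeq : nonnegPart 𝔤 H = nonnegPart 𝔤 H₀ := by
    refine le_antisymm hPle fun x hx => ?_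
    obtain ⟨p, hp, n, hn, rfl⟩ := Submodule.mem_sup.1 (h.le_sup hbr hHg hH (nonnegPart_le hx))
    -- The component n of negative H-degree has nonnegative and also negative H₀-degree, so tr(n* n)
    -- = 0.
    have h1 : n ∈ nonnegPart 𝔤 H₀ := by
      have := sub_mem hx (hPle hp)
      rwa [add_sub_cancel_left] at this
    have h2 := star_mem_posPart (H := -H₀) hst (by simp [hs]) (hNle hn)
    rw [neg_neg] at h2
    rw [h.eq_zero (h.trace_mul_posPart h2 h1), add_zero]
    exact hp
  have hUeq : U = posPart 𝔤 H₀ := by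
    ext x
    rw [hU, h.mem_posPart_iff hbr hst hHg hH, h.mem_posPart_iff hbr hst hH₀g hs, hPeq]
  have hNeq : nonnegPart 𝔤 (-H) = nonnegPart 𝔤 (-H₀) := by
    have h1 : ∀ {K K' : A}, star K = K → star K' = K' → nonnegPart 𝔤 K = nonnegPart 𝔤 K' →
        nonnegPart 𝔤 (-K) ≤ nonnegPart 𝔤 (-K') := by
      intro K K' hK hK' hKK x hx
      have h2 := star_mem_nonnegPart (H := -K) hst (by simp [hK]) hx
      rw [neg_neg, hKK] at h2
      simpa using star_mem_nonnegPart hst hK' h2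
    exact le_antisymm (h1 hH hs hPeq) (h1 hs hH hPeq.symm)
  -- `τ` is the functional dual to `H₀` on the whole nonnegative part
  have hτP : ∀ x ∈ nonnegPart 𝔤 H, tr (H₀ * x) = τ x := by
    have h1 : nonnegPart 𝔤 H ≤ LinearMap.ker (tr ∘ₗ LinearMap.mul ℝ A H₀ - τ) := by
      refine iSup₂_le fun κ hκ x hx => ?_
      rw [LinearMap.mem_ker, LinearMap.sub_apply, sub_eq_zero]
      change tr (H₀ * x) = τ x
      rcases hκ.eq_or_lt with rfl | hκ
      · exact hrL x hx
      have hxP : x ∈ nonnegPart 𝔤 H := gradedPart_le_nonnegPart hκ.le hx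
      rw [h.trace_mul_eq_zero (by rw [zero_add]; exact hκ.ne') hH₀ hx]
      -- In positive degree both functionals vanish: κ x = [H, x] is a commutator, so its trace is
      -- zero.
      have h2 : τ (adMap H x) = 0 := by
        have h3 : adMap H x ∈ nonnegPart 𝔤 H := adMap_mem_nonnegPart hbr (hL hHL) hxP
        rw [hτ _ (hpres _ h3)]
        exact trace_restrict_adMap_adMap (hpres H (hL hHL)) (hpres x hxP) _
      rw [(mem_gradedPart.1 hx).2, map_smul, smul_eq_mul] at h2
      exact ((mul_eq_zero.1 h2).resolve_left hκ.ne').symm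
    intro x hx
    exact sub_eq_zero.1 (LinearMap.mem_ker.1 (h1 hx))
  refine ⟨H₀, hH₀g, hs, hPeq, hNeq, hUeq, fun p hpg hpP => ?_⟩
  have hconjtr : ∀ x y : A, tr (p * x * ↑p⁻¹ * y) = tr (x * (↑p⁻¹ * y * p)) := by
    intro x y
    rw [mul_assoc, mul_assoc, h.map_mul_comm]
    simp [mul_assoc]
  have hpinv : ∀ y ∈ nonnegPart 𝔤 H, (↑p⁻¹ : A) * y * p ∈ nonnegPart 𝔤 H := fun y hy =>
    (hpP _).1 (by simpa [mul_assoc] using hy)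
  have hpginv : ∀ y ∈ 𝔤, (↑p⁻¹ : A) * y * p ∈ 𝔤 := fun y hy =>
    (hpg _).1 (by simpa [mul_assoc] using hy)
  -- U is the orthogonal of the nonnegative part inside 𝔤 for the conjugation-invariant trace form,
  -- so whatever normalizes 𝔤 and the nonnegative part normalizes U.
  have hpU : ∀ x, (p : A) * x * ↑p⁻¹ ∈ U ↔ x ∈ U := by
    intro x
    rw [hU, h.mem_posPart_iff hbr hst hHg hH, h.mem_posPart_iff hbr hst hHg hH, hpg]
    refine and_congr_right fun _ => ⟨fun hx y hy => ?_, fun hx y hy => ?_⟩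
    · have := hx _ ((hpP y).2 hy)
      rw [hconjtr] at this
      simpa [mul_assoc] using this
    · rw [hconjtr]
      exact hx _ (hpinv y hy)
  rw [hU, h.mem_posPart_iff hbr hst hHg hH]
  -- By the same orthogonality it suffices to test against y in the nonnegative part, where the
  -- claim reads τ(p⁻¹ y p) = τ(y), the invariance of the trace on U under conjugation.
  refine ⟨sub_mem ((hpg _).2 hH₀g) hH₀g, fun y hy => ?_⟩
  have hy' := hpinv y hy
  rw [sub_mul, map_sub, hconjtr, hτP _ hy', hτP y hy, sub_eq_zero, hτ _ (hpres _ hy')]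
  have hyy : (p : A) * (↑p⁻¹ * y * p) * ↑p⁻¹ = y := by simp [mul_assoc]
  rw [← trace_restrict_conj p U hpU (hpres _ hy') (by rw [hyy]; exact hpres y hy), ← hτ, hyy]

end GradingElement

/-! ### Calculus of the exponential in a Banach algebra. -/

section BanachAlgebra

variable {A : Type*} [NormedRing A] [NormedAlgebra ℝ A] [CompleteSpace A]

theorem exp_neg_smul_mul_exp_smul (t : ℝ) (X : A) : exp (-t • X) * exp (t • X) = 1 := by
  let : NormedAlgebra ℚ A := NormedAlgebra.restrictScalars ℚ ℝ A
  rw [← exp_add_of_commute ((Commute.refl X).smul_left _ |>.smul_right _)]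
  simp

theorem exp_smul_mul_exp_neg_smul (t : ℝ) (X : A) : exp (t • X) * exp (-t • X) = 1 := by
  simpa using exp_neg_smul_mul_exp_smul (-t) X

theorem exp_add_smul (s t : ℝ) (X : A) : exp ((s + t) • X) = exp (s • X) * exp (t • X) := by
  let : NormedAlgebra ℚ A := NormedAlgebra.restrictScalars ℚ ℝ A
  rw [← exp_add_of_commute ((Commute.refl X).smul_left _ |>.smul_right _), add_smul]

/-- The linear differential equation `dy/dt = y X`, `y 0 = 1` has the exponential as its solution. -/
theorem eventually_eq_exp_of_hasDerivAt {y : ℝ → A} {X : A} (h0 : y 0 = 1)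
    (h : ∀ᶠ t in 𝓝 (0 : ℝ), HasDerivAt y (y t * X) t) :
    ∀ᶠ t in 𝓝 (0 : ℝ), y t = exp (t • X) := by
  obtain ⟨ε, hε, hder⟩ := Metric.eventually_nhds_iff_ball.1 h
  have hder2 : ∀ t ∈ Metric.ball (0 : ℝ) ε, HasDerivAt (fun t => y t * exp (-t • X)) 0 t := by
    intro t ht
    have h1 := hasDerivAt_exp_smul_const' (𝕂 := ℝ) X (-t)
    have h2 : HasDerivAt (fun t : ℝ => exp (-t • X)) (-(X * exp (-t • X))) t := by
      have := h1.scomp t (hasDerivAt_neg t)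
      simpa [Function.comp_def] using this
    have h3 := (hder t ht).mul h2
    have h4 : y t * X * exp (-t • X) + y t * -(X * exp (-t • X)) = 0 := by
      rw [mul_neg, mul_assoc, add_neg_cancel]
    rw [h4] at h3
    exact h3
  refine Metric.eventually_nhds_iff_ball.2 ⟨ε, hε, fun t ht => ?_⟩
  have hc : y t * exp (-t • X) = 1 := by
    have := (convex_ball (0 : ℝ) ε).is_const_of_fderivWithin_eq_zero (𝕜 := ℝ)
      (f := fun t => y t * exp (-t • X))
      (fun t ht => (hder2 t ht).differentiableAt.differentiableWithinAt)
      (fun t ht => by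
        rw [fderivWithin_of_isOpen Metric.isOpen_ball ht, (hder2 t ht).hasFDerivAt.fderiv]
        ext; simp) ht (Metric.mem_ball_self hε)
    rw [this]
    simp [h0]
  rw [← mul_one (y t), ← exp_neg_smul_mul_exp_smul t X, ← mul_assoc, hc, one_mul]

theorem hasDerivAt_exp_smul_zero (X : A) : HasDerivAt (fun t : ℝ => exp (t • X)) X 0 := by
  simpa using hasDerivAt_exp_smul_const (𝕂 := ℝ) X 0

theorem hasDerivAt_exp_conj (X Y : A) :
    HasDerivAt (fun t : ℝ => exp (t • X) * Y * exp (-t • X)) (X * Y - Y * X) 0 := by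
  have h2 : HasDerivAt (fun t : ℝ => exp (-t • X)) (-X) 0 := by
    simpa using hasDerivAt_exp_smul_zero (-X)
  have h3 := ((hasDerivAt_exp_smul_zero X).mul_const Y).mul h2
  have h4 : X * Y * exp (-(0 : ℝ) • X) + exp ((0 : ℝ) • X) * Y * -X = X * Y - Y * X := by
    simp [sub_eq_add_neg]
  rw [h4] at h3
  exact h3

/-- The differential at the origin is addition 𝔪 × 𝔫 → 𝔪 + 𝔫, so the open mapping theorem will apply
as soon as the sum is the whole Lie algebra. -/
theorem hasStrictFDerivAt_exp_mul_exp (𝔪 𝔫 : Submodule ℝ A) :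
    HasStrictFDerivAt (fun z : 𝔪 × 𝔫 => exp (z.1 : A) * exp (z.2 : A))
      (𝔪.subtypeL.comp (ContinuousLinearMap.fst ℝ 𝔪 𝔫) +
        𝔫.subtypeL.comp (ContinuousLinearMap.snd ℝ 𝔪 𝔫)) 0 := by
  have he : HasStrictFDerivAt (exp : A → A) (1 : A →L[ℝ] A) 0 := hasStrictFDerivAt_exp_zero
  have h : ∀ L : (𝔪 × 𝔫) →L[ℝ] A, HasStrictFDerivAt (fun z => exp (L z)) L 0 := by
    intro L
    have h1 : HasStrictFDerivAt (exp : A → A) (1 : A →L[ℝ] A) (L 0) := by simpa using he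
    exact h1.comp (0 : 𝔪 × 𝔫) L.hasStrictFDerivAt
  have h3 := (h (𝔪.subtypeL.comp (ContinuousLinearMap.fst ℝ 𝔪 𝔫))).mul'
    (h (𝔫.subtypeL.comp (ContinuousLinearMap.snd ℝ 𝔪 𝔫)))
  refine h3.congr_fderiv ?_
  ext z <;> simp

theorem hasDerivAt_of_hasFDerivAt_comp_smulRight {E F : Type*} [NormedAddCommGroup E]
    [NormedSpace ℝ E] [NormedAddCommGroup F] [NormedSpace ℝ F] {f : ℝ → F} {L : E →L[ℝ] F} {w : E}
    {t : ℝ} (h : HasFDerivAt f (L.comp ((1 : ℝ →L[ℝ] ℝ).smulRight w)) t) :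
    HasDerivAt f (L w) t := by
  have := h.hasDerivAt
  simpa using this

end BanachAlgebra

/-! ### The Lie algebra and one-parameter subgroups of a closed linear group. -/

section LieGroupExp

variable {E : Type*} [NormedAddCommGroup E] [NormedSpace ℝ E] [FiniteDimensional ℝ E]
  {V : Type*} [NormedAddCommGroup V] [InnerProductSpace ℝ V] [FiniteDimensional ℝ V]
  {G : Type*} [TopologicalSpace G] [ChartedSpace E G] [Group G] [LieGroup 𝓘(ℝ, E) ∞ G]
  {ρ : G →* (V →L[ℝ] V)ˣ}

/-- The differential of `ρ` at the identity. -/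
noncomputable def lieDeriv (E : Type*) [NormedAddCommGroup E] [NormedSpace ℝ E]
    {V : Type*} [NormedAddCommGroup V] [InnerProductSpace ℝ V] [FiniteDimensional ℝ V]
    {G : Type*} [TopologicalSpace G] [ChartedSpace E G] [Group G]
    (ρ : G →* (V →L[ℝ] V)ˣ) : E →L[ℝ] (V →L[ℝ] V) :=
  mfderiv 𝓘(ℝ, E) 𝓘(ℝ, V →L[ℝ] V) (fun g : G => (ρ g : V →L[ℝ] V)) 1

theorem mem_lieAlg_iff {X : V →L[ℝ] V} :
    X ∈ lieAlg (E := E) ρ ↔ ∃ v : E, lieDeriv E ρ v = X := Iff.rfl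

theorem hasStrictFDerivAt_chart (hρ : IsLinearReductive (E := E) ρ) :
    HasStrictFDerivAt (fun x : E => (ρ ((chartAt E (1 : G)).symm x) : V →L[ℝ] V))
      (lieDeriv E ρ) (chartAt E (1 : G) 1) := by
  have h := hρ.contMDiff.contMDiffAt (x := (1 : G))
  have h1 := (contMDiffAt_iff.1 h).2
  have h2 : ContDiffAt ℝ ∞ (fun x : E => (ρ ((chartAt E (1 : G)).symm x) : V →L[ℝ] V))
      (chartAt E (1 : G) 1) := by
    have := h1
    simp only [mfld_simps, contDiffWithinAt_univ] at this
    exact this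
  have h3 := h2.hasStrictFDerivAt (by simp)
  have h4 : lieDeriv E ρ = fderiv ℝ (fun x : E => (ρ ((chartAt E (1 : G)).symm x) : V →L[ℝ] V))
      (chartAt E (1 : G) 1) := by
    have h5 := (h.mdifferentiableAt (by simp)).hasMFDerivAt.2
    have h6 : HasFDerivWithinAt (fun x : E => (ρ ((chartAt E (1 : G)).symm x) : V →L[ℝ] V))
        (lieDeriv E ρ) Set.univ (chartAt E (1 : G) 1) := by
      simp only [mfld_simps] at h5
      exact h5
    exact (hasFDerivWithinAt_univ.1 h6).fderiv.symm
  rw [h4]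
  exact h3

/-- The curve is an integral curve of the left-invariant vector field with value v at 1. Its image
under ρ solves y' = y X with X = dρ(v), which forces the exponential near 0. -/
theorem exists_curve (hρ : IsLinearReductive (E := E) ρ) (v : E) :
    ∃ γ : ℝ → G, γ 0 = 1 ∧
      HasMFDerivAt 𝓘(ℝ, ℝ) 𝓘(ℝ, E) γ 0 ((1 : ℝ →L[ℝ] ℝ).smulRight v) ∧
      ∀ᶠ t in 𝓝 (0 : ℝ), (ρ (γ t) : V →L[ℝ] V) = exp (t • lieDeriv E ρ v) := by
  have : LieGroup 𝓘(ℝ, E) (minSmoothness ℝ 3) G := by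
    simp only [minSmoothness_of_isRCLikeNormedField]
    exact LieGroup.of_le (m := 3) (n := ∞) (by exact (show (((3 : ℕ∞) : ℕ∞ω)) ≤ ∞ by exact_mod_cast le_top))
  have : IsManifold 𝓘(ℝ, E) 1 G := IsManifold.of_le (n := ∞) (by exact_mod_cast (le_top : (1 : ℕ∞) ≤ ⊤))
  have hv := contMDiffAt_mulInvariantVectorField (I := 𝓘(ℝ, E)) (G := G) v (g := 1)
  have hv1 := hv.of_le (m := 1) (by simp)
  obtain ⟨γ, h0, hγ⟩ := exists_isMIntegralCurveAt_of_contMDiffAt_boundaryless (t₀ := 0) hv1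
  have hmul : ∀ g : G, (fun h : G => (ρ (g * h) : V →L[ℝ] V)) =
      fun h => (ρ g : V →L[ℝ] V) * (ρ h : V →L[ℝ] V) := by
    intro g; ext1 h; simp
  have hmd : ∀ g : G, MDifferentiableAt 𝓘(ℝ, E) 𝓘(ℝ, V →L[ℝ] V)
      (fun g : G => (ρ g : V →L[ℝ] V)) g := fun g =>
    (hρ.contMDiff.contMDiffAt).mdifferentiableAt (by simp)
  have key : ∀ g : G, mfderiv 𝓘(ℝ, E) 𝓘(ℝ, V →L[ℝ] V) (fun g : G => (ρ g : V →L[ℝ] V)) g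
      (mulInvariantVectorField (I := 𝓘(ℝ, E)) v g) = (ρ g : V →L[ℝ] V) * lieDeriv E ρ v := by
    intro g
    have hL : MDifferentiableAt 𝓘(ℝ, E) 𝓘(ℝ, E) (g * ·) (1 : G) :=
      (contMDiff_mul_left (I := 𝓘(ℝ, E)) (n := ∞)).contMDiffAt.mdifferentiableAt (by simp)
    have hg := hmd (g * 1)
    have h1 := mfderiv_comp (I := 𝓘(ℝ, E)) (I' := 𝓘(ℝ, E)) (I'' := 𝓘(ℝ, V →L[ℝ] V)) (1 : G) hg hL
    have h2 : ((fun g : G => (ρ g : V →L[ℝ] V)) ∘ (g * ·)) =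
        (ContinuousLinearMap.mul ℝ (V →L[ℝ] V) (ρ g : V →L[ℝ] V)) ∘
          (fun g : G => (ρ g : V →L[ℝ] V)) := by
      ext1 h; simp
    rw [h2] at h1
    have h3 := mfderiv_comp (I := 𝓘(ℝ, E)) (I' := 𝓘(ℝ, V →L[ℝ] V)) (I'' := 𝓘(ℝ, V →L[ℝ] V))
      (1 : G) (g := (ContinuousLinearMap.mul ℝ (V →L[ℝ] V) (ρ g : V →L[ℝ] V)))
      (ContinuousLinearMap.mdifferentiableAt _) (hmd 1)
    rw [h3] at h1
    have h4 := DFunLike.congr_fun h1 v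
    -- The base point g * 1 is equal to g, but not by definition; quantifying over h avoids a cast
    -- between the two tangent spaces.
    have h5 : ∀ h : G, g * 1 = h → (mfderiv 𝓘(ℝ, E) 𝓘(ℝ, V →L[ℝ] V)
        (fun g : G => (ρ g : V →L[ℝ] V)) h : E →L[ℝ] (V →L[ℝ] V))
        (mfderiv 𝓘(ℝ, E) 𝓘(ℝ, E) (g * ·) (1 : G) v : E) = (ρ g : V →L[ℝ] V) * lieDeriv E ρ v := by
      rintro _ rfl
      refine Eq.trans h4.symm ?_
      exact DFunLike.congr_fun (ContinuousLinearMap.mfderiv_eq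
        (ContinuousLinearMap.mul ℝ (V →L[ℝ] V) (ρ g : V →L[ℝ] V))) (lieDeriv E ρ v)
    exact h5 g (mul_one g)
  refine ⟨γ, h0, ?_, ?_⟩
  · have h1 := hγ.self_of_nhds
    have hid : ∀ f : G → G, f = id →
        (mfderiv 𝓘(ℝ, E) 𝓘(ℝ, E) f (1 : G) : E →L[ℝ] E) v = v := by
      rintro _ rfl
      exact DFunLike.congr_fun (mfderiv_id (I := 𝓘(ℝ, E)) (x := (1 : G))) v
    have h2 : ∀ g : G, g = 1 → (mulInvariantVectorField (I := 𝓘(ℝ, E)) v g : E) = v := by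
      rintro _ rfl
      exact hid _ (funext one_mul)
    have h3 : ∀ w : E, w = v →
        HasMFDerivAt 𝓘(ℝ, ℝ) 𝓘(ℝ, E) γ 0 ((1 : ℝ →L[ℝ] ℝ).smulRight w) →
        HasMFDerivAt 𝓘(ℝ, ℝ) 𝓘(ℝ, E) γ 0 ((1 : ℝ →L[ℝ] ℝ).smulRight v) := by
      rintro _ rfl h
      exact h
    exact h3 _ (h2 _ h0) h1
  · set X := lieDeriv E ρ v with hX
    obtain ⟨ε, hε, hball⟩ := Metric.eventually_nhds_iff_ball.1 hγ
    have hder : ∀ t ∈ Metric.ball (0 : ℝ) ε,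
        HasDerivAt (fun t => (ρ (γ t) : V →L[ℝ] V)) ((ρ (γ t) : V →L[ℝ] V) * X) t := by
      intro t ht
      have h1 : HasFDerivAt (fun t => (ρ (γ t) : V →L[ℝ] V))
          ((mfderiv 𝓘(ℝ, E) 𝓘(ℝ, V →L[ℝ] V) (fun g : G => (ρ g : V →L[ℝ] V)) (γ t) :
            E →L[ℝ] (V →L[ℝ] V)).comp ((1 : ℝ →L[ℝ] ℝ).smulRight
              (mulInvariantVectorField (I := 𝓘(ℝ, E)) v (γ t) : E))) t :=
        ((hmd (γ t)).hasMFDerivAt.comp t (hball t ht)).hasFDerivAt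
      have h2 := hasDerivAt_of_hasFDerivAt_comp_smulRight (E := E) (F := V →L[ℝ] V) h1
      exact (key (γ t)) ▸ h2
    exact eventually_eq_exp_of_hasDerivAt (by simp [h0])
      (Metric.eventually_nhds_iff_ball.2 ⟨ε, hε, hder⟩)

theorem injective_of_isLinearReductive (hρ : IsLinearReductive (E := E) ρ) :
    Function.Injective ρ := hρ.isClosedEmbedding.injective

/-- If dρ(v) = 0, the curve of velocity v has constant image under the injective map ρ; it is then
constant near 0, so v = 0. -/
theorem lieDeriv_injective (hρ : IsLinearReductive (E := E) ρ) :
    Function.Injective (lieDeriv E ρ) := by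
  rw [injective_iff_map_eq_zero]
  intro v hv
  obtain ⟨γ, h0, hγ, hexp⟩ := exists_curve hρ v
  have h1 : γ =ᶠ[𝓝 0] fun _ => 1 := by
    filter_upwards [hexp] with t ht
    apply injective_of_isLinearReductive hρ
    ext1
    rw [ht, hv]
    simp
  have h2 := hγ.congr_of_eventuallyEq h1.symm
  have h3 := hasMFDerivAt_unique h2 (hasMFDerivAt_const (1 : G) (0 : ℝ))
  have h4 : ((1 : ℝ →L[ℝ] ℝ).smulRight v : ℝ →L[ℝ] E) = 0 := h3
  simpa using DFunLike.congr_fun h4 (1 : ℝ)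

/-- The curve gives exp(sX) only for small s. Taking s = t/n with n large and then the n-th power
reaches every t. -/
theorem exists_eq_exp (hρ : IsLinearReductive (E := E) ρ) {X : V →L[ℝ] V}
    (hX : X ∈ lieAlg (E := E) ρ) (t : ℝ) : ∃ g : G, (ρ g : V →L[ℝ] V) = exp (t • X) := by
  obtain ⟨v, rfl⟩ := mem_lieAlg_iff.1 hX
  obtain ⟨γ, h0, -, hexp⟩ := exists_curve hρ v
  have h1 : Tendsto (fun n : ℕ => t / (n : ℝ)) atTop (𝓝 0) := tendsto_const_div_atTop_nhds_zero_nat t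
  obtain ⟨n, hn, hn0⟩ := ((h1.eventually hexp).and (eventually_gt_atTop 0)).exists
  refine ⟨γ (t / n) ^ n, ?_⟩
  let : NormedAlgebra ℚ (V →L[ℝ] V) := NormedAlgebra.restrictScalars ℚ ℝ _
  rw [map_pow, Units.val_pow_eq_pow_val, hn, ← exp_nsmul, ← Nat.cast_smul_eq_nsmul ℝ, smul_smul]
  congr 2
  field_simp

/-- A left inverse of the differential of `ρ` gives a map on `G` that is injective near `1`. -/
theorem exists_leftInverse (hρ : IsLinearReductive (E := E) ρ) :
    ∃ R : (V →L[ℝ] V) →L[ℝ] E, (∀ v, R (lieDeriv E ρ v) = v) ∧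
      ∃ r : E → V →L[ℝ] V, HasStrictFDerivAt r (lieDeriv E ρ) (R 1) ∧
        ∀ᶠ g in 𝓝 (1 : G), r (R (ρ g : V →L[ℝ] V)) = (ρ g : V →L[ℝ] V) := by
  obtain ⟨R₀, hR₀⟩ := LinearMap.exists_leftInverse_of_injective (lieDeriv E ρ).toLinearMap
    (LinearMap.ker_eq_bot.2 (lieDeriv_injective hρ))
  set R : (V →L[ℝ] V) →L[ℝ] E := LinearMap.toContinuousLinearMap R₀ with hR
  have hRA : ∀ v, R (lieDeriv E ρ v) = v := fun v => LinearMap.congr_fun hR₀ v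
  refine ⟨R, hRA, ?_⟩
  set e := chartAt E (1 : G) with he
  have hf := hasStrictFDerivAt_chart hρ
  set f : E → V →L[ℝ] V := fun x => (ρ (e.symm x) : V →L[ℝ] V) with hfdef
  have hf1 : f (e 1) = 1 := by simp [hfdef, e.left_inv (mem_chart_source E (1 : G))]
  have hk : HasStrictFDerivAt (fun x => R (f x))
      ((ContinuousLinearEquiv.refl ℝ E : E ≃L[ℝ] E) : E →L[ℝ] E) (e 1) := by
    have h := R.hasStrictFDerivAt.comp (e 1) hf
    have h2 : R.comp (lieDeriv E ρ) = ((ContinuousLinearEquiv.refl ℝ E : E ≃L[ℝ] E) : E →L[ℝ] E) := by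
      ext v; simp [hRA]
    rw [h2] at h
    exact h
  have hinv := hk.to_localInverse
  set k' := hk.localInverse with hk'
  have hk1 : R (f (e 1)) = R 1 := by rw [hf1]
  have hleft := hk.eventually_left_inverse
  refine ⟨fun z => f (k' z), ?_, ?_⟩
  · rw [← hk1]
    have hk2 : k' (R (f (e 1))) = e 1 := hleft.self_of_nhds
    have hf' : HasStrictFDerivAt f (lieDeriv E ρ) (k' (R (f (e 1)))) := by rw [hk2]; exact hf
    exact hf'.comp (R (f (e 1))) hinv
  · have hcont : Tendsto e (𝓝 1) (𝓝 (e 1)) := e.continuousAt (mem_chart_source E (1 : G))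
    filter_upwards [hcont.eventually hleft, e.open_source.mem_nhds (mem_chart_source E (1 : G))]
      with g hg hgs
    have h1 : f (e g) = (ρ g : V →L[ℝ] V) := by simp [hfdef, e.left_inv hgs]
    rw [← h1]
    exact congrArg f hg

theorem continuous_val (hρ : IsLinearReductive (E := E) ρ) :
    Continuous fun g : G => (ρ g : V →L[ℝ] V) :=
  Units.continuous_val.comp hρ.isClosedEmbedding.continuous

/-- Convergence in `G` can be tested in `End V`. -/
theorem tendsto_iff_val (hρ : IsLinearReductive (E := E) ρ) {ι : Type*} {l : Filter ι} {u : ι → G}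
    {g : G} : Tendsto u l (𝓝 g) ↔
      Tendsto (fun i => (ρ (u i) : V →L[ℝ] V)) l (𝓝 (ρ g : V →L[ℝ] V)) := by
  rw [hρ.isClosedEmbedding.isInducing.tendsto_nhds_iff,
    Units.isOpenEmbedding_val.isInducing.tendsto_nhds_iff]
  rfl

/-- Near t = 0 the curve exp(tX) comes from elements of G close to 1, hence is fixed by r ∘ R.
Differentiating this identity gives X = dρ(R X). -/
theorem mem_lieAlg_of_exp (hρ : IsLinearReductive (E := E) ρ) {X : V →L[ℝ] V}
    (hX : ∀ t : ℝ, ∃ g : G, (ρ g : V →L[ℝ] V) = exp (t • X)) : X ∈ lieAlg (E := E) ρ := by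
  obtain ⟨R, hRA, r, hr, hloc⟩ := exists_leftInverse hρ
  choose c hc using hX
  have hexp := hasDerivAt_exp_smul_zero X
  have hct : Tendsto c (𝓝 0) (𝓝 1) := by
    rw [tendsto_iff_val hρ]
    simp only [hc]
    simpa using hexp.continuousAt.tendsto
  have h1 : (fun t : ℝ => r (R (exp (t • X)))) =ᶠ[𝓝 0] fun t => exp (t • X) := by
    filter_upwards [hct.eventually hloc] with t ht
    rw [← hc]; exact ht
  have h2 : HasDerivAt (fun t : ℝ => r (R (exp (t • X)))) (lieDeriv E ρ (R X)) 0 := by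
    have h3 : HasDerivAt (fun t : ℝ => R (exp (t • X))) (R X) 0 := R.hasFDerivAt.comp_hasDerivAt 0 hexp
    have h4 : HasFDerivAt r (lieDeriv E ρ) (R (exp ((0 : ℝ) • X))) := by
      simpa using hr.hasFDerivAt
    exact h4.comp_hasDerivAt 0 h3
  have h5 := (h2.congr_of_eventuallyEq h1.symm).unique hexp
  exact mem_lieAlg_iff.2 ⟨R X, h5⟩

theorem mem_lieAlg_iff_exp (hρ : IsLinearReductive (E := E) ρ) {X : V →L[ℝ] V} :
    X ∈ lieAlg (E := E) ρ ↔ ∀ t : ℝ, ∃ g : G, (ρ g : V →L[ℝ] V) = exp (t • X) :=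
  ⟨fun h t => exists_eq_exp hρ h t, mem_lieAlg_of_exp hρ⟩

theorem conj_mem_lieAlg (hρ : IsLinearReductive (E := E) ρ) (g : G) {X : V →L[ℝ] V}
    (hX : X ∈ lieAlg (E := E) ρ) :
    (ρ g : V →L[ℝ] V) * X * (ρ g⁻¹ : V →L[ℝ] V) ∈ lieAlg (E := E) ρ := by
  rw [mem_lieAlg_iff_exp hρ] at hX ⊢
  intro t
  obtain ⟨h, hh⟩ := hX t
  refine ⟨g * h * g⁻¹, ?_⟩
  let : NormedAlgebra ℚ (V →L[ℝ] V) := NormedAlgebra.restrictScalars ℚ ℝ _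
  rw [map_mul, map_mul, Units.val_mul, Units.val_mul, hh, map_inv, ← exp_units_conj]
  simp

theorem adjoint_mem_lieAlg (hρ : IsLinearReductive (E := E) ρ) {X : V →L[ℝ] V}
    (hX : X ∈ lieAlg (E := E) ρ) : ContinuousLinearMap.adjoint X ∈ lieAlg (E := E) ρ := by
  rw [mem_lieAlg_iff_exp hρ] at hX ⊢
  intro t
  obtain ⟨h, hh⟩ := hX t
  obtain ⟨k, hk⟩ := hρ.adjoint_mem h
  refine ⟨k, ?_⟩
  rw [hk, hh, ← ContinuousLinearMap.star_eq_adjoint, ← ContinuousLinearMap.star_eq_adjoint, star_exp]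
  simp

/-- The bracket is the derivative at 0 of exp(tX) Y exp(−tX), a curve inside a closed subspace. -/
theorem bracket_mem_lieAlg (hρ : IsLinearReductive (E := E) ρ) {X Y : V →L[ℝ] V}
    (hX : X ∈ lieAlg (E := E) ρ) (hY : Y ∈ lieAlg (E := E) ρ) :
    X * Y - Y * X ∈ lieAlg (E := E) ρ := by
  have hmem : ∀ t : ℝ, exp (t • X) * Y * exp (-t • X) ∈ lieAlg (E := E) ρ := by
    intro t
    obtain ⟨g, hg⟩ := exists_eq_exp hρ hX t
    have h := conj_mem_lieAlg hρ g hY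
    have h2 : (ρ g⁻¹ : V →L[ℝ] V) = exp (-t • X) := by
      rw [map_inv]
      exact Units.inv_eq_of_mul_eq_one_right (by rw [hg]; exact exp_smul_mul_exp_neg_smul t X)
    rwa [hg, h2] at h
  have h4 := hasDerivAt_exp_conj X Y
  have hclosed : IsClosed (lieAlg (E := E) ρ : Set (V →L[ℝ] V)) :=
    Submodule.closed_of_finiteDimensional _
  refine hclosed.mem_of_tendsto h4.tendsto_slope (Eventually.of_forall fun t => ?_)
  rw [slope_def_module]
  exact Submodule.smul_mem _ _ (Submodule.sub_mem _ (hmem _) (hmem _))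

/-- If `𝔪 + 𝔫 = 𝔤`, the products `exp X * exp Y` with `X ∈ 𝔪`, `Y ∈ 𝔫` fill a neighbourhood
of `1`. -/
theorem eventually_eq_exp_mul_exp (hρ : IsLinearReductive (E := E) ρ)
    {𝔪 𝔫 : Submodule ℝ (V →L[ℝ] V)} (h𝔪 : 𝔪 ≤ lieAlg (E := E) ρ) (h𝔫 : 𝔫 ≤ lieAlg (E := E) ρ)
    (hsup : lieAlg (E := E) ρ ≤ 𝔪 ⊔ 𝔫) :
    ∀ᶠ g in 𝓝 (1 : G), ∃ X ∈ 𝔪, ∃ Y ∈ 𝔫, (ρ g : V →L[ℝ] V) = exp X * exp Y := by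
  obtain ⟨R, hRA, r, -, hloc⟩ := exists_leftInverse hρ
  have hex : ∀ z : 𝔪 × 𝔫, ∃ g : G,
      (ρ g : V →L[ℝ] V) = exp (z.1 : V →L[ℝ] V) * exp (z.2 : V →L[ℝ] V) := by
    intro z
    obtain ⟨g, hg⟩ := exists_eq_exp hρ (h𝔪 z.1.2) 1
    obtain ⟨h, hh⟩ := exists_eq_exp hρ (h𝔫 z.2.2) 1
    exact ⟨g * h, by rw [map_mul, Units.val_mul, hg, hh, one_smul, one_smul]⟩
  choose c hc using hex
  have hd := hasStrictFDerivAt_exp_mul_exp 𝔪 𝔫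
  have hct : Tendsto c (𝓝 0) (𝓝 1) := by
    rw [tendsto_iff_val hρ]
    simp only [hc]
    simpa using hd.hasFDerivAt.continuousAt.tendsto
  have hRd := R.hasStrictFDerivAt.comp (0 : 𝔪 × 𝔫) hd
  -- Read through R, the differential of (X, Y) ↦ exp X exp Y is onto because 𝔪 + 𝔫 is all of 𝔤, so
  -- images of neighbourhoods of 0 are neighbourhoods.
  have hmap := hRd.map_nhds_eq_of_surj (by
    rw [eq_top_iff]
    rintro v -
    have hv : lieDeriv E ρ v ∈ 𝔪 ⊔ 𝔫 := hsup (mem_lieAlg_iff.2 ⟨v, rfl⟩)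
    obtain ⟨X, hX, Y, hY, hXY⟩ := Submodule.mem_sup.1 hv
    refine ⟨(⟨X, hX⟩, ⟨Y, hY⟩), ?_⟩
    simp only [ContinuousLinearMap.coe_coe, ContinuousLinearMap.comp_apply,
      ContinuousLinearMap.add_apply, ContinuousLinearMap.coe_fst', ContinuousLinearMap.coe_snd',
      Submodule.subtypeL_apply]
    rw [hXY, hRA])
  -- Equality of images under R will be upgraded to equality in End V by applying r; this needs both
  -- sides to be fixed by r ∘ R, hence the restriction to small z.
  have hT : ∀ᶠ z in 𝓝 (0 : 𝔪 × 𝔫), r (R (ρ (c z) : V →L[ℝ] V)) = (ρ (c z) : V →L[ℝ] V) :=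
    hct.eventually hloc
  have him := Filter.image_mem_map 
    (m := fun z : 𝔪 × 𝔫 => R (exp (z.1 : V →L[ℝ] V) * exp (z.2 : V →L[ℝ] V))) hT
  rw [hmap] at him
  have hRc : Tendsto (fun g : G => R (ρ g : V →L[ℝ] V)) (𝓝 1)
      (𝓝 (R (exp ((0 : 𝔪 × 𝔫).1 : V →L[ℝ] V) * exp ((0 : 𝔪 × 𝔫).2 : V →L[ℝ] V)))) := by
    have := (R.continuous.comp (continuous_val hρ)).tendsto (1 : G)
    simpa [Function.comp_def] using this
  filter_upwards [hRc him, hloc] with g hg hg2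
  obtain ⟨z, hz, hzg⟩ := hg
  refine ⟨z.1, z.1.2, z.2, z.2.2, ?_⟩
  have hz' : r (R (ρ (c z) : V →L[ℝ] V)) = (ρ (c z) : V →L[ℝ] V) := hz
  rw [hc] at hz'
  exact hg2.symm.trans ((congrArg r hzg.symm).trans hz')

end LieGroupExp

/-! ### Simultaneous diagonalization of commuting self-adjoint elements. -/

section JointEigenspaces

variable {A : Type*} [Ring A] [Algebra ℝ A] [StarRing A] [StarModule ℝ A] [FiniteDimensional ℝ A]
  {tr : A →ₗ[ℝ] ℝ}

/-- A subspace stable under the commutators with a commuting family of self-adjoint elements is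
spanned by joint eigenvectors. -/
theorem IsPosTrace.le_iSup_joint (h : IsPosTrace tr) {U : Submodule ℝ A} {ι : Type*} (a : ι → A)
    (ha : ∀ i, star (a i) = a i) (hU : ∀ i, ∀ x ∈ U, adMap (a i) x ∈ U)
    (hcomm : ∀ i j, a i * a j = a j * a i) :
    U ≤ ⨆ χ : ι → ℝ, U ⊓ ⨅ i, Module.End.eigenspace (adMap (a i)) (χ i) := by
  let : NormedAddCommGroup A := h.core.toNormedAddCommGroup
  let : InnerProductSpace ℝ A := InnerProductSpace.ofCore h.core.toCore
  let T : ι → U →ₗ[ℝ] U := fun i => (adMap (a i)).restrict (hU i)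
  have hT : ∀ i, (T i).IsSymmetric := by
    intro i x y
    have := h.adjoint (a i) x y
    rw [ha] at this
    exact this
  have hC : ∀ i j, Commute (T i) (T j) := by
    intro i j
    ext x
    change adMap (a i) (adMap (a j) x) = adMap (a j) (adMap (a i) x)
    rw [← sub_eq_zero, ← adMap_commutator]
    have : adMap (a i) (a j) = 0 := by rw [adMap_apply, hcomm, sub_self]
    rw [this]
    simp [adMap_apply]
  have h1 := LinearMap.IsSymmetric.iSup_iInf_eq_top_of_commute hT fun i j _ => hC i j
  have h2 := congrArg (Submodule.map U.subtype) h1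
  rw [Submodule.map_top, Submodule.range_subtype, Submodule.map_iSup] at h2
  refine h2.ge.trans (iSup_mono fun χ => ?_)
  rintro _ ⟨x, hx, rfl⟩
  refine ⟨x.2, ?_⟩
  rw [SetLike.mem_coe, Submodule.mem_iInf] at hx ⊢
  intro i
  have := Module.End.mem_eigenspace_iff.1 (hx i)
  rw [Module.End.mem_eigenspace_iff]
  exact congrArg Subtype.val this

end JointEigenspaces

/-! ### Restricted roots, and standard parabolic subalgebras as graded parts. -/

section Roots

variable {E : Type*} [NormedAddCommGroup E] [NormedSpace ℝ E] [FiniteDimensional ℝ E]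
  {V : Type*} [NormedAddCommGroup V] [InnerProductSpace ℝ V] [FiniteDimensional ℝ V]
  {G : Type*} [TopologicalSpace G] [ChartedSpace E G] [Group G] [LieGroup 𝓘(ℝ, E) ∞ G]
  {ρ : G →* (V →L[ℝ] V)ˣ}

/-- The trace on `End V`. -/
noncomputable def opTrace (V : Type*) [NormedAddCommGroup V] [InnerProductSpace ℝ V] [FiniteDimensional ℝ V] :
    (V →L[ℝ] V) →ₗ[ℝ] ℝ :=
  LinearMap.trace ℝ V ∘ₗ ContinuousLinearMap.coeLM ℝ

theorem opTrace_apply (X : V →L[ℝ] V) : opTrace V X =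
    ∑ i, inner ℝ (stdOrthonormalBasis ℝ V i) (X (stdOrthonormalBasis ℝ V i)) :=
  LinearMap.trace_eq_sum_inner _ (stdOrthonormalBasis ℝ V)

theorem isPosTrace_opTrace : IsPosTrace (opTrace V) where
  map_mul_comm X Y := LinearMap.trace_mul_comm ℝ (X : V →ₗ[ℝ] V) (Y : V →ₗ[ℝ] V)
  map_star X := by
    rw [opTrace_apply, opTrace_apply]
    refine Finset.sum_congr rfl fun i _ => ?_
    rw [ContinuousLinearMap.star_eq_adjoint, ContinuousLinearMap.adjoint_inner_right,
      real_inner_comm]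
  pos X hX := by
    rw [opTrace_apply]
    have h1 : ∀ i, inner ℝ (stdOrthonormalBasis ℝ V i)
        ((star X * X) (stdOrthonormalBasis ℝ V i)) = ‖X (stdOrthonormalBasis ℝ V i)‖ ^ 2 := by
      intro i
      rw [ContinuousLinearMap.star_eq_adjoint, ContinuousLinearMap.mul_apply,
        ContinuousLinearMap.adjoint_inner_right, real_inner_self_eq_norm_sq]
    simp_rw [h1]
    refine lt_of_le_of_ne (Finset.sum_nonneg fun i _ => by positivity) fun h0 => hX ?_
    rw [eq_comm, Finset.sum_eq_zero_iff_of_nonneg fun i _ => by positivity] at h0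
    have h2 : (X : V →ₗ[ℝ] V) = 0 := by
      refine (stdOrthonormalBasis ℝ V).toBasis.ext fun i => ?_
      simpa using h0 i (Finset.mem_univ i)
    ext v
    exact LinearMap.congr_fun h2 v

variable {𝔞 : Submodule ℝ (V →L[ℝ] V)}

theorem mem_rootSpace {α : Module.Dual ℝ 𝔞} {X : V →L[ℝ] V} :
    X ∈ rootSpace (E := E) ρ 𝔞 α ↔
      X ∈ lieAlg (E := E) ρ ∧ ∀ a : 𝔞, adMap (a : V →L[ℝ] V) X = α a • X := Iff.rfl

theorem star_mem_rootSpace (hρ : IsLinearReductive (E := E) ρ)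
    (ha : ∀ a ∈ 𝔞, ContinuousLinearMap.adjoint a = a) {α : Module.Dual ℝ 𝔞} {X : V →L[ℝ] V}
    (hX : X ∈ rootSpace (E := E) ρ 𝔞 α) : star X ∈ rootSpace (E := E) ρ 𝔞 (-α) := by
  rw [mem_rootSpace] at hX ⊢
  refine ⟨adjoint_mem_lieAlg hρ hX.1, fun a => ?_⟩
  have h := congrArg star (hX.2 a)
  have ha' : star (a : V →L[ℝ] V) = a := ha a a.2
  simp only [adMap_apply, star_sub, star_mul, ha', star_smul, star_trivial] at h
  rw [adMap_apply, LinearMap.neg_apply, neg_smul, ← h, neg_sub]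

/-- A subspace of `𝔤` stable under `ad 𝔞` is spanned by root vectors. -/
theorem le_iSup_inf_rootSpace (ha : ∀ a ∈ 𝔞, ContinuousLinearMap.adjoint a = a)
    (hcomm : ∀ X ∈ 𝔞, ∀ Y ∈ 𝔞, X * Y = Y * X) {U : Submodule ℝ (V →L[ℝ] V)}
    (hUg : U ≤ lieAlg (E := E) ρ) (hU : ∀ a ∈ 𝔞, ∀ x ∈ U, adMap a x ∈ U) :
    U ≤ ⨆ α : Module.Dual ℝ 𝔞, U ⊓ rootSpace (E := E) ρ 𝔞 α := by
  refine (isPosTrace_opTrace.le_iSup_joint (fun a : 𝔞 => (a : V →L[ℝ] V)) (fun a => ha a a.2)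
    (fun a => hU a a.2) (fun a b => hcomm a a.2 b b.2)).trans (iSup_le fun χ x hx => ?_)
  obtain ⟨hxU, hx⟩ := hx
  rw [SetLike.mem_coe, Submodule.mem_iInf] at hx
  have hx' : ∀ a : 𝔞, adMap (a : V →L[ℝ] V) x = χ a • x := fun a =>
    Module.End.mem_eigenspace_iff.1 (hx a)
  by_cases hx0 : x = 0
  · rw [hx0]; exact zero_mem _
  -- The joint eigenvalue is a priori a mere function on 𝔞; a nonzero joint eigenvector forces it to
  -- be linear.
  have hadd : ∀ a b : 𝔞, χ (a + b) = χ a + χ b := by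
    intro a b
    have h1 := hx' (a + b)
    have h2 : adMap ((a + b : 𝔞) : V →L[ℝ] V) x = adMap (a : V →L[ℝ] V) x + adMap (b : V →L[ℝ] V) x := by
      simp only [adMap_apply, Submodule.coe_add]; noncomm_ring
    rw [h2, hx', hx', ← add_smul] at h1
    exact (smul_left_injective ℝ hx0 h1).symm
  have hsmul : ∀ (r : ℝ) (a : 𝔞), χ (r • a) = r * χ a := by
    intro r a
    have h1 := hx' (r • a)
    have h2 : adMap ((r • a : 𝔞) : V →L[ℝ] V) x = r • adMap (a : V →L[ℝ] V) x := by
      simp only [adMap_apply, Submodule.coe_smul, smul_mul_assoc, mul_smul_comm, smul_sub]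
    rw [h2, hx', smul_smul] at h1
    exact (smul_left_injective ℝ hx0 h1).symm
  let α : Module.Dual ℝ 𝔞 := { toFun := χ, map_add' := hadd, map_smul' := fun r a => by simp [hsmul] }
  exact Submodule.mem_iSup_of_mem α ⟨hxU, mem_rootSpace.2 ⟨hUg hxU, hx'⟩⟩

/-- Linear independence allows the values of the simple roots to be prescribed by an element of the
bidual, which is evaluation at a point of 𝔞. The roots killed by this H will be those in the span of
Δ ∖ θ. -/
theorem exists_grading (Δ θ : Set (Module.Dual ℝ 𝔞)) (hΔ : LinearIndepOn ℝ id Δ) :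
    ∃ H : 𝔞, (∀ δ ∈ Δ ∩ θ, δ H = 1) ∧ ∀ δ ∈ Δ \ θ, δ H = 0 := by
  classical
  let b := Module.Basis.extend hΔ
  let φ : Module.Dual ℝ (Module.Dual ℝ 𝔞) :=
    b.constr ℝ fun i => if (i : Module.Dual ℝ 𝔞) ∈ θ then (1 : ℝ) else 0
  have hφ : ∀ δ ∈ Δ, φ δ = if δ ∈ θ then (1 : ℝ) else 0 := by
    intro δ hδ
    have h1 : δ ∈ hΔ.extend (Set.subset_univ _) := hΔ.subset_extend _ hδ
    have h2 := b.constr_basis ℝ (fun i => if (i : Module.Dual ℝ 𝔞) ∈ θ then (1 : ℝ) else 0) ⟨δ, h1⟩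
    rwa [Module.Basis.extend_apply_self] at h2
  refine ⟨(Module.evalEquiv ℝ 𝔞).symm φ, fun δ hδ => ?_, fun δ hδ => ?_⟩
  · rw [Module.apply_evalEquiv_symm_apply, hφ δ hδ.1, if_pos hδ.2]
  · rw [Module.apply_evalEquiv_symm_apply, hφ δ hδ.1, if_neg hδ.2]

variable {Δ θ : Set (Module.Dual ℝ 𝔞)}

theorem rootSpace_le_parabolicSubalgebra {α : Module.Dual ℝ 𝔞}
    (hα : α ∈ positiveRoots (E := E) ρ 𝔞 Δ) :
    rootSpace (E := E) ρ 𝔞 α ≤ parabolicSubalgebra (E := E) ρ 𝔞 Δ θ :=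
  (le_iSup₂ (f := fun α (_ : α ∈ positiveRoots (E := E) ρ 𝔞 Δ) => rootSpace (E := E) ρ 𝔞 α) α
    hα).trans (le_sup_right.trans le_sup_left)

theorem rootSpace_neg_le_parabolicSubalgebra {α : Module.Dual ℝ 𝔞}
    (hα : α ∈ positiveRoots (E := E) ρ 𝔞 Δ ∩ (Submodule.span ℝ (Δ \ θ) : Set (Module.Dual ℝ 𝔞))) :
    rootSpace (E := E) ρ 𝔞 (-α) ≤ parabolicSubalgebra (E := E) ρ 𝔞 Δ θ :=
  (le_iSup₂ (f := fun α (_ : α ∈ positiveRoots (E := E) ρ 𝔞 Δ ∩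
    (Submodule.span ℝ (Δ \ θ) : Set (Module.Dual ℝ 𝔞))) => rootSpace (E := E) ρ 𝔞 (-α)) α
    hα).trans le_sup_right

theorem rootSpace_neg_le_oppositeParabolicSubalgebra {α : Module.Dual ℝ 𝔞}
    (hα : α ∈ positiveRoots (E := E) ρ 𝔞 Δ) :
    rootSpace (E := E) ρ 𝔞 (-α) ≤ oppositeParabolicSubalgebra (E := E) ρ 𝔞 Δ θ :=
  (le_iSup₂ (f := fun α (_ : α ∈ positiveRoots (E := E) ρ 𝔞 Δ) => rootSpace (E := E) ρ 𝔞 (-α)) α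
    hα).trans (le_sup_right.trans le_sup_left)

theorem rootSpace_le_oppositeParabolicSubalgebra {α : Module.Dual ℝ 𝔞}
    (hα : α ∈ positiveRoots (E := E) ρ 𝔞 Δ ∩ (Submodule.span ℝ (Δ \ θ) : Set (Module.Dual ℝ 𝔞))) :
    rootSpace (E := E) ρ 𝔞 α ≤ oppositeParabolicSubalgebra (E := E) ρ 𝔞 Δ θ :=
  (le_iSup₂ (f := fun α (_ : α ∈ positiveRoots (E := E) ρ 𝔞 Δ ∩
    (Submodule.span ℝ (Δ \ θ) : Set (Module.Dual ℝ 𝔞))) => rootSpace (E := E) ρ 𝔞 α) α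
    hα).trans le_sup_right

/-- A standard parabolic subalgebra and its opposite are the nonnegative and the nonpositive part of
a grading. -/
theorem exists_parabolicSubalgebra_eq (hρ : IsLinearReductive (E := E) ρ)
    (h𝔞 : IsCartanSubspace (E := E) ρ 𝔞) (hΔ : IsSimpleSystem (E := E) ρ 𝔞 Δ) (hθ : θ ⊆ Δ) :
    ∃ H ∈ lieAlg (E := E) ρ, star H = H ∧
      parabolicSubalgebra (E := E) ρ 𝔞 Δ θ = nonnegPart (lieAlg (E := E) ρ) H ∧
      oppositeParabolicSubalgebra (E := E) ρ 𝔞 Δ θ = nonnegPart (lieAlg (E := E) ρ) (-H) := by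
  obtain ⟨⟨hag, ha, hcomm⟩, -⟩ := h𝔞
  obtain ⟨H, hH1, hH0⟩ := exists_grading Δ θ hΔ.linearIndepOn
  have hHg : (H : V →L[ℝ] V) ∈ lieAlg (E := E) ρ := hag H.2
  have hHs : star (H : V →L[ℝ] V) = H := ha H H.2
  have hst : ∀ x ∈ lieAlg (E := E) ρ, star x ∈ lieAlg (E := E) ρ := fun x hx =>
    adjoint_mem_lieAlg hρ hx
  have hgr : ∀ α : Module.Dual ℝ 𝔞,
      rootSpace (E := E) ρ 𝔞 α ≤ gradedPart (lieAlg (E := E) ρ) H (α H) := fun α X hX =>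
    mem_gradedPart.2 ⟨hX.1, hX.2 H⟩
  have hspan0 : ∀ α ∈ Submodule.span ℝ (Δ \ θ), α H = 0 := by
    intro α hα
    induction hα using Submodule.span_induction with
    | mem x hx => exact hH0 x hx
    | zero => simp
    | add x y _ _ hx hy => simp [hx, hy]
    | smul r x _ hx => simp [hx]
  -- A nonnegative combination of simple roots has value at H equal to the sum of its coefficients
  -- along θ, so it vanishes only if all these coefficients do.
  have hspan : ∀ α ∈ Submodule.span ℝ≥0 Δ,
      0 ≤ α H ∧ (α H = 0 → α ∈ Submodule.span ℝ (Δ \ θ)) := by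
    intro α hα
    induction hα using Submodule.span_induction with
    | mem x hx =>
      by_cases hxθ : x ∈ θ
      · rw [hH1 x ⟨hx, hxθ⟩]
        exact ⟨zero_le_one, fun h => absurd h one_ne_zero⟩
      · rw [hH0 x ⟨hx, hxθ⟩]
        exact ⟨le_rfl, fun _ => Submodule.subset_span ⟨hx, hxθ⟩⟩
    | zero => exact ⟨by simp, fun _ => zero_mem _⟩
    | add x y _ _ hx hy =>
      rw [LinearMap.add_apply]
      refine ⟨add_nonneg hx.1 hy.1, fun h => ?_⟩
      obtain ⟨h1, h2⟩ := (add_eq_zero_iff_of_nonneg hx.1 hy.1).1 h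
      exact add_mem (hx.2 h1) (hy.2 h2)
    | smul r x _ hx =>
      have h1 : (r • x) H = (r : ℝ) * x H := rfl
      rw [h1]
      refine ⟨mul_nonneg r.2 hx.1, fun h => ?_⟩
      rcases mul_eq_zero.1 h with h | h
      · have : r = 0 := by exact_mod_cast h
        rw [this, zero_smul]; exact zero_mem _
      · exact Submodule.smul_mem _ (r : ℝ) (hx.2 h)
  have hpar : parabolicSubalgebra (E := E) ρ 𝔞 Δ θ = nonnegPart (lieAlg (E := E) ρ) H := by
    apply le_antisymm
    · refine sup_le (sup_le ?_ (iSup₂_le fun α hα => ?_)) (iSup₂_le fun α hα => ?_)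
      · exact (hgr 0).trans (gradedPart_le_nonnegPart (by simp))
      · exact (hgr α).trans (gradedPart_le_nonnegPart (hspan α hα.2).1)
      · exact (hgr (-α)).trans (gradedPart_le_nonnegPart (by simp [hspan0 α hα.2]))
    · refine iSup₂_le fun κ hκ => ?_
      refine (le_iSup_inf_rootSpace ha hcomm (gradedPart_le κ) fun a haa x hx => ?_).trans
        (iSup_le fun α x hx => ?_)
      · have h1 : a ∈ gradedPart (lieAlg (E := E) ρ) (H : V →L[ℝ] V) 0 :=
          mem_gradedPart.2 ⟨hag haa, by rw [adMap_apply, hcomm H H.2 a haa, sub_self, zero_smul]⟩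
        simpa using adMap_mem_gradedPart (fun x hx y hy => bracket_mem_lieAlg hρ hx hy) h1 hx
      · obtain ⟨hx1, hx2⟩ := hx
        by_cases hx0 : x = 0
        · rw [hx0]; exact zero_mem _
        have hαH : α H = κ := by
          have h1 := (mem_gradedPart.1 hx1).2
          have h2 := (mem_rootSpace.1 hx2).2 H
          rw [h1] at h2
          exact (smul_left_injective ℝ hx0 h2).symm
        by_cases hα0 : α = 0
        · rw [hα0] at hx2
          exact (le_sup_left.trans le_sup_left : _ ≤ parabolicSubalgebra (E := E) ρ 𝔞 Δ θ) hx2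
        have hroot : α ∈ restrictedRoots (E := E) ρ 𝔞 :=
          ⟨hα0, fun hb => hx0 (by rw [hb] at hx2; exact (Submodule.mem_bot ℝ).1 hx2)⟩
        rcases hΔ.nonneg_or_nonpos α hroot with hp | hn
        · exact rootSpace_le_parabolicSubalgebra ⟨hroot, hp⟩ hx2
        -- A negative root with value κ ≥ 0 at H must have κ = 0, and then −α lies in the span of Δ
        -- ∖ θ.
        · have hnH := hspan _ hn
          rw [LinearMap.neg_apply, hαH] at hnH
          have hκ0 : -κ = 0 := le_antisymm (by linarith) hnH.1
          have hnroot : -α ∈ restrictedRoots (E := E) ρ 𝔞 := by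
            refine ⟨neg_ne_zero.2 hα0, fun hb => hx0 ?_⟩
            have h4 := star_mem_rootSpace hρ ha hx2
            rw [hb] at h4
            exact star_eq_zero.1 ((Submodule.mem_bot ℝ).1 h4)
          have h3 : rootSpace (E := E) ρ 𝔞 (- -α) ≤ parabolicSubalgebra (E := E) ρ 𝔞 Δ θ :=
            rootSpace_neg_le_parabolicSubalgebra ⟨⟨hnroot, hn⟩, hnH.2 hκ0⟩
          rw [neg_neg] at h3
          exact h3 hx2
  -- The statement for the opposite subalgebra is transported by the involution, which exchanges 𝔤_α
  -- and 𝔤_{−α}, and likewise degrees κ and −κ.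
  have hstarpar : ∀ x ∈ parabolicSubalgebra (E := E) ρ 𝔞 Δ θ,
      star x ∈ oppositeParabolicSubalgebra (E := E) ρ 𝔞 Δ θ := by
    have h1 : parabolicSubalgebra (E := E) ρ 𝔞 Δ θ ≤
        (oppositeParabolicSubalgebra (E := E) ρ 𝔞 Δ θ).comap
          (starLinearEquiv ℝ (A := V →L[ℝ] V)).toLinearMap := by
      refine sup_le (sup_le ?_ (iSup₂_le fun α hα => ?_)) (iSup₂_le fun α hα => ?_) <;>
        intro x hx <;> have h2 := star_mem_rootSpace hρ ha hx
      · rw [neg_zero] at h2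
        exact (le_sup_left.trans le_sup_left :
          _ ≤ oppositeParabolicSubalgebra (E := E) ρ 𝔞 Δ θ) h2
      · exact rootSpace_neg_le_oppositeParabolicSubalgebra hα h2
      · rw [neg_neg] at h2
        exact rootSpace_le_oppositeParabolicSubalgebra hα h2
    exact fun x hx => h1 hx
  have hstaropp : ∀ x ∈ oppositeParabolicSubalgebra (E := E) ρ 𝔞 Δ θ,
      star x ∈ parabolicSubalgebra (E := E) ρ 𝔞 Δ θ := by
    have h1 : oppositeParabolicSubalgebra (E := E) ρ 𝔞 Δ θ ≤
        (parabolicSubalgebra (E := E) ρ 𝔞 Δ θ).comap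
          (starLinearEquiv ℝ (A := V →L[ℝ] V)).toLinearMap := by
      refine sup_le (sup_le ?_ (iSup₂_le fun α hα => ?_)) (iSup₂_le fun α hα => ?_) <;>
        intro x hx <;> have h2 := star_mem_rootSpace hρ ha hx
      · rw [neg_zero] at h2
        exact (le_sup_left.trans le_sup_left :
          _ ≤ parabolicSubalgebra (E := E) ρ 𝔞 Δ θ) h2
      · rw [neg_neg] at h2
        exact rootSpace_le_parabolicSubalgebra hα h2
      · exact rootSpace_neg_le_parabolicSubalgebra hα h2
    exact fun x hx => h1 hx
  refine ⟨H, hHg, hHs, hpar, ?_⟩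
  ext x
  constructor
  · intro hx
    have h1 := hstaropp x hx
    rw [hpar] at h1
    simpa using star_mem_nonnegPart hst hHs h1
  · intro hx
    have h1 := star_mem_nonnegPart (H := -(H : V →L[ℝ] V)) hst (by simp [hHs]) hx
    rw [neg_neg, ← hpar] at h1
    simpa using hstarpar _ h1

end Roots

/-! ### Exponentials of operators, and Ad(exp X) = exp(ad X). -/

section ExpOperators

theorem hasSum_map_exp {A W : Type*} [NormedRing A] [NormedAlgebra ℝ A] [CompleteSpace A]
    [NormedAddCommGroup W] [NormedSpace ℝ W] (L : A →L[ℝ] W) (x : A) :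
    HasSum (fun n : ℕ => (n.factorial : ℝ)⁻¹ • L (x ^ n)) (L (exp x)) := by
  have h := L.hasSum (exp_series_hasSum_exp' (𝕂 := ℝ) x)
  simpa only [map_smul, Function.comp_def] using h

theorem hasDerivAt_exp_neg_smul {A : Type*} [NormedRing A] [NormedAlgebra ℝ A] [CompleteSpace A]
    (X : A) (t : ℝ) : HasDerivAt (fun t : ℝ => exp (-t • X)) (-(exp (-t • X) * X)) t := by
  have := hasDerivAt_exp_smul_const (𝕂 := ℝ) (-X) t
  simpa using this

theorem exp_zero_smul {A : Type*} [NormedRing A] [NormedAlgebra ℝ A] (X : A) :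
    exp (-(0 : ℝ) • X) = 1 := by simp

/-- The exponential of an operator acts on an eigenvector by the exponential of the eigenvalue. -/
theorem exp_apply_eigenvector {W : Type*} [NormedAddCommGroup W] [NormedSpace ℝ W] [CompleteSpace W]
    {T : W →L[ℝ] W} {v : W} {c : ℝ} (h : T v = c • v) : exp T v = Real.exp c • v := by
  have h1 : HasSum (fun n : ℕ => (n.factorial : ℝ)⁻¹ • (T ^ n) v) (exp T v) :=
    hasSum_map_exp (ContinuousLinearMap.apply ℝ W v) T
  have h2 : HasSum (fun n : ℕ => ((n.factorial : ℝ)⁻¹ • c ^ n) • v) (exp c • v) :=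
    ((exp_series_hasSum_exp' (𝕂 := ℝ) c).smul_const v)
  rw [Real.exp_eq_exp_ℝ]
  refine h1.unique ?_
  convert h2 using 2 with n
  have h3 : (T ^ n) v = c ^ n • v := by
    induction n with
    | zero => simp
    | succ n ih => rw [pow_succ, ContinuousLinearMap.mul_apply, h, map_smul, ih, smul_smul, pow_succ,
        mul_comm]
  rw [h3, smul_smul, smul_eq_mul]

theorem exp_apply_mem {W : Type*} [NormedAddCommGroup W] [NormedSpace ℝ W] [CompleteSpace W]
    {T : W →L[ℝ] W} {U : Submodule ℝ W} (hU : IsClosed (U : Set W)) (h : ∀ y ∈ U, T y ∈ U) {y : W}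
    (hy : y ∈ U) : exp T y ∈ U := by
  have h1 : HasSum (fun n : ℕ => (n.factorial : ℝ)⁻¹ • (T ^ n) y) (exp T y) :=
    hasSum_map_exp (ContinuousLinearMap.apply ℝ W y) T
  have h2 : ∀ n : ℕ, (T ^ n) y ∈ U := by
    intro n
    induction n with
    | zero => simpa
    | succ n ih => rw [pow_succ', ContinuousLinearMap.mul_apply]; exact h _ ih
  refine hU.mem_of_tendsto h1 (Eventually.of_forall fun s => Submodule.sum_mem _ fun n _ => ?_)
  exact Submodule.smul_mem _ _ (h2 n)

variable {A : Type*} [NormedRing A] [NormedAlgebra ℝ A] [CompleteSpace A]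

/-- Along the line tX both sides solve the same linear equation f' = T f; equivalently exp(−tT) f(t)
has zero derivative. -/
theorem exp_commutator_apply (X y : A) :
    exp (ContinuousLinearMap.mul ℝ A X - (ContinuousLinearMap.mul ℝ A).flip X) y =
      exp X * y * exp (-X) := by
  set T : A →L[ℝ] A := ContinuousLinearMap.mul ℝ A X - (ContinuousLinearMap.mul ℝ A).flip X with hT
  have hTapp : ∀ z, T z = X * z - z * X := fun z => rfl
  have hf : ∀ t : ℝ, HasDerivAt (fun t : ℝ => exp (t • X) * y * exp (-t • X))
      (T (exp (t • X) * y * exp (-t • X))) t := by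
    intro t
    have h1 := hasDerivAt_exp_smul_const' (𝕂 := ℝ) X t
    have h2 := hasDerivAt_exp_neg_smul X t
    have h3 := (h1.mul_const y).mul h2
    rw [hTapp]
    have h4 : X * exp (t • X) * y * exp (-t • X) + exp (t • X) * y * -(exp (-t • X) * X) =
        X * (exp (t • X) * y * exp (-t • X)) - exp (t • X) * y * exp (-t • X) * X := by
      noncomm_ring
    rw [h4] at h3
    exact h3
  have hh : ∀ t : ℝ, HasDerivAt
      (fun t : ℝ => exp (-t • T) (exp (t • X) * y * exp (-t • X))) 0 t := by
    intro t
    have h2 : HasDerivAt (fun t : ℝ => exp (-t • T)) (-(exp (-t • T) * T)) t :=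
      hasDerivAt_exp_neg_smul T t
    have h3 := h2.clm_apply (hf t)
    have h4 : (-(exp (-t • T) * T)) (exp (t • X) * y * exp (-t • X)) +
        exp (-t • T) (T (exp (t • X) * y * exp (-t • X))) = 0 := by
      simp
    rw [h4] at h3
    exact h3
  have hconst := is_const_of_deriv_eq_zero (fun t => (hh t).differentiableAt)
    (fun t => (hh t).deriv) 1 0
  have h5 : exp ((1 : ℝ) • T) (exp (-(1 : ℝ) • T) (exp ((1 : ℝ) • X) * y * exp (-(1 : ℝ) • X))) =
      exp ((1 : ℝ) • X) * y * exp (-(1 : ℝ) • X) :=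
    DFunLike.congr_fun (exp_smul_mul_exp_neg_smul (1 : ℝ) T) _
  have h6 : exp (-(0 : ℝ) • T) (exp ((0 : ℝ) • X) * y * exp (-(0 : ℝ) • X)) = y := by
    rw [show exp (-(0 : ℝ) • T) = 1 from exp_zero_smul T]
    simp
  rw [hconst, h6, one_smul] at h5
  rw [h5, one_smul, neg_smul, one_smul]

/-- A closed subspace stable under the commutator with `X` is stable under conjugation by
`exp X`. -/
theorem exp_conj_mem {X y : A} {U : Submodule ℝ A} (hU : IsClosed (U : Set A))
    (h : ∀ z ∈ U, adMap X z ∈ U) (hy : y ∈ U) : exp X * y * exp (-X) ∈ U := by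
  rw [← exp_commutator_apply]
  exact exp_apply_mem hU h hy

end ExpOperators

/-! ### The dynamics of conjugation by exp(tK), in an eigenbasis of K. -/

section Entries

variable {V : Type*} [NormedAddCommGroup V] [InnerProductSpace ℝ V] [FiniteDimensional ℝ V]
  {ι : Type*} [Fintype ι]

/-- The matrix entries of an operator in an orthonormal basis. -/
noncomputable def entries (b : OrthonormalBasis ι ℝ V) : (V →L[ℝ] V) →ₗ[ℝ] (ι → ι → ℝ) where
  toFun T i j := inner ℝ (b i) (T (b j))
  map_add' S T := by ext i j; simp [inner_add_right]
  map_smul' r T := by ext i j; simp [inner_smul_right]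

theorem entries_apply (b : OrthonormalBasis ι ℝ V) (T : V →L[ℝ] V) (i j : ι) :
    entries b T i j = inner ℝ (b i) (T (b j)) := rfl

theorem entries_injective (b : OrthonormalBasis ι ℝ V) : Function.Injective (entries b) := by
  rw [← LinearMap.ker_eq_bot, LinearMap.ker_eq_bot']
  intro T hT
  have h2 : (T : V →ₗ[ℝ] V) = 0 := by
    refine b.toBasis.ext fun j => ?_
    rw [OrthonormalBasis.coe_toBasis]
    refine b.toBasis.ext_elem fun i => ?_
    simp only [OrthonormalBasis.coe_toBasis_repr_apply, OrthonormalBasis.repr_apply_apply]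
    rw [LinearMap.zero_apply, inner_zero_right]
    exact congrFun (congrFun hT i) j
  ext v
  exact LinearMap.congr_fun h2 v

theorem isClosedEmbedding_entries (b : OrthonormalBasis ι ℝ V) :
    Topology.IsClosedEmbedding (entries b) :=
  LinearMap.isClosedEmbedding_of_injective (LinearMap.ker_eq_bot.2 (entries_injective b))

theorem tendsto_iff_entries (b : OrthonormalBasis ι ℝ V) {α : Type*} {l : Filter α}
    {f : α → V →L[ℝ] V} {T : V →L[ℝ] V} :
    Tendsto f l (𝓝 T) ↔ ∀ i j, Tendsto (fun x => entries b (f x) i j) l (𝓝 (entries b T i j)) := by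
  rw [(isClosedEmbedding_entries b).isInducing.tendsto_nhds_iff]
  simp only [tendsto_pi_nhds]
  rfl

theorem entries_mul (b : OrthonormalBasis ι ℝ V) (S T : V →L[ℝ] V) (i j : ι) :
    entries b (S * T) i j = ∑ k, entries b S i k * entries b T k j := by
  simp only [entries_apply, ContinuousLinearMap.mul_apply]
  rw [← ContinuousLinearMap.adjoint_inner_left, ← b.sum_inner_mul_inner]
  refine Finset.sum_congr rfl fun k _ => ?_
  rw [ContinuousLinearMap.adjoint_inner_left]

theorem entries_one (b : OrthonormalBasis ι ℝ V) [DecidableEq ι] (i j : ι) :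
    entries b 1 i j = if i = j then 1 else 0 := by
  rw [entries_apply, ContinuousLinearMap.one_apply, orthonormal_iff_ite.1 b.orthonormal]

variable {b : OrthonormalBasis ι ℝ V} {s : ι → ℝ} {K : V →L[ℝ] V}

theorem entries_mul_left (hK : ∀ i, K (b i) = s i • b i) (hs : star K = K) (T : V →L[ℝ] V)
    (i j : ι) : entries b (K * T) i j = s i * entries b T i j := by
  rw [entries_apply, entries_apply, ContinuousLinearMap.mul_apply, ← hs,
    ContinuousLinearMap.star_eq_adjoint, ContinuousLinearMap.adjoint_inner_right, hK,
    real_inner_smul_left]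

theorem entries_mul_right (hK : ∀ i, K (b i) = s i • b i) (T : V →L[ℝ] V)
    (i j : ι) : entries b (T * K) i j = entries b T i j * s j := by
  rw [entries_apply, entries_apply, ContinuousLinearMap.mul_apply, hK, map_smul,
    real_inner_smul_right, mul_comm]

/-- All the limits below are read off this formula as t → +∞: entries with s i > s j are contracted,
those with s i = s j are fixed, and those with s i < s j blow up unless they vanish. -/
theorem entries_exp_conj (hK : ∀ i, K (b i) = s i • b i) (hs : star K = K) (T : V →L[ℝ] V)
    (t : ℝ) (i j : ι) :
    entries b (exp (-t • K) * T * exp (t • K)) i j =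
      Real.exp (t * (s j - s i)) * entries b T i j := by
  have h1 : ∀ r : ℝ, ∀ i, exp (r • K) (b i) = Real.exp (r * s i) • b i := fun r i =>
    exp_apply_eigenvector (by rw [ContinuousLinearMap.smul_apply, hK, smul_smul])
  have h2 : star (exp (-t • K)) = exp (-t • K) := by
    rw [star_exp]; simp [hs]
  rw [entries_mul_right (s := fun i => Real.exp (t * s i)) (h1 t),
    entries_mul_left (s := fun i => Real.exp (-t * s i)) (h1 (-t)) h2]
  rw [mul_right_comm, ← Real.exp_add]
  ring_nf

/-- An element of positive degree is strictly block triangular. -/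
theorem entries_eq_zero_of_mem_posPart (hK : ∀ i, K (b i) = s i • b i) (hs : star K = K)
    {𝔤 : Submodule ℝ (V →L[ℝ] V)} {N : V →L[ℝ] V} (hN : N ∈ posPart 𝔤 K) {i j : ι}
    (hij : s i ≤ s j) : entries b N i j = 0 := by
  have h : posPart 𝔤 K ≤ LinearMap.ker ((LinearMap.proj j ∘ₗ LinearMap.proj i :
      (ι → ι → ℝ) →ₗ[ℝ] ℝ) ∘ₗ entries b) := by
    refine iSup₂_le fun κ hκ x hx => ?_
    have h1 := (mem_gradedPart.1 hx).2
    have h2 := congrFun (congrFun (congrArg (entries b) h1) i) j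
    rw [adMap_apply, map_sub, map_smul, Pi.sub_apply, Pi.sub_apply, Pi.smul_apply, Pi.smul_apply,
      entries_mul_left hK hs, entries_mul_right hK, smul_eq_mul] at h2
    have h3 : (s i - s j - κ) * entries b x i j = 0 := by linarith
    exact (mul_eq_zero.1 h3).resolve_left (by linarith)
  exact h hN

/-- An operator that moves `K` by an element of positive degree is block triangular. -/
theorem entries_eq_zero_of_conj (hK : ∀ i, K (b i) = s i • b i) (hs : star K = K)
    {𝔤 : Submodule ℝ (V →L[ℝ] V)} {p : (V →L[ℝ] V)ˣ}
    (hp : (p : V →L[ℝ] V) * K * ↑p⁻¹ - K ∈ posPart 𝔤 K) {i j : ι} (hij : s i < s j) :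
    entries b p i j = 0 := by
  set N := (p : V →L[ℝ] V) * K * ↑p⁻¹ - K with hN
  have hpK : (p : V →L[ℝ] V) * K = K * p + N * p := by
    rw [hN, sub_mul, mul_assoc _ _ (p : V →L[ℝ] V), Units.inv_mul, mul_one]; abel
  by_contra hne
  -- Among the offending rows of column j, take one with s minimal. In that row N only involves
  -- indices of smaller s, where the entries of column j vanish by minimality; then p K = K p + N p
  -- gives (s j − s i₀) p i₀ j = 0.
  obtain ⟨i₀, hi₀, hmin⟩ := Finset.exists_min_image
    (Finset.univ.filter fun i => s i < s j ∧ entries b (p : V →L[ℝ] V) i j ≠ 0) s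
    ⟨i, by simpa using ⟨hij, hne⟩⟩
  simp only [Finset.mem_filter, Finset.mem_univ, true_and] at hi₀ hmin
  have h1 := congrFun (congrFun (congrArg (entries b) hpK) i₀) j
  rw [map_add, Pi.add_apply, Pi.add_apply, entries_mul_left hK hs, entries_mul_right hK,
    entries_mul] at h1
  have h2 : ∑ k, entries b N i₀ k * entries b (p : V →L[ℝ] V) k j = 0 := by
    refine Finset.sum_eq_zero fun k _ => ?_
    rcases le_or_gt (s i₀) (s k) with hk | hk
    · rw [entries_eq_zero_of_mem_posPart hK hs hp hk, zero_mul]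
    · by_contra hne'
      have h3 := hmin k ⟨hk.trans hi₀.1, (mul_ne_zero_iff.1 hne').2⟩
      exact absurd hk (not_lt.2 h3)
  rw [h2, add_zero] at h1
  have h4 : (s j - s i₀) * entries b (p : V →L[ℝ] V) i₀ j = 0 := by linarith
  exact (mul_ne_zero (sub_ne_zero.2 hi₀.1.ne') hi₀.2) h4

/-- Conjugating a block triangular operator by the contracting flow gives its block diagonal part
in the limit. -/
theorem exists_tendsto_exp_conj (hK : ∀ i, K (b i) = s i • b i) (hs : star K = K) {p : V →L[ℝ] V}
    (hp : ∀ i j, s i < s j → entries b p i j = 0) :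
    ∃ T : V →L[ℝ] V, Tendsto (fun t : ℝ => exp (-t • K) * p * exp (t • K)) atTop (𝓝 T) := by
  classical
  let w : ι → ι → ℝ := fun i j => if s i = s j then entries b p i j else 0
  have hw : Tendsto (fun t : ℝ => entries b (exp (-t • K) * p * exp (t • K))) atTop (𝓝 w) := by
    rw [tendsto_pi_nhds]
    intro i
    rw [tendsto_pi_nhds]
    intro j
    simp only [entries_exp_conj hK hs, w]
    rcases lt_trichotomy (s i) (s j) with h | h | h
    · simp [hp i j h]
    · simp [h]
    · rw [if_neg h.ne']
      have h1 : Tendsto (fun t : ℝ => Real.exp (t * (s j - s i))) atTop (𝓝 0) :=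
        Real.tendsto_exp_atBot.comp (tendsto_id.atTop_mul_const_of_neg (by linarith))
      simpa using h1.mul_const (entries b p i j)
  obtain ⟨T, hT⟩ := (isClosedEmbedding_entries b).isClosed_range.mem_of_tendsto hw
    (Eventually.of_forall fun t => ⟨_, rfl⟩)
  refine ⟨T, ?_⟩
  rw [(isClosedEmbedding_entries b).isInducing.tendsto_nhds_iff, hT]
  exact hw

/-- Being contracted to 1 amounts to finitely many equations on matrix entries, so the contracted
subgroup is closed. -/
theorem tendsto_exp_conj_one_iff (hK : ∀ i, K (b i) = s i • b i) (hs : star K = K)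
    {p : V →L[ℝ] V} [DecidableEq ι] :
    Tendsto (fun t : ℝ => exp (-t • K) * p * exp (t • K)) atTop (𝓝 1) ↔
      ∀ i j, s i ≤ s j → entries b p i j = if i = j then 1 else 0 := by
  rw [tendsto_iff_entries b]
  simp only [entries_exp_conj hK hs, entries_one]
  refine ⟨fun h i j hij => ?_, fun h i j => ?_⟩
  · have h1 := h i j
    rcases hij.eq_or_lt with h2 | h2
    · simp only [h2, sub_self, mul_zero, Real.exp_zero, one_mul] at h1
      exact tendsto_nhds_unique tendsto_const_nhds h1
    · have h3 : i ≠ j := fun h => by rw [h] at h2; exact lt_irrefl _ h2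
      rw [if_neg h3] at h1 ⊢
      -- Multiplying the convergent, exponentially scaled entry by the inverse factor shows that the
      -- constant entry tends to 0.
      have h4 : Tendsto (fun t : ℝ => Real.exp (-(t * (s j - s i)))) atTop (𝓝 0) :=
        Real.tendsto_exp_neg_atTop_nhds_zero.comp (tendsto_id.atTop_mul_const (by linarith))
      have h5 := h4.mul h1
      rw [zero_mul] at h5
      have h6 : (fun t : ℝ => Real.exp (-(t * (s j - s i))) *
          (Real.exp (t * (s j - s i)) * entries b p i j)) = fun _ => entries b p i j := by
        ext t
        rw [← mul_assoc, ← Real.exp_add, neg_add_cancel, Real.exp_zero, one_mul]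
      rw [h6] at h5
      exact tendsto_nhds_unique tendsto_const_nhds h5
  · rcases le_or_gt (s i) (s j) with h1 | h1
    · rw [h i j h1]
      by_cases hij : i = j
      · simp [hij]
      · simp [hij]
    · have h3 : i ≠ j := fun h => by rw [h] at h1; exact lt_irrefl _ h1
      rw [if_neg h3]
      have h4 : Tendsto (fun t : ℝ => Real.exp (t * (s j - s i))) atTop (𝓝 0) :=
        Real.tendsto_exp_atBot.comp (tendsto_id.atTop_mul_const_of_neg (by linarith))
      simpa using h4.mul_const (entries b p i j)

theorem tendsto_exp_conj_zero (hK : ∀ i, K (b i) = s i • b i) (hs : star K = K)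
    {𝔤 : Submodule ℝ (V →L[ℝ] V)} {N : V →L[ℝ] V} (hN : N ∈ posPart 𝔤 K) :
    Tendsto (fun t : ℝ => exp (-t • K) * N * exp (t • K)) atTop (𝓝 0) := by
  rw [tendsto_iff_entries b]
  simp only [entries_exp_conj hK hs, map_zero, Pi.zero_apply]
  intro i j
  rcases le_or_gt (s i) (s j) with h1 | h1
  · simp [entries_eq_zero_of_mem_posPart hK hs hN h1]
  · have h4 : Tendsto (fun t : ℝ => Real.exp (t * (s j - s i))) atTop (𝓝 0) :=
      Real.tendsto_exp_atBot.comp (tendsto_id.atTop_mul_const_of_neg (by linarith))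
    simpa using h4.mul_const (entries b N i j)

/-- A self-adjoint operator has an orthonormal basis of eigenvectors. -/
theorem exists_eigenbasis (hs : star K = K) :
    ∃ (b : OrthonormalBasis (Fin (Module.finrank ℝ V)) ℝ V) (s : Fin (Module.finrank ℝ V) → ℝ),
      ∀ i, K (b i) = s i • b i := by
  have hsym : (K : V →ₗ[ℝ] V).IsSymmetric :=
    ContinuousLinearMap.isSelfAdjoint_iff_isSymmetric.1 hs
  exact ⟨hsym.eigenvectorBasis rfl, hsym.eigenvalues rfl, fun i =>
    hsym.apply_eigenvectorBasis rfl i⟩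

end Entries

/-- A pair of closed subgroups `P`, `Q` with a one-parameter group `a` in `P ∩ Q` that centralizes
`P ∩ Q` and contracts a nontrivial closed subgroup `U` of `P` with `P = U (P ∩ Q)`. -/
structure ContractingPair {G : Type*} [Group G] [TopologicalSpace G] (P Q U : Subgroup G)
    (a : ℝ → G) : Prop where
  continuous_flow : Continuous a
  flow_add : ∀ s t, a (s + t) = a s * a t
  flow_mem_left : ∀ t, a t ∈ P
  flow_mem_right : ∀ t, a t ∈ Q
  flow_comm : ∀ t, ∀ l ∈ P, l ∈ Q → a t * l = l * a t
  le_left : U ≤ P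
  isClosed_contracted : IsClosed (U : Set G)
  isClosed_right : IsClosed (Q : Set G)
  exists_eq_mul : ∀ p ∈ P, ∃ u ∈ U, ∃ l ∈ P, l ∈ Q ∧ p = u * l
  conj_mem : ∀ t, ∀ u ∈ U, (a t)⁻¹ * u * a t ∈ U
  tendsto_conj : ∀ u ∈ U, Tendsto (fun t => (a t)⁻¹ * u * a t) atTop (𝓝 1)
  isOpen_bigCell : IsOpen (bigCell P Q)
  ne_bot : U ≠ ⊥

/-! ### Conjugating contracting pairs, and openness of the big cell. -/

section Transport

variable {G : Type*} [Group G] [TopologicalSpace G] [IsTopologicalGroup G] {P Q U : Subgroup G}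
  {a : ℝ → G}

/-- Conjugation by `g` as a homeomorphism. -/
def conjHomeomorph (g : G) : G ≃ₜ G where
  toEquiv := (MulAut.conj g).toEquiv
  continuous_toFun := by
    change Continuous fun x : G => g * x * g⁻¹
    fun_prop
  continuous_invFun := by
    change Continuous fun x : G => g⁻¹ * x * g
    fun_prop

theorem coe_map_conj (g : G) (S : Subgroup G) :
    (S.map (MulAut.conj g).toMonoidHom : Set G) = conjHomeomorph g '' S := rfl

theorem bigCell_map_conj (g : G) (P Q : Subgroup G) :
    bigCell (P.map (MulAut.conj g).toMonoidHom) (Q.map (MulAut.conj g).toMonoidHom) =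
      conjHomeomorph g '' bigCell P Q := by
  ext x
  constructor
  · rintro ⟨_, ⟨p, hp, rfl⟩, _, ⟨q, hq, rfl⟩, rfl⟩
    exact ⟨p * q, ⟨p, hp, q, hq, rfl⟩, map_mul (MulAut.conj g) p q⟩
  · rintro ⟨_, ⟨p, hp, q, hq, rfl⟩, rfl⟩
    exact ⟨_, ⟨p, hp, rfl⟩, _, ⟨q, hq, rfl⟩, map_mul (MulAut.conj g) p q⟩

theorem ContractingPair.map_conj (h : ContractingPair P Q U a) (g : G) :
    ContractingPair (P.map (MulAut.conj g).toMonoidHom) (Q.map (MulAut.conj g).toMonoidHom)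
      (U.map (MulAut.conj g).toMonoidHom) (fun t => MulAut.conj g (a t)) where
  continuous_flow := (conjHomeomorph g).continuous.comp h.continuous_flow
  flow_add s t := by rw [h.flow_add, map_mul]
  flow_mem_left t := ⟨a t, h.flow_mem_left t, rfl⟩
  flow_mem_right t := ⟨a t, h.flow_mem_right t, rfl⟩
  flow_comm := by
    rintro t _ ⟨l, hl, rfl⟩ ⟨l', hl', hll⟩
    have hl2 : l' = l := (MulAut.conj g).injective hll
    subst hl2
    have := congrArg (MulAut.conj g) (h.flow_comm t l' hl hl')
    rwa [map_mul, map_mul] at this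
  le_left := Subgroup.map_mono h.le_left
  isClosed_contracted := by
    rw [coe_map_conj]
    exact (conjHomeomorph g).isClosedMap _ h.isClosed_contracted
  isClosed_right := by
    rw [coe_map_conj]
    exact (conjHomeomorph g).isClosedMap _ h.isClosed_right
  exists_eq_mul := by
    rintro _ ⟨p, hp, rfl⟩
    obtain ⟨u, hu, l, hl, hl', rfl⟩ := h.exists_eq_mul p hp
    exact ⟨_, ⟨u, hu, rfl⟩, _, ⟨l, hl, rfl⟩, ⟨l, hl', rfl⟩, map_mul _ _ _⟩
  conj_mem := by
    rintro t _ ⟨u, hu, rfl⟩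
    refine ⟨_, h.conj_mem t u hu, ?_⟩
    change MulAut.conj g _ = (MulAut.conj g _)⁻¹ * MulAut.conj g _ * MulAut.conj g _
    rw [map_mul, map_mul, map_inv]
  tendsto_conj := by
    rintro _ ⟨u, hu, rfl⟩
    have h1 := ((conjHomeomorph g).continuous.tendsto 1).comp (h.tendsto_conj u hu)
    have h2 : conjHomeomorph g 1 = 1 := map_one (MulAut.conj g)
    rw [h2] at h1
    refine h1.congr fun t => ?_
    change MulAut.conj g _ = (MulAut.conj g _)⁻¹ * MulAut.conj g _ * MulAut.conj g _
    rw [map_mul, map_mul, map_inv]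
  isOpen_bigCell := by
    rw [bigCell_map_conj]
    exact (conjHomeomorph g).isOpenMap _ h.isOpen_bigCell
  ne_bot := by
    rw [Ne, Subgroup.map_eq_bot_iff_of_injective _ (MulAut.conj g).injective]
    exact h.ne_bot

/-- The big cell is open as soon as it is a neighbourhood of the identity. -/
theorem isOpen_bigCell_of_mem_nhds (h : bigCell P Q ∈ 𝓝 (1 : G)) : IsOpen (bigCell P Q) := by
  rw [isOpen_iff_mem_nhds]
  rintro _ ⟨p, hp, q, hq, rfl⟩
  have h1 : Tendsto (fun x : G => p⁻¹ * x * q⁻¹) (𝓝 (p * q)) (𝓝 1) := by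
    have : Continuous fun x : G => p⁻¹ * x * q⁻¹ := by fun_prop
    simpa using this.tendsto (p * q)
  filter_upwards [h1 h]
  rintro x ⟨p', hp', q', hq', hx⟩
  refine ⟨p * p', P.mul_mem hp hp', q' * q, Q.mul_mem hq' hq, ?_⟩
  change p⁻¹ * x * q⁻¹ = p' * q' at hx
  have : x = p * (p⁻¹ * x * q⁻¹) * q := by group
  rw [this, hx]
  group

end Transport

/-! ### Limits and commutation for exponentials. -/

section ExpContinuity

variable {A : Type*} [NormedRing A] [NormedAlgebra ℝ A] [CompleteSpace A]

theorem continuous_exp_smul (X : A) : Continuous fun t : ℝ => exp (t • X) :=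
  continuous_iff_continuousAt.2 fun t => (hasDerivAt_exp_smul_const (𝕂 := ℝ) X t).continuousAt

theorem tendsto_exp_of_tendsto_zero {ι : Type*} {l : Filter ι} {f : ι → A}
    (h : Tendsto f l (𝓝 0)) : Tendsto (fun i => exp (f i)) l (𝓝 1) := by
  let : NormedAlgebra ℚ A := NormedAlgebra.restrictScalars ℚ ℝ A
  have := (exp_continuous (𝔸 := A)).tendsto 0
  rw [exp_zero] at this
  exact this.comp h

theorem exp_conj_exp (t : ℝ) (K X : A) :
    exp (exp (-t • K) * X * exp (t • K)) = exp (-t • K) * exp X * exp (t • K) := by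
  let : NormedAlgebra ℚ A := NormedAlgebra.restrictScalars ℚ ℝ A
  let u : Aˣ := ⟨exp (-t • K), exp (t • K), exp_neg_smul_mul_exp_smul t K,
    exp_smul_mul_exp_neg_smul t K⟩
  exact exp_units_conj u X

theorem eq_zero_of_exp_smul_eq_one {X : A} (h : ∀ t : ℝ, exp (t • X) = 1) : X = 0 := by
  have h1 := hasDerivAt_exp_smul_zero X
  rw [show (fun t : ℝ => exp (t • X)) = fun _ => 1 from funext h] at h1
  exact h1.unique (hasDerivAt_const _ _)

theorem commute_of_commute_exp_smul {X Y : A} (h : ∀ t : ℝ, exp (t • X) * Y = Y * exp (t • X)) :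
    X * Y = Y * X := by
  have h1 := hasDerivAt_exp_conj X Y
  have h2 : (fun t : ℝ => exp (t • X) * Y * exp (-t • X)) = fun _ => Y := by
    ext t
    rw [h, mul_assoc, exp_smul_mul_exp_neg_smul, mul_one]
  rw [h2] at h1
  exact sub_eq_zero.1 (h1.unique (hasDerivAt_const _ _))

theorem exp_smul_mul_comm {X Y : A} (h : X * Y = Y * X) (t : ℝ) :
    exp (t • X) * Y = Y * exp (t • X) := by
  let : NormedAlgebra ℚ A := NormedAlgebra.restrictScalars ℚ ℝ A
  have h1 : Commute X Y := h
  exact (h1.smul_left t).exp_left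

end ExpContinuity

/-! ### Normalizers in G of graded parts of the Lie algebra. -/

section Construction

variable {E : Type*} [NormedAddCommGroup E] [NormedSpace ℝ E] [FiniteDimensional ℝ E]
  {V : Type*} [NormedAddCommGroup V] [InnerProductSpace ℝ V] [FiniteDimensional ℝ V]
  {G : Type*} [TopologicalSpace G] [ChartedSpace E G] [Group G] [LieGroup 𝓘(ℝ, E) ∞ G]
  {ρ : G →* (V →L[ℝ] V)ˣ} {K : V →L[ℝ] V}

theorem val_inv_eq_exp {g : G} {X : V →L[ℝ] V} {t : ℝ} (h : (ρ g : V →L[ℝ] V) = exp (t • X)) :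
    (ρ g⁻¹ : V →L[ℝ] V) = exp (-t • X) := by
  rw [map_inv]
  refine (left_inv_eq_right_inv (a := (ρ g : V →L[ℝ] V)) (Units.inv_mul _) ?_)
  rw [h]
  exact exp_smul_mul_exp_neg_smul t X

theorem val_mul_val_inv (g : G) : (ρ g : V →L[ℝ] V) * (ρ g⁻¹ : V →L[ℝ] V) = 1 := by
  rw [map_inv]; exact Units.mul_inv _

theorem val_inv_mul_val (g : G) : (ρ g⁻¹ : V →L[ℝ] V) * (ρ g : V →L[ℝ] V) = 1 := by
  rw [map_inv]; exact Units.inv_mul _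

theorem mem_adNormalizer_of_forall {W : Submodule ℝ (V →L[ℝ] V)} {g : G}
    (h : ∀ X ∈ W, (ρ g : V →L[ℝ] V) * X * (ρ g⁻¹ : V →L[ℝ] V) ∈ W)
    (h' : ∀ X ∈ W, (ρ g⁻¹ : V →L[ℝ] V) * X * (ρ g : V →L[ℝ] V) ∈ W) : g ∈ adNormalizer ρ W := by
  intro X
  refine ⟨fun hX => ?_, h X⟩
  have h1 := h' _ hX
  have h2 : (ρ g⁻¹ : V →L[ℝ] V) * ((ρ g : V →L[ℝ] V) * X * (ρ g⁻¹ : V →L[ℝ] V)) *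
      (ρ g : V →L[ℝ] V) = X := by
    rw [mul_assoc (ρ g : V →L[ℝ] V), ← mul_assoc, val_inv_mul_val, one_mul, mul_assoc,
      val_inv_mul_val, mul_one]
  rwa [h2] at h1

theorem mem_adNormalizer_iff {W : Submodule ℝ (V →L[ℝ] V)} {g : G} :
    g ∈ adNormalizer ρ W ↔ (∀ X ∈ W, (ρ g : V →L[ℝ] V) * X * (ρ g⁻¹ : V →L[ℝ] V) ∈ W) ∧
      ∀ X ∈ W, (ρ g⁻¹ : V →L[ℝ] V) * X * (ρ g : V →L[ℝ] V) ∈ W := by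
  refine ⟨fun h => ⟨fun X hX => (h X).2 hX, fun X hX => ?_⟩,
    fun h => mem_adNormalizer_of_forall h.1 h.2⟩
  have h1 := ((adNormalizer ρ W).inv_mem h X).2 hX
  rwa [inv_inv] at h1

/-- The equivalence defining the normalizer is not visibly a closed condition, but stability of W
under both g and g⁻¹ is. -/
theorem isClosed_adNormalizer (hρ : IsLinearReductive (E := E) ρ) (W : Submodule ℝ (V →L[ℝ] V)) :
    IsClosed (adNormalizer ρ W : Set G) := by
  have : IsTopologicalGroup G := topologicalGroup_of_lieGroup 𝓘(ℝ, E) ∞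
  have hW : IsClosed (W : Set (V →L[ℝ] V)) := W.closed_of_finiteDimensional
  have hc := continuous_val hρ
  have hc' : Continuous fun g : G => (ρ g⁻¹ : V →L[ℝ] V) := hc.comp continuous_inv
  have h : (adNormalizer ρ W : Set G) =
      (⋂ X ∈ W, {g : G | (ρ g : V →L[ℝ] V) * X * (ρ g⁻¹ : V →L[ℝ] V) ∈ W}) ∩
      ⋂ X ∈ W, {g : G | (ρ g⁻¹ : V →L[ℝ] V) * X * (ρ g : V →L[ℝ] V) ∈ W} := by
    ext g
    simp only [SetLike.mem_coe, mem_adNormalizer_iff, Set.mem_inter_iff, Set.mem_iInter,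
      Set.mem_setOf_eq]
  rw [h]
  exact (isClosed_biInter fun X _ => hW.preimage ((hc.mul continuous_const).mul hc')).inter
    (isClosed_biInter fun X _ => hW.preimage ((hc'.mul continuous_const).mul hc))

theorem mem_adNormalizer_of_exp {W : Submodule ℝ (V →L[ℝ] V)} {X : V →L[ℝ] V} {g : G}
    (hg : (ρ g : V →L[ℝ] V) = exp X) (hX : ∀ Y ∈ W, adMap X Y ∈ W) : g ∈ adNormalizer ρ W := by
  have hW : IsClosed (W : Set (V →L[ℝ] V)) := W.closed_of_finiteDimensional
  have hg' : (ρ g : V →L[ℝ] V) = exp ((1 : ℝ) • X) := by rw [one_smul, hg]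
  have hi := val_inv_eq_exp hg'
  rw [neg_smul, one_smul] at hi
  refine mem_adNormalizer_of_forall (fun Y hY => ?_) (fun Y hY => ?_)
  · rw [hg, hi]
    exact exp_conj_mem hW hX hY
  · have h2 := exp_conj_mem (X := -X) hW (fun Z hZ => by
      rw [adMap_neg, LinearMap.neg_apply]; exact W.neg_mem (hX Z hZ)) hY
    rw [neg_neg] at h2
    rw [hg, hi]
    exact h2

theorem adNormalizer_lieAlg (hρ : IsLinearReductive (E := E) ρ) :
    adNormalizer ρ (lieAlg (E := E) ρ) = ⊤ := by
  rw [eq_top_iff]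
  intro g _
  refine mem_adNormalizer_of_forall (fun X hX => conj_mem_lieAlg hρ g hX) (fun X hX => ?_)
  have := conj_mem_lieAlg hρ g⁻¹ hX
  rwa [inv_inv] at this

theorem conj_mem_nonnegPart (hρ : IsLinearReductive (E := E) ρ) {l : G}
    (hl : K * (ρ l : V →L[ℝ] V) = (ρ l : V →L[ℝ] V) * K) {X : V →L[ℝ] V}
    (hX : X ∈ nonnegPart (lieAlg (E := E) ρ) K) :
    (ρ l : V →L[ℝ] V) * X * (ρ l⁻¹ : V →L[ℝ] V) ∈ nonnegPart (lieAlg (E := E) ρ) K := by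
  have hK : (ρ l : V →L[ℝ] V) * K * (ρ l⁻¹ : V →L[ℝ] V) = K := by
    rw [← hl, mul_assoc, val_mul_val_inv, mul_one]
  let c : (V →L[ℝ] V) →ₗ[ℝ] (V →L[ℝ] V) :=
    LinearMap.mulRight ℝ (ρ l⁻¹ : V →L[ℝ] V) ∘ₗ LinearMap.mulLeft ℝ (ρ l : V →L[ℝ] V)
  have h : nonnegPart (lieAlg (E := E) ρ) K ≤ (nonnegPart (lieAlg (E := E) ρ) K).comap c := by
    refine iSup₂_le fun κ hκ X hX => gradedPart_le_nonnegPart hκ ?_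
    rw [mem_gradedPart] at hX ⊢
    refine ⟨conj_mem_lieAlg hρ l hX.1, ?_⟩
    have h1 := adMap_units_conj (ρ l) K X
    rw [← map_inv, hK, hX.2] at h1
    change adMap K ((ρ l : V →L[ℝ] V) * X * (ρ l⁻¹ : V →L[ℝ] V)) =
      κ • ((ρ l : V →L[ℝ] V) * X * (ρ l⁻¹ : V →L[ℝ] V))
    rw [h1, mul_smul_comm, smul_mul_assoc]
  exact h hX

theorem mem_adNormalizer_of_comm (hρ : IsLinearReductive (E := E) ρ) {l : G}
    (hl : K * (ρ l : V →L[ℝ] V) = (ρ l : V →L[ℝ] V) * K) :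
    l ∈ adNormalizer ρ (nonnegPart (lieAlg (E := E) ρ) K) := by
  have hl' : K * (ρ l⁻¹ : V →L[ℝ] V) = (ρ l⁻¹ : V →L[ℝ] V) * K := by
    have h1 : K = (ρ l : V →L[ℝ] V) * K * (ρ l⁻¹ : V →L[ℝ] V) := by
      rw [← hl, mul_assoc, val_mul_val_inv, mul_one]
    conv_rhs => rw [h1, ← mul_assoc, ← mul_assoc, val_inv_mul_val, one_mul]
  refine mem_adNormalizer_of_forall (fun X hX => conj_mem_nonnegPart hρ hl hX) (fun X hX => ?_)
  have := conj_mem_nonnegPart hρ hl' hX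
  rwa [inv_inv] at this

end Construction

/-! ### From a grading element to a contracting pair. -/

section Construction

variable {E : Type*} [NormedAddCommGroup E] [NormedSpace ℝ E] [FiniteDimensional ℝ E]
  {V : Type*} [NormedAddCommGroup V] [InnerProductSpace ℝ V] [FiniteDimensional ℝ V]
  {G : Type*} [TopologicalSpace G] [ChartedSpace E G] [Group G] [LieGroup 𝓘(ℝ, E) ∞ G]
  {ρ : G →* (V →L[ℝ] V)ˣ} {K : V →L[ℝ] V}

/-- `K` is a grading element: the normalizer of its nonnegative part moves it only by elements of
positive degree. -/
structure IsGradingElement (E : Type*) [NormedAddCommGroup E] [NormedSpace ℝ E]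
    {V : Type*} [NormedAddCommGroup V] [InnerProductSpace ℝ V] [FiniteDimensional ℝ V]
    {G : Type*} [TopologicalSpace G] [ChartedSpace E G] [Group G]
    (ρ : G →* (V →L[ℝ] V)ˣ) (K : V →L[ℝ] V) : Prop where
  mem : K ∈ lieAlg (E := E) ρ
  star_eq : star K = K
  conj_sub_mem : ∀ g ∈ adNormalizer ρ (nonnegPart (lieAlg (E := E) ρ) K),
    (ρ g : V →L[ℝ] V) * K * (ρ g⁻¹ : V →L[ℝ] V) - K ∈ posPart (lieAlg (E := E) ρ) K

theorem mem_gradedPart_zero {𝔤 : Submodule ℝ (V →L[ℝ] V)} (hK : K ∈ 𝔤) :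
    K ∈ gradedPart 𝔤 K 0 := by
  rw [mem_gradedPart, adMap_apply, sub_self, zero_smul]
  exact ⟨hK, rfl⟩

namespace IsGradingElement

/-- The Cartan involution g ↦ (g*)⁻¹ exchanges the normalizers of the nonnegative and nonpositive
parts, so the defining property of K passes to the opposite side. -/
theorem conj_sub_mem_neg (hρ : IsLinearReductive (E := E) ρ) (hK : IsGradingElement E ρ K) {q : G}
    (hq : q ∈ adNormalizer ρ (nonnegPart (lieAlg (E := E) ρ) (-K))) :
    (ρ q : V →L[ℝ] V) * K * (ρ q⁻¹ : V →L[ℝ] V) - K ∈ posPart (lieAlg (E := E) ρ) (-K) := by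
  have hst : ∀ X ∈ lieAlg (E := E) ρ, star X ∈ lieAlg (E := E) ρ := fun X hX =>
    adjoint_mem_lieAlg hρ hX
  have hsK : star (-K) = -K := by rw [star_neg, hK.star_eq]
  obtain ⟨g, hg⟩ := hρ.adjoint_mem q
  replace hg : (ρ g : V →L[ℝ] V) = star (ρ q : V →L[ℝ] V) := hg
  have hgi : (ρ g⁻¹ : V →L[ℝ] V) = star (ρ q⁻¹ : V →L[ℝ] V) := by
    refine (left_inv_eq_right_inv (a := (ρ g : V →L[ℝ] V)) (val_inv_mul_val g) ?_)
    rw [hg, ← star_mul, val_inv_mul_val, star_one]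
  have hmem : g⁻¹ ∈ adNormalizer ρ (nonnegPart (lieAlg (E := E) ρ) K) := by
    rw [mem_adNormalizer_iff] at hq
    refine mem_adNormalizer_of_forall (fun X hX => ?_) (fun X hX => ?_)
    · have h1 := star_mem_nonnegPart hst hsK (hq.1 _ (star_mem_nonnegPart hst hK.star_eq hX))
      rwa [neg_neg, star_mul, star_mul, star_star, ← hg, ← hgi, ← mul_assoc, ← inv_inv g,
        inv_inv g⁻¹] at h1
    · have h1 := star_mem_nonnegPart hst hsK (hq.2 _ (star_mem_nonnegPart hst hK.star_eq hX))
      rwa [neg_neg, star_mul, star_mul, star_star, ← hg, ← hgi, ← mul_assoc, ← inv_inv g,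
        inv_inv g⁻¹] at h1
  have h2 := star_mem_posPart hst hK.star_eq (hK.conj_sub_mem _ hmem)
  rwa [inv_inv, star_sub, star_mul, star_mul, hg, hgi, star_star, star_star, hK.star_eq,
    ← mul_assoc] at h2

/-- The difference l K l⁻¹ − K has both positive and negative degree, hence is zero. This is what
makes the flow on the big cell well defined, whatever the components of P ∩ Q. -/
theorem comm_of_mem (hρ : IsLinearReductive (E := E) ρ) (hK : IsGradingElement E ρ K) {l : G}
    (hP : l ∈ adNormalizer ρ (nonnegPart (lieAlg (E := E) ρ) K))
    (hQ : l ∈ adNormalizer ρ (nonnegPart (lieAlg (E := E) ρ) (-K))) :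
    K * (ρ l : V →L[ℝ] V) = (ρ l : V →L[ℝ] V) * K := by
  have hst : ∀ X ∈ lieAlg (E := E) ρ, star X ∈ lieAlg (E := E) ρ := fun X hX =>
    adjoint_mem_lieAlg hρ hX
  have hsK : star (-K) = -K := by rw [star_neg, hK.star_eq]
  have h1 := hK.conj_sub_mem l hP
  have h2 := star_mem_posPart hst hsK (hK.conj_sub_mem_neg hρ hQ)
  rw [neg_neg] at h2
  have h3 := isPosTrace_opTrace.eq_zero
    (isPosTrace_opTrace.trace_mul_posPart h2 (posPart_le_nonnegPart h1))
  rw [sub_eq_zero] at h3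
  conv_lhs => rw [← h3, mul_assoc, val_inv_mul_val, mul_one]

/-- The one-parameter group of a grading element. -/
theorem exists_flow (hρ : IsLinearReductive (E := E) ρ) (hK : IsGradingElement E ρ K) :
    ∃ a : ℝ → G, Continuous a ∧ (∀ s t, a (s + t) = a s * a t) ∧
      ∀ t, (ρ (a t) : V →L[ℝ] V) = exp (t • K) := by
  choose a ha using fun t => exists_eq_exp hρ hK.mem t
  refine ⟨a, ?_, fun s t => ?_, ha⟩
  · rw [continuous_iff_continuousAt]
    intro t
    refine (tendsto_iff_val hρ).2 ?_
    simp only [ha]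
    exact (continuous_exp_smul K).tendsto t
  · refine injective_of_isLinearReductive hρ (Units.ext ?_)
    rw [map_mul, Units.val_mul, ha, ha, ha]
    exact exp_add_smul s t K

/-- The conjugates of an element of the parabolic subgroup by the contracting flow converge. -/
theorem exists_tendsto (hρ : IsLinearReductive (E := E) ρ) (hK : IsGradingElement E ρ K)
    {a : ℝ → G} (ha : ∀ t, (ρ (a t) : V →L[ℝ] V) = exp (t • K)) {p : G}
    (hp : p ∈ adNormalizer ρ (nonnegPart (lieAlg (E := E) ρ) K)) :
    ∃ l : G, Tendsto (fun t => (a t)⁻¹ * p * a t) atTop (𝓝 l) := by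
  obtain ⟨b, s, hb⟩ := exists_eigenbasis hK.star_eq
  have hval : ∀ (g : G) (t : ℝ), (ρ ((a t)⁻¹ * g * a t) : V →L[ℝ] V) =
      exp (-t • K) * (ρ g : V →L[ℝ] V) * exp (t • K) := by
    intro g t
    rw [map_mul, map_mul, Units.val_mul, Units.val_mul, val_inv_eq_exp (ha t), ha]
  have hlim : ∀ g ∈ adNormalizer ρ (nonnegPart (lieAlg (E := E) ρ) K), ∃ T : V →L[ℝ] V,
      Tendsto (fun t : ℝ => exp (-t • K) * (ρ g : V →L[ℝ] V) * exp (t • K)) atTop (𝓝 T) := by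
    intro g hg
    refine exists_tendsto_exp_conj hb hK.star_eq fun i j hij => ?_
    refine entries_eq_zero_of_conj hb hK.star_eq (𝔤 := lieAlg (E := E) ρ) ?_ hij
    have := hK.conj_sub_mem g hg
    rwa [map_inv] at this
  obtain ⟨T, hT⟩ := hlim p hp
  -- The conjugates of p⁻¹ converge too, so the limit T is invertible; the closed range of ρ then
  -- puts it in G.
  obtain ⟨T', hT'⟩ := hlim p⁻¹ (Subgroup.inv_mem _ hp)
  have key : ∀ (g : G) (t : ℝ), exp (-t • K) * (ρ g : V →L[ℝ] V) * exp (t • K) *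
      (exp (-t • K) * (ρ g⁻¹ : V →L[ℝ] V) * exp (t • K)) = 1 := by
    intro g t
    rw [← hval, ← hval, ← Units.val_mul, ← map_mul]
    have : (a t)⁻¹ * g * a t * ((a t)⁻¹ * g⁻¹ * a t) = 1 := by group
    rw [this, map_one, Units.val_one]
  have h1 : T * T' = 1 := by
    refine tendsto_nhds_unique (hT.mul hT') ?_
    simp only [key p]
    exact tendsto_const_nhds
  have h2 : T' * T = 1 := by
    refine tendsto_nhds_unique (hT'.mul hT) ?_
    have := key p⁻¹
    rw [inv_inv] at this
    simp only [this]
    exact tendsto_const_nhds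
  let u : (V →L[ℝ] V)ˣ := ⟨T, T', h1, h2⟩
  have h3 : Tendsto (fun t => ρ ((a t)⁻¹ * p * a t)) atTop (𝓝 u) := by
    rw [Units.isOpenEmbedding_val.isInducing.tendsto_nhds_iff]
    exact hT.congr fun t => (hval p t).symm
  obtain ⟨l, hl⟩ := hρ.isClosedEmbedding.isClosed_range.mem_of_tendsto h3
    (Eventually.of_forall fun t => ⟨_, rfl⟩)
  refine ⟨l, ?_⟩
  rw [hρ.isClosedEmbedding.isInducing.tendsto_nhds_iff, hl]
  exact h3

/-- The subgroup of the elements contracted by conjugation with the inverse flow. -/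
def contracted [IsTopologicalGroup G] (P : Subgroup G) (a : ℝ → G) : Subgroup G where
  carrier := {g | g ∈ P ∧ Tendsto (fun t => (a t)⁻¹ * g * a t) atTop (𝓝 1)}
  one_mem' := ⟨P.one_mem, by simpa using tendsto_const_nhds⟩
  mul_mem' := by
    rintro g h ⟨hg, hg'⟩ ⟨hh, hh'⟩
    refine ⟨P.mul_mem hg hh, ?_⟩
    have := hg'.mul hh'
    rw [mul_one] at this
    refine this.congr fun t => by group
  inv_mem' := by
    rintro g ⟨hg, hg'⟩
    refine ⟨P.inv_mem hg, ?_⟩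
    have := hg'.inv
    rw [inv_one] at this
    refine this.congr fun t => by group

/-- U consists of the elements of P contracted to 1. The Levi component of p is the limit l of its
conjugates, and p l⁻¹ is contracted. The big cell is open because the positive and nonpositive parts
together span 𝔤. If U were trivial, no positive degree would occur, hence by the involution no
negative one, and P would be all of G. -/
theorem contractingPair (hρ : IsLinearReductive (E := E) ρ) (hK : IsGradingElement E ρ K)
    (htop : adNormalizer ρ (nonnegPart (lieAlg (E := E) ρ) K) ≠ ⊤) :
    ∃ (U : Subgroup G) (a : ℝ → G),
      ContractingPair (adNormalizer ρ (nonnegPart (lieAlg (E := E) ρ) K))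
        (adNormalizer ρ (nonnegPart (lieAlg (E := E) ρ) (-K))) U a := by
  classical
  have : IsTopologicalGroup G := topologicalGroup_of_lieGroup 𝓘(ℝ, E) ∞
  have : T2Space G := hρ.isClosedEmbedding.isEmbedding.t2Space
  have hst : ∀ X ∈ lieAlg (E := E) ρ, star X ∈ lieAlg (E := E) ρ := fun X hX =>
    adjoint_mem_lieAlg hρ hX
  have hbr : ∀ X ∈ lieAlg (E := E) ρ, ∀ Y ∈ lieAlg (E := E) ρ, adMap X Y ∈ lieAlg (E := E) ρ :=
    fun X hX Y hY => bracket_mem_lieAlg hρ hX hY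
  have hsK : star (-K) = -K := by rw [star_neg, hK.star_eq]
  have hnegK : -K ∈ lieAlg (E := E) ρ := Submodule.neg_mem _ hK.mem
  obtain ⟨a, hcont, hadd, ha⟩ := hK.exists_flow hρ
  set P := adNormalizer ρ (nonnegPart (lieAlg (E := E) ρ) K) with hP
  set Q := adNormalizer ρ (nonnegPart (lieAlg (E := E) ρ) (-K)) with hQ
  have hKnn : K ∈ nonnegPart (lieAlg (E := E) ρ) K :=
    gradedPart_le_nonnegPart le_rfl (mem_gradedPart_zero hK.mem)
  have hKnn' : K ∈ nonnegPart (lieAlg (E := E) ρ) (-K) := by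
    have := gradedPart_le_nonnegPart le_rfl (mem_gradedPart_zero hnegK)
    simpa using Submodule.neg_mem _ this
  have haP : ∀ t, a t ∈ P := fun t => mem_adNormalizer_of_exp (ha t) fun Y hY =>
    adMap_mem_nonnegPart hbr (Submodule.smul_mem _ t hKnn) hY
  have haQ : ∀ t, a t ∈ Q := fun t => mem_adNormalizer_of_exp (ha t) fun Y hY =>
    adMap_mem_nonnegPart hbr (Submodule.smul_mem _ t hKnn') hY
  have hcomm : ∀ (l : G), K * (ρ l : V →L[ℝ] V) = (ρ l : V →L[ℝ] V) * K → ∀ t,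
      a t * l = l * a t := by
    intro l hl t
    refine injective_of_isLinearReductive hρ (Units.ext ?_)
    rw [map_mul, map_mul, Units.val_mul, Units.val_mul, ha]
    exact exp_smul_mul_comm hl t
  have hshift : ∀ (g : G) (s t : ℝ), (a (t + s))⁻¹ * g * a (t + s) =
      (a s)⁻¹ * ((a t)⁻¹ * g * a t) * a s := by
    intro g s t
    rw [hadd]; group
  have hval : ∀ (g : G) (t : ℝ), (ρ ((a t)⁻¹ * g * a t) : V →L[ℝ] V) =
      exp (-t • K) * (ρ g : V →L[ℝ] V) * exp (t • K) := by
    intro g t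
    rw [map_mul, map_mul, Units.val_mul, Units.val_mul, val_inv_eq_exp (ha t), ha]
  obtain ⟨b, s, hb⟩ := exists_eigenbasis hK.star_eq
  have hexpU : ∀ (g : G) (X : V →L[ℝ] V), X ∈ posPart (lieAlg (E := E) ρ) K →
      (ρ g : V →L[ℝ] V) = exp X → g ∈ contracted P a := by
    intro g X hX hg
    refine ⟨mem_adNormalizer_of_exp hg fun Y hY =>
      adMap_mem_nonnegPart hbr (posPart_le_nonnegPart hX) hY, ?_⟩
    rw [tendsto_iff_val hρ, map_one, Units.val_one]
    simp only [hval, hg]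
    have h1 := tendsto_exp_of_tendsto_zero (tendsto_exp_conj_zero hb hK.star_eq hX)
    refine h1.congr fun t => ?_
    exact exp_conj_exp t K X
  refine ⟨contracted P a, a, hcont, hadd, haP, haQ, fun t l hl hl' => ?_, fun u hu => hu.1, ?_,
    isClosed_adNormalizer hρ _, fun p hp => ?_, fun t u hu => ?_, fun u hu => hu.2, ?_, ?_⟩
  · exact hcomm l (hK.comm_of_mem hρ hl hl') t
  · have h1 : (contracted P a : Set G) = (P : Set G) ∩
        ⋂ (i) (j) (_ : s i ≤ s j), {g : G | entries b (ρ g : V →L[ℝ] V) i j =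
          if i = j then 1 else 0} := by
      ext g
      simp only [Set.mem_inter_iff, Set.mem_iInter, Set.mem_setOf_eq]
      rw [← tendsto_exp_conj_one_iff hb hK.star_eq]
      refine and_congr Iff.rfl ?_
      rw [tendsto_iff_val hρ, map_one, Units.val_one]
      simp only [hval]
    rw [h1]
    refine (isClosed_adNormalizer hρ _).inter (isClosed_iInter fun i => isClosed_iInter fun j =>
      isClosed_iInter fun _ => isClosed_eq ?_ continuous_const)
    have hc : Continuous fun g : G => entries b (ρ g : V →L[ℝ] V) :=
      (isClosedEmbedding_entries b).continuous.comp (continuous_val hρ)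
    exact (continuous_apply j).comp ((continuous_apply i).comp hc)
  · obtain ⟨l, hl⟩ := hK.exists_tendsto hρ ha hp
    -- Shifting time by r conjugates the family by a(r) without changing its limit, so l commutes
    -- with a(r).
    have h1 : ∀ t, a t * l = l * a t := by
      intro r
      have h2 : Tendsto (fun t => (a (t + r))⁻¹ * p * a (t + r)) atTop (𝓝 l) :=
        hl.comp (tendsto_atTop_add_const_right _ r tendsto_id)
      simp only [hshift] at h2
      have h3 := tendsto_nhds_unique h2 ((tendsto_const_nhds.mul hl).mul tendsto_const_nhds)
      rw [mul_assoc, eq_inv_mul_iff_mul_eq] at h3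
      exact h3
    have h2 : K * (ρ l : V →L[ℝ] V) = (ρ l : V →L[ℝ] V) * K := by
      refine commute_of_commute_exp_smul fun t => ?_
      have h3 := congrArg (fun g => (ρ g : V →L[ℝ] V)) (h1 t)
      simp only [map_mul, Units.val_mul, ha] at h3
      exact h3
    have h2' : -K * (ρ l : V →L[ℝ] V) = (ρ l : V →L[ℝ] V) * -K := by
      rw [neg_mul, mul_neg, h2]
    have hlP : l ∈ P := mem_adNormalizer_of_comm hρ h2
    refine ⟨p * l⁻¹, ⟨P.mul_mem hp (P.inv_mem hlP), ?_⟩, l, hlP, mem_adNormalizer_of_comm hρ h2',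
      by group⟩
    have h4 : Tendsto (fun t => (a t)⁻¹ * p * a t * l⁻¹) atTop (𝓝 1) := by
      have := hl.mul_const l⁻¹
      rwa [mul_inv_cancel] at this
    refine h4.congr fun t => ?_
    have h5 : a t * l⁻¹ = l⁻¹ * a t := by
      rw [mul_inv_eq_iff_eq_mul, mul_assoc, h1, inv_mul_cancel_left]
    rw [mul_assoc, h5]; group
  · refine ⟨P.mul_mem (P.mul_mem (P.inv_mem (haP t)) hu.1) (haP t), ?_⟩
    have h2 : Tendsto (fun r => (a (r + t))⁻¹ * u * a (r + t)) atTop (𝓝 1) :=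
      hu.2.comp (tendsto_atTop_add_const_right _ t tendsto_id)
    refine h2.congr fun r => ?_
    rw [add_comm, hadd]; group
  · refine isOpen_bigCell_of_mem_nhds ?_
    have hsup : lieAlg (E := E) ρ ≤ posPart (lieAlg (E := E) ρ) K ⊔
        nonnegPart (lieAlg (E := E) ρ) (-K) := by
      have := isPosTrace_opTrace.le_sup hbr hnegK hsK
      rwa [neg_neg, sup_comm] at this
    filter_upwards [eventually_eq_exp_mul_exp hρ posPart_le nonnegPart_le hsup]
    rintro g ⟨X, hX, Y, hY, hg⟩
    obtain ⟨u, hu⟩ := exists_eq_exp hρ (posPart_le hX) 1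
    obtain ⟨q, hq⟩ := exists_eq_exp hρ (nonnegPart_le hY) 1
    rw [one_smul] at hu hq
    refine ⟨u, (hexpU u X hX hu).1, q, mem_adNormalizer_of_exp hq fun Z hZ =>
      adMap_mem_nonnegPart hbr hY hZ, ?_⟩
    refine injective_of_isLinearReductive hρ (Units.ext ?_)
    rw [map_mul, Units.val_mul, hu, hq, hg]
  · intro hbot
    refine htop ?_
    -- Each exp(tX) with X of positive degree is the image of an element of U, so U = 1 forces
    -- exp(tX) = 1 for all t.
    have h1 : posPart (lieAlg (E := E) ρ) K = ⊥ := by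
      rw [eq_bot_iff]
      intro X hX
      refine eq_zero_of_exp_smul_eq_one fun t => ?_
      obtain ⟨g, hg⟩ := exists_eq_exp hρ (posPart_le hX) t
      have h2 := hexpU g (t • X) (Submodule.smul_mem _ t hX) hg
      rw [hbot, Subgroup.mem_bot] at h2
      rw [h2, map_one, Units.val_one] at hg
      exact hg.symm
    have h2 : posPart (lieAlg (E := E) ρ) (-K) = ⊥ := by
      rw [eq_bot_iff]
      intro X hX
      have h3 := star_mem_posPart hst hsK hX
      rw [neg_neg, h1, Submodule.mem_bot, star_eq_zero] at h3
      exact h3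
    have h4 : nonnegPart (lieAlg (E := E) ρ) K = lieAlg (E := E) ρ := by
      refine le_antisymm nonnegPart_le ?_
      have := isPosTrace_opTrace.le_sup hbr hK.mem hK.star_eq
      rwa [h2, sup_bot_eq] at this
    rw [hP, h4]
    exact adNormalizer_lieAlg hρ

end IsGradingElement

/-- Opposite parabolic subgroups form a contracting pair. -/
theorem AreOppositeParabolics.exists_contractingPair (hρ : IsLinearReductive (E := E) ρ)
    {P Q : Subgroup G} (h : AreOppositeParabolics (E := E) ρ P Q) (hP : P ≠ ⊤) :
    ∃ (U : Subgroup G) (a : ℝ → G), ContractingPair P Q U a := by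
  have : IsTopologicalGroup G := topologicalGroup_of_lieGroup 𝓘(ℝ, E) ∞
  obtain ⟨𝔞, Δ, θ, g, h𝔞, hΔ, hθ, rfl, rfl⟩ := h
  obtain ⟨H, hH, hsH, h1, h2⟩ := exists_parabolicSubalgebra_eq hρ h𝔞 hΔ hθ
  have hst : ∀ X ∈ lieAlg (E := E) ρ, star X ∈ lieAlg (E := E) ρ := fun X hX =>
    adjoint_mem_lieAlg hρ hX
  have hbr : ∀ X ∈ lieAlg (E := E) ρ, ∀ Y ∈ lieAlg (E := E) ρ, adMap X Y ∈ lieAlg (E := E) ρ :=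
    fun X hX Y hY => bracket_mem_lieAlg hρ hX hY
  obtain ⟨K, hKg, hsK, hnn, hnn', hpos, hmove⟩ :=
    isPosTrace_opTrace.exists_gradingElement hbr hst hH hsH
  have hK : IsGradingElement E ρ K := by
    refine ⟨hKg, hsK, fun p hp => ?_⟩
    have htop : p ∈ adNormalizer ρ (lieAlg (E := E) ρ) := by
      rw [adNormalizer_lieAlg hρ]; trivial
    have h3 := hmove (ρ p) (fun x => by have := htop x; rwa [map_inv] at this)
      (fun x => by have := hp x; rwa [map_inv, ← hnn] at this)
    rwa [hpos, ← map_inv] at h3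
  have hne : adNormalizer ρ (nonnegPart (lieAlg (E := E) ρ) K) ≠ ⊤ := by
    intro htop
    refine hP ?_
    rw [h1, hnn, htop]
    exact Subgroup.map_top_of_surjective _ (MulAut.conj g).surjective
  obtain ⟨U, a, hUa⟩ := hK.contractingPair hρ hne
  rw [h1, h2, hnn, hnn']
  exact ⟨_, _, hUa.map_conj g⟩

end Construction

open MeasureTheory MeasureTheory.Measure
open scoped Pointwise

/-! ### Vanishing criteria for the modular character. -/

section Modular

variable {G : Type*} [TopologicalSpace G] [Group G] [IsTopologicalGroup G] [LocallyCompactSpace G]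

/-- The modular character is invariant under topological automorphisms. -/
theorem modularCharacter_apply_equiv (σ : G ≃ₜ* G) (g : G) :
    modularCharacter (σ g) = modularCharacter g := by
  borelize G
  let ν := haar (G := G)
  have hσm : Measurable σ := σ.continuous.measurable
  have hν : IsHaarMeasure (map σ ν) := σ.isHaarMeasure_map ν
  have h1 : modularCharacter (σ g) = haarScalarFactor (map (· * σ g) (map σ ν)) (map σ ν) :=
    modularCharacterFun_eq_haarScalarFactor _ _
  have h2 : modularCharacter g = haarScalarFactor (map (· * g) ν) ν :=
    modularCharacterFun_eq_haarScalarFactor _ _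
  have h3 : map (· * σ g) (map σ ν) = map σ (map (· * g) ν) := by
    rw [map_map (measurable_mul_const _) hσm, map_map hσm (measurable_mul_const _)]
    congr 1
    ext x
    simp
  rw [h1, h2]
  simp only [h3]
  exact haarScalarFactor_map _ _ σ

/-- The modular character is trivial on compact subgroups. -/
theorem modularCharacter_eq_one_of_isCompact [SecondCountableTopology G] {K : Subgroup G}
    (hK : IsCompact (K : Set G)) {g : G} (hg : g ∈ K) : modularCharacter g = 1 := by
  borelize G
  let ν := haar (G := G)
  obtain ⟨A, hA, hA1⟩ := exists_compact_mem_nhds (1 : G)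
  have hpos : ν A ≠ 0 := (measure_pos_of_mem_nhds ν hA1).ne'
  have hfin : ν A ≠ ⊤ := hA.measure_lt_top.ne
  have hAK : ν (A * (K : Set G)) ≠ ⊤ := (hA.mul hK).measure_lt_top.ne
  set C : ℝ≥0 := (ν (A * (K : Set G)) / ν A).toNNReal with hC
  have hCtop : ν (A * (K : Set G)) / ν A ≠ ⊤ := ENNReal.div_ne_top hAK hpos
  -- Translating A on the right by elements of K stays inside the compact set A K, which bounds the
  -- modular character on K.
  have hbound : ∀ k ∈ K, modularCharacter k ≤ C := by
    intro k hk
    have h1 : map (· * k) ν = modularCharacter k • ν := by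
      have : modularCharacter k = haarScalarFactor (map (· * k) ν) ν :=
        modularCharacterFun_eq_haarScalarFactor _ _
      rw [this]
      exact isMulLeftInvariant_eq_smul _ _
    have h2 : map (· * k) ν A = modularCharacter k * ν A := by
      rw [h1]; rfl
    have h3 : map (· * k) ν A ≤ ν (A * (K : Set G)) := by
      refine ((Homeomorph.mulRight k).toMeasurableEquiv.map_apply (μ := ν) A).le.trans ?_
      refine measure_mono fun x hx => ?_
      exact ⟨x * k, hx, k⁻¹, K.inv_mem hk, by simp⟩
    rw [h2] at h3
    have h4 := ENNReal.div_le_div_right h3 (ν A)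
    rw [ENNReal.mul_div_cancel_right hpos hfin] at h4
    rw [← ENNReal.coe_le_coe, hC, ENNReal.coe_toNNReal hCtop]
    exact h4
  -- A value above 1 would have unbounded powers, and the powers of k stay in K.
  have hle : ∀ k ∈ K, modularCharacter k ≤ 1 := by
    intro k hk
    by_contra hlt
    obtain ⟨n, hn⟩ := pow_unbounded_of_one_lt C (not_le.1 hlt)
    have := hbound (k ^ n) (K.pow_mem hk n)
    rw [map_pow] at this
    exact absurd hn (not_lt.2 this)
  refine le_antisymm (hle g hg) ?_
  have h1 := hle g⁻¹ (K.inv_mem hg)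
  have h2 : modularCharacter g * modularCharacter g⁻¹ = (1 : ℝ≥0) := by
    rw [← map_mul, mul_inv_cancel, map_one]
  calc (1 : ℝ≥0) = modularCharacter g * modularCharacter g⁻¹ := h2.symm
    _ ≤ modularCharacter g * 1 := by gcongr
    _ = modularCharacter g := mul_one _

end Modular

/-! ### Unimodularity of connected linear reductive groups. -/

section Reductive

variable {E : Type*} [NormedAddCommGroup E] [NormedSpace ℝ E] [FiniteDimensional ℝ E]
  {V : Type*} [NormedAddCommGroup V] [InnerProductSpace ℝ V] [FiniteDimensional ℝ V]
  {G : Type*} [TopologicalSpace G] [ChartedSpace E G] [Group G] [LieGroup 𝓘(ℝ, E) ∞ G]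
  {ρ : G →* (V →L[ℝ] V)ˣ}

theorem secondCountableTopology_of_isLinearReductive (hρ : IsLinearReductive (E := E) ρ) :
    SecondCountableTopology G := by
  have : ProperSpace (V →L[ℝ] V) := FiniteDimensional.proper ℝ _
  have h : Topology.IsEmbedding fun g : G => (ρ g : V →L[ℝ] V) :=
    Units.isOpenEmbedding_val.isEmbedding.comp hρ.isClosedEmbedding.isEmbedding
  exact h.secondCountableTopology

theorem t2Space_of_isLinearReductive (hρ : IsLinearReductive (E := E) ρ) : T2Space G :=
  hρ.isClosedEmbedding.isEmbedding.t2Space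

/-- The Cartan involution `g ↦ (ρ g)⁻ᵀ`. -/
theorem exists_cartanInvolution (hρ : IsLinearReductive (E := E) ρ) :
    ∃ σ : G ≃ₜ* G, ∀ g, (ρ (σ g) : V →L[ℝ] V) = star (ρ g⁻¹ : V →L[ℝ] V) := by
  have : IsTopologicalGroup G := topologicalGroup_of_lieGroup 𝓘(ℝ, E) ∞
  choose σ hσ using fun g : G => hρ.adjoint_mem g⁻¹
  replace hσ : ∀ g, (ρ (σ g) : V →L[ℝ] V) = star (ρ g⁻¹ : V →L[ℝ] V) := hσ
  have hinj := injective_of_isLinearReductive hρ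
  have hmul : ∀ g h, σ (g * h) = σ g * σ h := by
    intro g h
    refine hinj (Units.ext ?_)
    rw [map_mul, Units.val_mul, hσ, hσ, hσ, ← star_mul, mul_inv_rev, map_mul, Units.val_mul]
  have hone : σ 1 = 1 := by
    refine hinj (Units.ext ?_)
    rw [hσ, inv_one, map_one, Units.val_one, star_one]
  have hinv : ∀ g, σ (σ g) = g := by
    intro g
    refine hinj (Units.ext ?_)
    have h1 : (σ g)⁻¹ = σ g⁻¹ := by
      rw [inv_eq_iff_mul_eq_one, ← hmul, mul_inv_cancel, hone]
    rw [hσ, h1, hσ, star_star, inv_inv]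
  have hcont : Continuous σ := by
    rw [continuous_iff_continuousAt]
    intro g
    refine (tendsto_iff_val hρ).2 ?_
    simp only [hσ]
    exact (continuous_star.comp ((continuous_val hρ).comp continuous_inv)).tendsto g
  exact ⟨{ toFun := σ, invFun := σ, left_inv := hinv, right_inv := hinv, map_mul' := hmul,
           continuous_toFun := hcont, continuous_invFun := hcont }, hσ⟩

/-- The maximal compact subgroup of the elements acting by isometries. -/
def isometrySubgroup (ρ : G →* (V →L[ℝ] V)ˣ) : Subgroup G where
  carrier := {g | star (ρ g : V →L[ℝ] V) = (ρ g⁻¹ : V →L[ℝ] V)}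
  one_mem' := by simp
  mul_mem' := by
    intro g h hg hh
    simp only [Set.mem_setOf_eq] at hg hh ⊢
    rw [map_mul, Units.val_mul, star_mul, hg, hh, mul_inv_rev, map_mul, Units.val_mul]
  inv_mem' := by
    intro g hg
    simp only [Set.mem_setOf_eq] at hg ⊢
    rw [← hg, star_star, inv_inv]

theorem isCompact_isometrySubgroup (hρ : IsLinearReductive (E := E) ρ) :
    IsCompact (isometrySubgroup ρ : Set G) := by
  have : ProperSpace (V →L[ℝ] V) := FiniteDimensional.proper ℝ _
  let S : Set (V →L[ℝ] V) := {T | T * star T = 1 ∧ star T * T = 1}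
  have hScl : IsClosed S :=
    (isClosed_eq (continuous_id.mul continuous_star) continuous_const).inter
      (isClosed_eq (continuous_star.mul continuous_id) continuous_const)
  have hS : IsCompact S := by
    refine Metric.isCompact_of_isClosed_isBounded hScl ?_
    refine (Metric.isBounded_closedBall (x := (0 : V →L[ℝ] V)) (r := 1)).subset fun T hT => ?_
    rw [mem_closedBall_zero_iff]
    have h1 : ‖T‖ * ‖T‖ ≤ 1 := by
      rw [← CStarRing.norm_star_mul_self, hT.2]
      exact ContinuousLinearMap.norm_id_le
    nlinarith [norm_nonneg T]
  let f : S → (V →L[ℝ] V)ˣ := fun T => ⟨T, star (T : V →L[ℝ] V), T.2.1, T.2.2⟩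
  have hf : Continuous f := by
    rw [Units.continuous_iff]
    exact ⟨continuous_subtype_val, continuous_star.comp continuous_subtype_val⟩
  have : CompactSpace S := isCompact_iff_compactSpace.1 hS
  have hr : IsCompact (Set.range f) := isCompact_range hf
  have h := hρ.isClosedEmbedding.isCompact_preimage hr
  convert h using 1
  ext g
  constructor
  · intro hg
    replace hg : star (ρ g : V →L[ℝ] V) = (ρ g⁻¹ : V →L[ℝ] V) := hg
    refine ⟨⟨(ρ g : V →L[ℝ] V), ?_, ?_⟩, Units.ext rfl⟩
    · rw [hg, val_mul_val_inv]
    · rw [hg, val_inv_mul_val]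
  · rintro ⟨T, hT⟩
    change star (ρ g : V →L[ℝ] V) = (ρ g⁻¹ : V →L[ℝ] V)
    rw [map_inv, ← hT]
    rfl

/-- A connected linear reductive group is unimodular. -/
theorem modularCharacter_eq_one [ConnectedSpace G] [IsTopologicalGroup G] [LocallyCompactSpace G]
    (hρ : IsLinearReductive (E := E) ρ) (g : G) : modularCharacter g = 1 := by
  have : SecondCountableTopology G := secondCountableTopology_of_isLinearReductive hρ
  obtain ⟨σ, hσ⟩ := exists_cartanInvolution hρ
  have hinj := injective_of_isLinearReductive hρ
  let 𝔪 : Submodule ℝ (V →L[ℝ] V) := lieAlg (E := E) ρ ⊓ skewAdjoint.submodule ℝ (V →L[ℝ] V)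
  let 𝔫 : Submodule ℝ (V →L[ℝ] V) := lieAlg (E := E) ρ ⊓ selfAdjoint.submodule ℝ (V →L[ℝ] V)
  have hsup : lieAlg (E := E) ρ ≤ 𝔪 ⊔ 𝔫 := by
    intro X hX
    have hX' : star X ∈ lieAlg (E := E) ρ := adjoint_mem_lieAlg hρ hX
    have h1 : (1 / 2 : ℝ) • (X - star X) ∈ 𝔪 := by
      refine ⟨Submodule.smul_mem _ _ (Submodule.sub_mem _ hX hX'), ?_⟩
      change star _ = -_
      rw [star_smul, star_sub, star_star, star_trivial, ← smul_neg, neg_sub]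
    have h2 : (1 / 2 : ℝ) • (X + star X) ∈ 𝔫 := by
      refine ⟨Submodule.smul_mem _ _ (Submodule.add_mem _ hX hX'), ?_⟩
      change star _ = _
      rw [star_smul, star_add, star_star, star_trivial, add_comm]
    have h3 : X = (1 / 2 : ℝ) • (X - star X) + (1 / 2 : ℝ) • (X + star X) := by module
    rw [h3]
    exact Submodule.add_mem_sup h1 h2
  -- Infinitesimal Cartan decomposition: near 1 every element is exp X exp Y with X skew-adjoint and
  -- Y self-adjoint. Once both factors lie in the kernel, it is open, hence closed, hence everything
  -- by connectedness.
  have hnhds : ((modularCharacter (G := G)).ker : Set G) ∈ 𝓝 (1 : G) := by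
    filter_upwards [eventually_eq_exp_mul_exp hρ (inf_le_left : 𝔪 ≤ _) (inf_le_left : 𝔫 ≤ _) hsup]
    rintro x ⟨X, hX, Y, hY, hx⟩
    obtain ⟨k, hk⟩ := exists_eq_exp hρ hX.1 1
    obtain ⟨p, hp⟩ := exists_eq_exp hρ hY.1 1
    have hki := val_inv_eq_exp hk
    have hpi := val_inv_eq_exp hp
    have hXs : star X = -X := hX.2
    have hYs : star Y = Y := hY.2
    have hkp : x = k * p := by
      refine hinj (Units.ext ?_)
      rw [map_mul, Units.val_mul, hk, hp, hx, one_smul, one_smul]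
    have h1 : modularCharacter k = 1 := by
      refine modularCharacter_eq_one_of_isCompact (isCompact_isometrySubgroup hρ) ?_
      change star (ρ k : V →L[ℝ] V) = (ρ k⁻¹ : V →L[ℝ] V)
      rw [hk, hki, star_exp, star_smul, hXs, star_trivial, smul_neg, neg_smul]
    -- The Cartan involution inverts p but preserves the modular character, so the square of its
    -- value at p is 1.
    have h2 : modularCharacter p = 1 := by
      have h3 : σ p = p⁻¹ := by
        refine hinj (Units.ext ?_)
        rw [hσ, hpi, star_exp, star_smul, hYs, star_trivial]
      have h4 := modularCharacter_apply_equiv σ p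
      rw [h3] at h4
      have h5 : modularCharacter p * modularCharacter p⁻¹ = (1 : ℝ≥0) := by
        rw [← map_mul, mul_inv_cancel, map_one]
      rw [h4] at h5
      rw [← sq] at h5
      exact (pow_eq_one_iff_of_nonneg zero_le two_ne_zero).1 h5
    change modularCharacter x = 1
    rw [hkp, map_mul, h1, h2, one_mul]
  have hopen := Subgroup.isOpen_of_mem_nhds _ hnhds
  have hclopen : IsClopen ((modularCharacter (G := G)).ker : Set G) :=
    ⟨Subgroup.isClosed_of_isOpen _ hopen, hopen⟩
  have huniv := hclopen.eq_univ ⟨1, Subgroup.one_mem _⟩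
  have : g ∈ ((modularCharacter (G := G)).ker : Set G) := by rw [huniv]; trivial
  exact this

theorem isMulRightInvariant_of_isLinearReductive [ConnectedSpace G] [IsTopologicalGroup G]
    [MeasurableSpace G] [BorelSpace G] (hρ : IsLinearReductive (E := E) ρ) (μ : Measure G)
    [μ.IsHaarMeasure] : μ.IsMulRightInvariant := by
  have : LocallyCompactSpace G := ChartedSpace.locallyCompactSpace E G
  have : SecondCountableTopology G := secondCountableTopology_of_isLinearReductive hρ
  refine ⟨fun g => ?_⟩
  rw [isMulLeftInvariant_eq_smul (map (· * g) μ) μ, ← modularCharacterFun_eq_haarScalarFactor]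
  have : modularCharacterFun g = 1 := modularCharacter_eq_one hρ g
  rw [this, one_smul]

end Reductive

/-! ### A contraction does not preserve a Haar measure. -/

section Contraction

variable {H L : Type*} [Group H] [TopologicalSpace H] [IsTopologicalGroup H] [T2Space H]
  [LocallyCompactSpace H] [SecondCountableTopology H] [MeasurableSpace H] [BorelSpace H]
  [Group L] [TopologicalSpace L] [IsTopologicalGroup L]
  [LocallyCompactSpace L] [SecondCountableTopology L] [MeasurableSpace L] [BorelSpace L]

/-- A Haar measure on `H × L` is not preserved by a map contracting a nontrivial factor `H`. -/
theorem not_measurePreserving_of_contracting (ν : Measure (H × L)) [ν.IsHaarMeasure]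
    [Nontrivial H] {θ : H → H} (hθ : ∀ u, Tendsto (fun n : ℕ => θ^[n] u) atTop (𝓝 1)) :
    ¬ MeasurePreserving (Prod.map θ id : H × L → H × L) ν ν := by
  intro hmp
  obtain ⟨u₀, hu₀⟩ := exists_ne (1 : H)
  obtain ⟨A, B, hA, hB, h1A, hu₀B, hAB⟩ := t2_separation hu₀.symm
  obtain ⟨C, hC, hC1⟩ := exists_compact_mem_nhds (1 : H)
  obtain ⟨D, hD, hD1⟩ := exists_compact_mem_nhds (1 : L)
  -- W is a relatively compact neighbourhood of 1, small enough that W and u₀ W are disjoint.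
  let W : Set H := interior C ∩ (A ∩ (u₀ * ·) ⁻¹' B)
  have hW : IsOpen W := isOpen_interior.inter (hA.inter (hB.preimage (continuous_const_mul u₀)))
  have hW1 : (1 : H) ∈ W := ⟨mem_interior_iff_mem_nhds.2 hC1, h1A, by simpa using hu₀B⟩
  have hD1' : (1 : L) ∈ interior D := mem_interior_iff_mem_nhds.2 hD1
  let S : Set (H × L) := W ×ˢ interior D
  let T : Set (H × L) := Set.univ ×ˢ interior D
  have hSo : IsOpen S := hW.prod isOpen_interior
  have hSfin : ν S < ⊤ := by
    refine (measure_mono ?_).trans_lt (hC.prod hD).measure_lt_top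
    exact Set.prod_mono (Set.inter_subset_left.trans interior_subset) interior_subset
  have hSpos : 0 < ν S := hSo.measure_pos ν ⟨(1, 1), hW1, hD1'⟩
  have hiter : ∀ (n : ℕ) (z : H × L), (Prod.map θ id)^[n] z = (θ^[n] z.1, z.2) := by
    intro n z
    rw [Prod.map_iterate]
    simp [Prod.map]
  -- Each point of T = H × D° ends up in S under iteration and stays there. So T lies in the
  -- increasing union of the sets R N, each inside the preimage of S by the N-th iterate, of measure
  -- ν S.
  have hle : ν T ≤ ν S := by
    let R : ℕ → Set (H × L) := fun N => ⋂ n ≥ N, ((Prod.map θ id)^[n]) ⁻¹' S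
    have hmono : Monotone R := fun N N' hN =>
      Set.biInter_mono (fun n hn => le_trans hN hn) fun n _ => le_rfl
    have hsub : T ⊆ ⋃ N, R N := by
      rintro ⟨u, q⟩ ⟨-, hq⟩
      obtain ⟨N, hN⟩ := eventually_atTop.1 ((hθ u).eventually (hW.mem_nhds hW1))
      refine Set.mem_iUnion.2 ⟨N, Set.mem_iInter₂.2 fun n hn => ?_⟩
      rw [Set.mem_preimage, hiter]
      exact ⟨hN n hn, hq⟩
    refine (measure_mono hsub).trans ?_
    rw [hmono.measure_iUnion]
    refine iSup_le fun N => ?_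
    refine (measure_mono (Set.biInter_subset_of_mem (le_refl N))).trans ?_
    rw [(hmp.iterate N).measure_preimage hSo.measurableSet.nullMeasurableSet]
  have hdisj : Disjoint S (((u₀, (1 : L)) : H × L) • S) := by
    rw [Set.disjoint_left]
    rintro _ ⟨h1, h2⟩ ⟨⟨u, q⟩, ⟨hu, hq⟩, rfl⟩
    exact Set.disjoint_left.1 hAB h1.2.1 hu.2.2
  have hT : S ∪ ((u₀, (1 : L)) : H × L) • S ⊆ T := by
    rintro x (hx | ⟨⟨u, q⟩, ⟨hu, hq⟩, rfl⟩)
    · exact ⟨trivial, hx.2⟩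
    · refine ⟨trivial, ?_⟩
      simpa using hq
  -- T contains two disjoint translates of S, which contradicts 0 < ν S < ∞.
  have h2 : ν S + ν S ≤ ν S := by
    calc ν S + ν S = ν S + ν (((u₀, (1 : L)) : H × L) • S) := by rw [measure_smul]
      _ = ν (S ∪ ((u₀, (1 : L)) : H × L) • S) :=
        (measure_union hdisj (hSo.smul _).measurableSet).symm
      _ ≤ ν T := measure_mono hT
      _ ≤ ν S := hle
  have h3 := ENNReal.add_lt_add_left hSfin.ne hSpos
  rw [add_zero] at h3
  exact absurd h3 (not_lt.2 h2)

end Contraction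

section SubgroupInstances

variable {G : Type*} [Group G] [TopologicalSpace G]

instance instSecondCountableTopologySubgroup [SecondCountableTopology G] (S : Subgroup G) :
    SecondCountableTopology S :=
  TopologicalSpace.Subtype.secondCountableTopology (S : Set G)

instance instBorelSpaceSubgroup [MeasurableSpace G] [BorelSpace G] (S : Subgroup G) :
    BorelSpace S :=
  Subtype.borelSpace (S : Set G)

end SubgroupInstances

/-! ### Coordinates U × Q on the big cell, its flow, and the scaling of volume. -/

namespace ContractingPair

variable {G : Type*} [Group G] [TopologicalSpace G] [IsTopologicalGroup G] {P Q U : Subgroup G}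
  {a : ℝ → G}

theorem flow_zero (h : ContractingPair P Q U a) : a 0 = 1 := by
  have := h.flow_add 0 0
  rwa [add_zero, left_eq_mul] at this

/-- An element of U ∩ Q commutes with the flow, so its conjugates are constant; being contracted,
they tend to 1. -/
theorem eq_one_of_mem [T2Space G] (h : ContractingPair P Q U a) {u : G} (hu : u ∈ U) (hq : u ∈ Q) :
    u = 1 := by
  have h1 : (fun t => (a t)⁻¹ * u * a t) = fun _ => u := by
    ext t
    rw [mul_assoc, ← h.flow_comm t u (h.le_left hu) hq, inv_mul_cancel_left]
  have h2 := h.tendsto_conj u hu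
  rw [h1] at h2
  exact tendsto_nhds_unique tendsto_const_nhds h2

theorem mem_bigCell (h : ContractingPair P Q U a) (z : U × Q) : (z.1 : G) * (z.2 : G)⁻¹ ∈ bigCell P Q :=
  ⟨z.1, h.le_left z.1.2, (z.2 : G)⁻¹, Q.inv_mem z.2.2, rfl⟩

/-- The map `U × Q → Ω`, `(u, q) ↦ u q⁻¹`. -/
def cellMap (h : ContractingPair P Q U a) (z : U × Q) : bigCell P Q :=
  ⟨(z.1 : G) * (z.2 : G)⁻¹, h.mem_bigCell z⟩

theorem coe_cellMap (h : ContractingPair P Q U a) (z : U × Q) :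
    (h.cellMap z : G) = (z.1 : G) * (z.2 : G)⁻¹ := rfl

theorem continuous_cellMap (h : ContractingPair P Q U a) : Continuous h.cellMap := by
  refine Continuous.subtype_mk ?_ _
  fun_prop

theorem cellMap_bijective [T2Space G] (h : ContractingPair P Q U a) :
    Function.Bijective h.cellMap := by
  constructor
  · rintro ⟨u, q⟩ ⟨u', q'⟩ hz
    have h1 : (u : G) * (q : G)⁻¹ = (u' : G) * (q' : G)⁻¹ := congrArg Subtype.val hz
    have h2 : (u' : G)⁻¹ * u = (q' : G)⁻¹ * q := by
      rw [inv_mul_eq_iff_eq_mul, ← mul_assoc, ← h1, inv_mul_cancel_right]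
    have h3 : (u' : G)⁻¹ * u = 1 := by
      refine h.eq_one_of_mem (U.mul_mem (U.inv_mem u'.2) u.2) ?_
      rw [h2]
      exact Q.mul_mem (Q.inv_mem q'.2) q.2
    rw [h3] at h2
    exact Prod.ext (Subtype.ext (inv_mul_eq_one.1 h3).symm) (Subtype.ext (inv_mul_eq_one.1 h2.symm).symm)
  · rintro ⟨g, p, hp, q, hq, rfl⟩
    obtain ⟨u, hu, l, hl, hl', rfl⟩ := h.exists_eq_mul p hp
    refine ⟨(⟨u, hu⟩, ⟨(l * q)⁻¹, Q.inv_mem (Q.mul_mem hl' hq)⟩), Subtype.ext ?_⟩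
    change u * ((l * q)⁻¹)⁻¹ = u * l * q
    rw [inv_inv, mul_assoc]

/-- The map is an orbit map of the σ-compact group U × Q acting transitively and continuously on a
locally compact Hausdorff space; such maps are open by a Baire argument. -/
theorem isOpenMap_cellMap [T2Space G] [LocallyCompactSpace G] [SecondCountableTopology G]
    (h : ContractingPair P Q U a) : IsOpenMap h.cellMap := by
  have : LocallyCompactSpace U := h.isClosed_contracted.locallyCompactSpace
  have : LocallyCompactSpace Q := h.isClosed_right.locallyCompactSpace
  have : LocallyCompactSpace (bigCell P Q) := h.isOpen_bigCell.locallyCompactSpace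
  let act : MulAction (U × Q) (bigCell P Q) :=
    { smul := fun z g => ⟨(z.1 : G) * g * (z.2 : G)⁻¹, by
        obtain ⟨p, hp, q, hq, hg⟩ := g.2
        exact ⟨z.1 * p, P.mul_mem (h.le_left z.1.2) hp, q * (z.2 : G)⁻¹,
          Q.mul_mem hq (Q.inv_mem z.2.2), by rw [hg]; group⟩⟩
      one_smul := fun g => Subtype.ext (show ((1 : U) : G) * g * ((1 : Q) : G)⁻¹ = g by simp)
      mul_smul := fun z w g => Subtype.ext
        (show ((z.1 * w.1 : U) : G) * g * ((z.2 * w.2 : Q) : G)⁻¹ =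
          (z.1 : G) * ((w.1 : G) * g * (w.2 : G)⁻¹) * (z.2 : G)⁻¹ by simp [mul_assoc]) }
  have hact : ∀ (z : U × Q) (g : bigCell P Q), ((z • g : bigCell P Q) : G) =
      (z.1 : G) * g * (z.2 : G)⁻¹ := fun z g => rfl
  let o : bigCell P Q := ⟨1, 1, P.one_mem, 1, Q.one_mem, (mul_one 1).symm⟩
  have horb : ∀ z : U × Q, z • o = h.cellMap z := fun z => Subtype.ext (by
    rw [hact, coe_cellMap]; simp [o])
  have : ContinuousSMul (U × Q) (bigCell P Q) := by
    refine ⟨Continuous.subtype_mk ?_ _⟩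
    fun_prop
  have : MulAction.IsPretransitive (U × Q) (bigCell P Q) := by
    refine ⟨fun x y => ?_⟩
    obtain ⟨z, rfl⟩ := h.cellMap_bijective.2 x
    obtain ⟨w, rfl⟩ := h.cellMap_bijective.2 y
    exact ⟨w * z⁻¹, by rw [← horb, ← horb, smul_smul, inv_mul_cancel_right]⟩
  have h1 := isOpenMap_smul_of_sigmaCompact (G := U × Q) o
  simp only [horb] at h1
  exact h1

variable [T2Space G] [LocallyCompactSpace G] [SecondCountableTopology G]

/-- The homeomorphism `U × Q ≃ Ω`, `(u, q) ↦ u q⁻¹`. -/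
noncomputable def cellEquiv (h : ContractingPair P Q U a) : U × Q ≃ₜ bigCell P Q :=
  (Equiv.ofBijective h.cellMap h.cellMap_bijective).toHomeomorphOfContinuousOpen
    h.continuous_cellMap h.isOpenMap_cellMap

theorem coe_cellEquiv (h : ContractingPair P Q U a) (z : U × Q) :
    (h.cellEquiv z : G) = (z.1 : G) * (z.2 : G)⁻¹ := rfl

/-- The inverse of the one-parameter group, as an element of `U × Q`. -/
def flowElt (h : ContractingPair P Q U a) (t : ℝ) : U × Q := (1, ⟨(a t)⁻¹, Q.inv_mem (h.flow_mem_right t)⟩)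

theorem flowElt_add (h : ContractingPair P Q U a) (s t : ℝ) :
    h.flowElt (s + t) = h.flowElt t * h.flowElt s := by
  refine Prod.ext (by simp [flowElt]) (Subtype.ext ?_)
  change (a (s + t))⁻¹ = (a t)⁻¹ * (a s)⁻¹
  rw [h.flow_add, mul_inv_rev]

/-- The flow `p q ↦ p a(t) q` on the big cell. -/
noncomputable def flow (h : ContractingPair P Q U a) (t : ℝ) : bigCell P Q ≃ₜ bigCell P Q :=
  h.cellEquiv.symm.trans ((Homeomorph.mulRight (h.flowElt t)).trans h.cellEquiv)

theorem flow_apply (h : ContractingPair P Q U a) (t : ℝ) (x : bigCell P Q) :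
    h.flow t x = h.cellEquiv (h.cellEquiv.symm x * h.flowElt t) := rfl

theorem flow_cellEquiv (h : ContractingPair P Q U a) (t : ℝ) (z : U × Q) :
    h.flow t (h.cellEquiv z) = h.cellEquiv (z * h.flowElt t) := by
  rw [flow_apply, Homeomorph.symm_apply_apply]

theorem continuous_flow_uncurry (h : ContractingPair P Q U a) :
    Continuous fun z : ℝ × bigCell P Q => h.flow z.1 z.2 := by
  have h1 : Continuous h.flowElt :=
    Continuous.prodMk continuous_const (Continuous.subtype_mk h.continuous_flow.inv _)
  exact h.cellEquiv.continuous.comp ((h.cellEquiv.symm.continuous.comp continuous_snd).mul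
    (h1.comp continuous_fst))

theorem flow_add_apply (h : ContractingPair P Q U a) (s t : ℝ) (x : bigCell P Q) :
    h.flow (s + t) x = h.flow s (h.flow t x) := by
  rw [flow_apply, flow_apply, flow_apply, Homeomorph.symm_apply_apply, h.flowElt_add, mul_assoc]

theorem flow_zero_apply (h : ContractingPair P Q U a) (x : bigCell P Q) : h.flow 0 x = x := by
  have h1 : h.flowElt 0 = 1 := Prod.ext rfl (Subtype.ext (by simp [flowElt, h.flow_zero]))
  rw [flow_apply, h1, mul_one, Homeomorph.apply_symm_apply]

/-- Independence of the decomposition x = p q: with p = u l, the factor l in P ∩ Q moves across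
a(t), so only the U-component matters. -/
theorem coe_flow (h : ContractingPair P Q U a) (t : ℝ) (x : bigCell P Q) {p q : G} (hp : p ∈ P)
    (hq : q ∈ Q) (hx : (x : G) = p * q) : (h.flow t x : G) = p * a t * q := by
  obtain ⟨u, hu, l, hl, hl', rfl⟩ := h.exists_eq_mul p hp
  have h1 : x = h.cellEquiv (⟨u, hu⟩, ⟨(l * q)⁻¹, Q.inv_mem (Q.mul_mem hl' hq)⟩) := by
    refine Subtype.ext ?_
    rw [coe_cellEquiv, hx, inv_inv, mul_assoc]
  rw [h1, flow_cellEquiv, coe_cellEquiv]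
  change (u * 1) * ((l * q)⁻¹ * (a t)⁻¹)⁻¹ = _
  rw [mul_inv_rev, inv_inv, inv_inv, mul_one, mul_assoc u l (a t), ← h.flow_comm t l hl hl']
  simp only [mul_assoc]

/-- The flow commutes with the action of `P × Q`. -/
theorem coe_flow_equivariant (h : ContractingPair P Q U a) (t : ℝ) {x y : bigCell P Q} {p q : G}
    (hp : p ∈ P) (hq : q ∈ Q) (hxy : (y : G) = p * x * q⁻¹) :
    (h.flow t y : G) = p * h.flow t x * q⁻¹ := by
  obtain ⟨p', hp', q', hq', hx⟩ := x.2
  rw [h.coe_flow t x hp' hq' hx, h.coe_flow t y (P.mul_mem hp hp') (Q.mul_mem hq' (Q.inv_mem hq))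
    (by rw [hxy, hx]; group)]
  group

section Scaling

variable [MeasurableSpace G] [BorelSpace G]

/-- The Haar measure of `G` in the coordinates `U × Q` of the big cell. -/
noncomputable def cellMeasure (h : ContractingPair P Q U a) (μ : Measure G) : Measure (U × Q) :=
  μ.comap fun z => (h.cellEquiv z : G)

theorem cellMeasure_apply (h : ContractingPair P Q U a) (μ : Measure G) (s : Set (U × Q)) :
    h.cellMeasure μ s = μ ((fun z => (h.cellEquiv z : G)) '' s) := by
  have h1 : Topology.IsOpenEmbedding fun z => (h.cellEquiv z : G) :=
    h.isOpen_bigCell.isOpenEmbedding_subtypeVal.comp h.cellEquiv.isOpenEmbedding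
  exact h1.measurableEmbedding.comap_apply μ s

/-- Left translation by (u, q) in the coordinates is g ↦ u g q⁻¹ in G, which preserves a biinvariant
measure. -/
theorem isHaarMeasure_cellMeasure (h : ContractingPair P Q U a) (μ : Measure G) [μ.IsHaarMeasure]
    [μ.IsMulRightInvariant] : (h.cellMeasure μ).IsHaarMeasure := by
  have h1 : Topology.IsOpenEmbedding fun z => (h.cellEquiv z : G) :=
    h.isOpen_bigCell.isOpenEmbedding_subtypeVal.comp h.cellEquiv.isOpenEmbedding
  have hfin : IsFiniteMeasureOnCompacts (h.cellMeasure μ) := by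
    refine ⟨fun K hK => ?_⟩
    rw [cellMeasure_apply]
    exact (hK.image h1.continuous).measure_lt_top
  have hopen : IsOpenPosMeasure (h.cellMeasure μ) := by
    refine ⟨fun O hO hne => ?_⟩
    rw [cellMeasure_apply]
    exact ((h1.isOpenMap O hO).measure_pos μ (hne.image _)).ne'
  have hinv : IsMulLeftInvariant (h.cellMeasure μ) := by
    refine ⟨fun z => ?_⟩
    ext s hs
    rw [map_apply (measurable_const_mul z) hs, cellMeasure_apply, cellMeasure_apply]
    have h2 : (fun z => (h.cellEquiv z : G)) '' ((z * ·) ⁻¹' s) =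
        (fun g : G => g * (z.2 : G)⁻¹) ⁻¹' (((z.1 : G) * ·) ⁻¹'
          ((fun z => (h.cellEquiv z : G)) '' s)) := by
      ext g
      constructor
      · rintro ⟨w, hw, rfl⟩
        refine ⟨z * w, hw, ?_⟩
        simp only [coe_cellEquiv, Prod.fst_mul, Prod.snd_mul, Subgroup.coe_mul]
        group
      · rintro ⟨w, hw, hwg⟩
        refine ⟨z⁻¹ * w, by simpa using hw, ?_⟩
        simp only [coe_cellEquiv, Prod.fst_mul, Prod.snd_mul, Subgroup.coe_mul, Prod.fst_inv,
          Prod.snd_inv, Subgroup.coe_inv] at hwg ⊢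
        have h3 : g = (z.1 : G)⁻¹ * ((z.1 : G) * (g * (z.2 : G)⁻¹)) * z.2 := by group
        rw [h3, ← hwg]
        group
    rw [h2, measure_preimage_mul_right, measure_preimage_mul]
  exact { }

/-- The flow multiplies the Haar measure by a constant different from `1`. -/
theorem exists_measure_flow_image (h : ContractingPair P Q U a) (μ : Measure G) [μ.IsHaarMeasure]
    [μ.IsMulRightInvariant] {t : ℝ} (ht : 0 < t) :
    ∃ c : ℝ≥0, c ≠ 0 ∧ c ≠ 1 ∧ ∀ A : Set (bigCell P Q),
      μ (Subtype.val '' (h.flow t '' A)) = c * μ (Subtype.val '' A) := by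
  have : LocallyCompactSpace U := h.isClosed_contracted.locallyCompactSpace
  have : LocallyCompactSpace Q := h.isClosed_right.locallyCompactSpace
  have hν := h.isHaarMeasure_cellMeasure μ
  set ν := h.cellMeasure μ with hνdef
  set x := h.flowElt t with hx
  -- In the coordinates the flow is right translation by x, so c is a modular factor of U × Q.
  set c := haarScalarFactor (map (· * x⁻¹) ν) ν with hc
  have hmap : map (· * x⁻¹) ν = c • ν := isMulLeftInvariant_eq_smul _ _
  have hscale : ∀ B : Set (U × Q), ν ((· * x⁻¹) ⁻¹' B) = c * ν B := by
    intro B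
    have h1 : map (· * x⁻¹) ν B = ν ((· * x⁻¹) ⁻¹' B) :=
      (Homeomorph.mulRight x⁻¹).toMeasurableEquiv.map_apply (μ := ν) B
    rw [← h1, hmap]
    rfl
  have hflow : ∀ A : Set (bigCell P Q),
      μ (Subtype.val '' (h.flow t '' A)) = c * μ (Subtype.val '' A) := by
    intro A
    have h1 : Subtype.val '' A = (fun z => (h.cellEquiv z : G)) '' (h.cellEquiv ⁻¹' A) := by
      rw [← Set.image_image Subtype.val h.cellEquiv, Set.image_preimage_eq _ h.cellEquiv.surjective]
    have h2 : Subtype.val '' (h.flow t '' A) =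
        (fun z => (h.cellEquiv z : G)) '' ((· * x⁻¹) ⁻¹' (h.cellEquiv ⁻¹' A)) := by
      rw [← Set.image_image Subtype.val h.cellEquiv]
      refine congrArg (Subtype.val '' ·) ?_
      ext y
      constructor
      · rintro ⟨w, hw, rfl⟩
        refine ⟨h.cellEquiv.symm w * x, ?_, rfl⟩
        simpa using hw
      · rintro ⟨z, hz, rfl⟩
        refine ⟨_, hz, ?_⟩
        rw [flow_cellEquiv, inv_mul_cancel_right]
    rw [h1, h2, ← cellMeasure_apply, ← cellMeasure_apply]
    exact hscale _
  refine ⟨c, (haarScalarFactor_pos_of_isHaarMeasure _ _).ne', fun hc1 => ?_, hflow⟩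
  -- If c were 1, the flow followed by left translation by a(t)⁻¹ would preserve the measure. This
  -- composite sends u q⁻¹ to (a(t)⁻¹ u a(t)) q⁻¹, which contracts the U factor and fixes the Q
  -- factor.
  let θ : U → U := fun u => ⟨(a t)⁻¹ * u * a t, h.conj_mem t u u.2⟩
  have hθn : ∀ (n : ℕ) (u : U), ((θ^[n] u : U) : G) = (a (n * t))⁻¹ * u * a (n * t) := by
    intro n u
    induction n with
    | zero => simp [h.flow_zero]
    | succ n ih =>
      rw [Function.iterate_succ_apply']
      change (a t)⁻¹ * _ * a t = _
      rw [ih, Nat.cast_succ, add_mul, one_mul, h.flow_add]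
      group
  have hθ : ∀ u, Tendsto (fun n : ℕ => θ^[n] u) atTop (𝓝 1) := by
    intro u
    rw [tendsto_subtype_rng]
    simp only [hθn]
    exact (h.tendsto_conj u u.2).comp (tendsto_natCast_atTop_atTop.atTop_mul_const ht)
  have : Nontrivial U := (Subgroup.nontrivial_iff_ne_bot U).2 h.ne_bot
  refine not_measurePreserving_of_contracting ν hθ ⟨?_, ?_⟩
  · have hθc : Continuous θ := Continuous.subtype_mk (by fun_prop) _
    exact (hθc.prodMap continuous_id).measurable
  · have hθc : Continuous θ := Continuous.subtype_mk (by fun_prop) _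
    have hm : Measurable (Prod.map θ id : U × Q → U × Q) :=
      (hθc.prodMap continuous_id).measurable
    ext s hs
    rw [map_apply hm hs]
    have h1 : (fun z => (h.cellEquiv z : G)) '' ((· * x⁻¹) ⁻¹' (Prod.map θ id ⁻¹' s)) =
        ((a t)⁻¹ * ·) ⁻¹' ((fun z => (h.cellEquiv z : G)) '' s) := by
      ext g
      constructor
      · rintro ⟨w, hw, rfl⟩
        obtain ⟨z, rfl⟩ : ∃ z, w = z * x := ⟨w * x⁻¹, by simp⟩
        rw [Set.mem_preimage, Set.mem_preimage, mul_inv_cancel_right] at hw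
        refine ⟨_, hw, ?_⟩
        change (a t)⁻¹ * z.1 * a t * (z.2 : G)⁻¹ =
          (a t)⁻¹ * ((z.1 * 1) * ((z.2 : G) * (a t)⁻¹)⁻¹)
        group
      · rintro ⟨⟨u, q⟩, hw, hwg⟩
        change (u : G) * (q : G)⁻¹ = (a t)⁻¹ * g at hwg
        have hu : a t * u * (a t)⁻¹ ∈ U := by
          have h2 := h.conj_mem (-t) u u.2
          have h3 : a (-t) = (a t)⁻¹ := by
            rw [eq_inv_iff_mul_eq_one, ← h.flow_add, neg_add_cancel, h.flow_zero]
          rwa [h3, inv_inv] at h2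
        refine ⟨(⟨_, hu⟩, q) * x, ?_, ?_⟩
        · rw [Set.mem_preimage, Set.mem_preimage, mul_inv_cancel_right]
          convert hw using 1
          refine Prod.ext (Subtype.ext ?_) rfl
          change (a t)⁻¹ * (a t * u * (a t)⁻¹) * a t = u
          group
        · change (a t * u * (a t)⁻¹ * 1) * ((q : G) * (a t)⁻¹)⁻¹ = g
          rw [← mul_inv_cancel_left (a t) g, ← hwg]
          group
    have h2 := hscale (Prod.map θ id ⁻¹' s)
    rw [hc1, ENNReal.coe_one, one_mul] at h2
    rw [← h2, hνdef, cellMeasure_apply, cellMeasure_apply, h1, measure_preimage_mul]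

end Scaling
end ContractingPair

open scoped unitInterval

/-! ### Deck transformations of universal coverings. -/

section Deck

variable {M N : Type*} [TopologicalSpace M] [TopologicalSpace N] {π : N → M}

theorem t2Space_of_isCoveringMap [T2Space M] (hπ : IsCoveringMap π) : T2Space N := by
  refine ⟨fun x y hxy => ?_⟩
  by_cases h : π x = π y
  · exact hπ.isSeparatedMap x y h hxy
  · obtain ⟨A, B, hA, hB, hxA, hyB, hAB⟩ := t2_separation h
    exact ⟨π ⁻¹' A, π ⁻¹' B, hA.preimage hπ.continuous, hB.preimage hπ.continuous, hxA, hyB,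
      hAB.preimage π⟩

/-- The deck group of a universal covering is transitive on the fibres. -/
theorem exists_mem_deckGroup [SimplyConnectedSpace N] [LocallyPathConnectedSpace N]
    (hπ : IsCoveringMap π) {x y : N} (h : π x = π y) : ∃ φ ∈ deckGroup π, φ x = y := by
  let p : C(N, M) := ⟨π, hπ.continuous⟩
  obtain ⟨f, ⟨hfx, hf⟩, -⟩ := hπ.existsUnique_continuousMap_lifts p x y h.symm
  obtain ⟨g, ⟨hgy, hg⟩, -⟩ := hπ.existsUnique_continuousMap_lifts p y x h
  have hf' : ∀ z, π (f z) = π z := fun z => congrFun hf z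
  have hg' : ∀ z, π (g z) = π z := fun z => congrFun hg z
  have h1 : g ∘ f = id := by
    refine hπ.eq_of_comp_eq (g.continuous.comp f.continuous) continuous_id ?_ x ?_
    · ext z; simp [hf', hg']
    · simp [hfx, hgy]
  have h2 : f ∘ g = id := by
    refine hπ.eq_of_comp_eq (f.continuous.comp g.continuous) continuous_id ?_ y ?_
    · ext z; simp [hf', hg']
    · simp [hfx, hgy]
  exact ⟨{ toFun := f, invFun := g, left_inv := congrFun h1, right_inv := congrFun h2,
           continuous_toFun := f.continuous, continuous_invFun := g.continuous }, hf', hfx⟩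

end Deck

/-! ### Lifting a flow through a local homeomorphism. -/

section FlowLift

variable {N X : Type*} [TopologicalSpace N] [TopologicalSpace X]
  {F : ℝ → X → X} {dev : N → X}

/-- The flow line of `dev x` for time `ε` lifts to a path from `x`. -/
def HasFlowLift (F : ℝ → X → X) (dev : N → X) (ε : ℝ) (x : N) : Prop :=
  ∃ γ : C(I, N), γ 0 = x ∧ ∀ t : I, dev (γ t) = F (t * ε) (dev x)

/-- If the flow lines lift for the times `ε` and `-ε`, then the flow at time `ε` lifts. -/
theorem exists_homeomorph_lift [T2Space N] (hdev : IsLocalHomeomorph dev)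
    (hF : Continuous fun z : ℝ × X => F z.1 z.2)
    (hF_add : ∀ s t x, F (s + t) x = F s (F t x)) {ε : ℝ}
    (hpos : ∀ x, HasFlowLift F dev ε x) (hneg : ∀ x, HasFlowLift F dev (-ε) x) :
    ∃ ψ : N ≃ₜ N, (∀ x, dev (ψ x) = F ε (dev x)) ∧
      ∀ φ : N ≃ₜ N, (∀ x y t, dev y = F t (dev x) → dev (φ y) = F t (dev (φ x))) →
        ∀ x, φ (ψ x) = ψ (φ x) := by
  have hsep : IsSeparatedMap dev := T2Space.isSeparatedMap dev
  have huniq : ∀ {g₁ g₂ : I → N}, Continuous g₁ → Continuous g₂ → (∀ t, dev (g₁ t) = dev (g₂ t)) →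
      g₁ 0 = g₂ 0 → g₁ = g₂ := fun h₁ h₂ he h0 =>
    hsep.eq_of_comp_eq hdev.isLocallyInjective h₁ h₂ (funext he) 0 h0
  -- A family of lifted paths with continuous starting points is jointly continuous, so the
  -- endpoints depend continuously on x.
  have hlift : ∀ {δ : ℝ} (γ : N → C(I, N)), (∀ x, γ x 0 = x) →
      (∀ x, ∀ t : I, dev (γ x t) = F (t * δ) (dev x)) → Continuous fun x => γ x 1 := by
    intro δ γ h0 hγ
    let f : C(I × N, X) := ⟨fun z => F (z.1 * δ) (dev z.2), hF.comp
      (Continuous.prodMk (by fun_prop) (hdev.continuous.comp continuous_snd))⟩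
    have h := hdev.continuous_lift hsep f (g := fun z => γ z.2 z.1)
      (funext fun z => hγ z.2 z.1) (by simp only [h0]; exact continuous_id)
      (fun x => (γ x).continuous)
    exact h.comp (Continuous.prodMk continuous_const continuous_id)
  choose γ hγ0 hγ using hpos
  choose δ hδ0 hδ using hneg
  -- By uniqueness of lifts, the path for time −η from the endpoint is the original path reversed;
  -- hence the maps for ε and −ε are inverse to each other.
  have hrev : ∀ (x : N) {η : ℝ} (α : C(I, N)) (β : C(I, N)), α 0 = x →
      (∀ t : I, dev (α t) = F (t * η) (dev x)) → β 0 = α 1 →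
      (∀ t : I, dev (β t) = F (t * -η) (dev (α 1))) → β 1 = x := by
    intro x η α β hα0 hα hβ0 hβ
    have h1 : (fun t : I => β t) = fun t : I => α (σ t) := by
      refine huniq β.continuous (α.continuous.comp unitInterval.continuous_symm) (fun t => ?_) ?_
      · rw [hβ, hα, hα, ← hF_add]
        congr 1
        simp only [unitInterval.coe_symm_eq, Set.Icc.coe_one]
        ring
      · rw [unitInterval.symm_zero, hβ0]
    have h2 := congrFun h1 1
    simp only [unitInterval.symm_one, hα0] at h2
    exact h2
  refine ⟨{ toFun := fun x => γ x 1, invFun := fun x => δ x 1,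
            left_inv := fun x => hrev x (γ x) (δ (γ x 1)) (hγ0 x) (hγ x) (hδ0 _) (hδ _),
            right_inv := fun x => hrev x (δ x) (γ (δ x 1)) (hδ0 x) (hδ x) (hγ0 _)
              (by simpa using hγ (δ x 1)),
            continuous_toFun := hlift γ hγ0 hγ, continuous_invFun := hlift δ hδ0 hδ }, ?_, ?_⟩
  · intro x
    have := hγ x 1
    simpa using this
  · intro φ hφ x
    -- A φ compatible with the flow carries lifted flow lines to lifted flow lines, and these are
    -- determined by their starting point.
    have h1 : (fun t : I => φ (γ x t)) = fun t => γ (φ x) t := by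
      refine huniq (φ.continuous.comp (γ x).continuous) (γ (φ x)).continuous (fun t => ?_) ?_
      · rw [hγ, hφ x _ _ (hγ x t)]
      · rw [hγ0, hγ0]
    exact congrFun h1 1

/-- Flow lines lift locally, for a short time. -/
theorem exists_nhds_hasFlowLift (hdev : IsLocalHomeomorph dev)
    (hF : Continuous fun z : ℝ × X => F z.1 z.2) (hF_zero : ∀ x, F 0 x = x) (x : N) :
    ∃ δ > 0, ∃ W, IsOpen W ∧ x ∈ W ∧ ∀ y ∈ W, ∀ s : ℝ, |s| ≤ δ → HasFlowLift F dev s y := by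
  obtain ⟨e, hxe, rfl⟩ := hdev x
  have h1 : ∀ᶠ z : ℝ × X in 𝓝 (0, e x), F z.1 z.2 ∈ e.target := by
    refine hF.continuousAt.eventually_mem (e.open_target.mem_nhds ?_)
    rw [hF_zero]
    exact e.map_source hxe
  rw [nhds_prod_eq, eventually_prod_iff] at h1
  obtain ⟨p, hp, q, hq, hpq⟩ := h1
  obtain ⟨r, hr, hball⟩ := Metric.eventually_nhds_iff.1 hp
  obtain ⟨O, hOq, hO, hxO⟩ := eventually_nhds_iff.1 hq
  refine ⟨r / 2, half_pos hr, e.source ∩ e ⁻¹' O, e.isOpen_inter_preimage hO, ⟨hxe, hxO⟩, ?_⟩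
  rintro y ⟨hye, hyO⟩ s hs
  have hmem : ∀ t : I, F (t * s) (e y) ∈ e.target := by
    intro t
    refine hpq (hball ?_) (hOq _ hyO)
    rw [dist_zero_right, Real.norm_eq_abs, abs_mul]
    have ht : |(t : ℝ)| ≤ 1 := by rw [abs_of_nonneg t.2.1]; exact t.2.2
    nlinarith [abs_nonneg s, abs_nonneg (t : ℝ)]
  have hFc : Continuous fun t : I => F (t * s) (e y) :=
    hF.comp (Continuous.prodMk (by fun_prop) continuous_const)
  refine ⟨⟨fun t => e.symm (F (t * s) (e y)), e.continuousOn_symm.comp_continuous hFc hmem⟩, ?_,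
    fun t => e.right_inv (hmem t)⟩
  change e.symm (F ((0 : I) * s) (e y)) = y
  rw [Set.Icc.coe_zero, zero_mul, hF_zero]
  exact e.left_inv hye

/-- Over a compact quotient, the flow lines lift for a uniform time. -/
theorem exists_pos_hasFlowLift {M : Type*} [TopologicalSpace M] [CompactSpace M] {π : N → M}
    (hπo : IsOpenMap π) (hπs : Function.Surjective π) (hdev : IsLocalHomeomorph dev)
    (hF : Continuous fun z : ℝ × X => F z.1 z.2) (hF_zero : ∀ x, F 0 x = x)
    (hdeck : ∀ x y, π x = π y → ∃ φ : N ≃ₜ N, φ x = y ∧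
      ∀ x y t, dev y = F t (dev x) → dev (φ y) = F t (dev (φ x))) :
    ∃ ε > 0, ∀ x, ∀ s : ℝ, |s| ≤ ε → HasFlowLift F dev s x := by
  have key : ∃ ε > 0, ∀ x, π x ∈ (Set.univ : Set M) → ∀ s : ℝ, |s| ≤ ε → HasFlowLift F dev s x := by
    -- A uniform lifting time is inherited by finite unions, so compactness reduces the claim to
    -- small neighbourhoods in M.
    refine isCompact_univ.induction_on
      (p := fun S => ∃ ε > 0, ∀ x, π x ∈ S → ∀ s : ℝ, |s| ≤ ε → HasFlowLift F dev s x)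
      ⟨1, one_pos, fun x hx => hx.elim⟩ ?_ ?_ ?_
    · rintro S T hST ⟨ε, hε, h⟩
      exact ⟨ε, hε, fun x hx => h x (hST hx)⟩
    · rintro S T ⟨ε, hε, h⟩ ⟨ε', hε', h'⟩
      refine ⟨min ε ε', lt_min hε hε', ?_⟩
      rintro x (hx | hx) s hs
      · exact h x hx s (hs.trans (min_le_left _ _))
      · exact h' x hx s (hs.trans (min_le_right _ _))
    · intro m _
      obtain ⟨x, rfl⟩ := hπs m
      obtain ⟨δ, hδ, W, hW, hxW, h⟩ := exists_nhds_hasFlowLift hdev hF hF_zero x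
      refine ⟨π '' W, mem_nhdsWithin_of_mem_nhds ((hπo W hW).mem_nhds ⟨x, hxW, rfl⟩), δ, hδ, ?_⟩
      rintro y ⟨w, hw, hwy⟩ s hs
      -- Points over π(W) need not lie in W; a deck transformation carries the lift from a point of
      -- W to any other point of its fibre.
      obtain ⟨φ, rfl, hφ⟩ := hdeck w y hwy
      obtain ⟨γ, hγ0, hγ⟩ := h w hw s hs
      exact ⟨⟨fun t => φ (γ t), φ.continuous.comp γ.continuous⟩, congrArg φ hγ0,
        fun t => hφ _ _ _ (hγ t)⟩
  obtain ⟨ε, hε, h⟩ := key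
  exact ⟨ε, hε, fun x => h x trivial⟩

/-- The flow lines lift through a covering map. -/
theorem hasFlowLift_of_isCoveringMap (hdev : IsCoveringMap dev)
    (hF : Continuous fun z : ℝ × X => F z.1 z.2) (hF_zero : ∀ x, F 0 x = x) (s : ℝ) (x : N) :
    HasFlowLift F dev s x := by
  let γ : C(I, X) := ⟨fun t => F (t * s) (dev x),
    hF.comp (Continuous.prodMk (by fun_prop) continuous_const)⟩
  obtain ⟨Γ, hΓ, hΓ0⟩ := hdev.exists_path_lifts γ x (by simp [γ, hF_zero])
  exact ⟨Γ, hΓ0, fun t => congrFun hΓ t⟩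

end FlowLift

/-! ### Measures on M induced through the developing map. -/

section LocalMeasures

/-- By second countability, countably many of the sets W cover O, and equality of restrictions
passes to countable unions. -/
theorem restrict_congr_of_locally {M : Type*} [TopologicalSpace M] [SecondCountableTopology M]
    [MeasurableSpace M] [BorelSpace M] {ν₁ ν₂ : Measure M} {O : Set M}
    (h : ∀ m ∈ O, ∃ W, IsOpen W ∧ m ∈ W ∧ ν₁.restrict W = ν₂.restrict W) :
    ν₁.restrict O = ν₂.restrict O := by
  choose! W hW hmW hWeq using h
  obtain ⟨T, hT, hTO⟩ := TopologicalSpace.isOpen_iUnion_countable (fun m : O => W m)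
    (fun m => hW m m.2)
  have hsub : O ⊆ ⋃ m ∈ T, W (m : O) := by
    rw [hTO]
    exact fun m hm => Set.mem_iUnion.2 ⟨⟨m, hm⟩, hmW m hm⟩
  have h1 : ν₁.restrict (⋃ m ∈ T, W (m : O)) = ν₂.restrict (⋃ m ∈ T, W (m : O)) :=
    (restrict_biUnion_congr hT).2 fun m _ => hWeq m m.2
  rw [← restrict_restrict_of_subset hsub, h1, restrict_restrict_of_subset hsub]

/-- Two finite measures agreeing on the open subsets of an open set agree there. -/
theorem restrict_congr_of_isOpen {M : Type*} [TopologicalSpace M]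
    [MeasurableSpace M] [BorelSpace M] {ν₁ ν₂ : Measure M} {W : Set M} (hW : IsOpen W)
    (hfin : ν₁ W ≠ ⊤) (h : ∀ O, IsOpen O → O ⊆ W → ν₁ O = ν₂ O) :
    ν₁.restrict W = ν₂.restrict W := by
  have : IsFiniteMeasure (ν₁.restrict W) := ⟨by rw [restrict_apply_univ]; exact hfin.lt_top⟩
  refine ext_of_generate_finite {O | IsOpen O} (BorelSpace.measurable_eq) isPiSystem_isOpen
    (fun O hO => ?_) ?_
  · rw [restrict_apply hO.measurableSet, restrict_apply hO.measurableSet]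
    exact h _ (hO.inter hW) Set.inter_subset_right
  · rw [restrict_apply_univ, restrict_apply_univ]
    exact h W hW le_rfl

variable {M N G : Type*} [TopologicalSpace M] [TopologicalSpace N] [TopologicalSpace G]
  {π : N → M} {d : N → G}

/-- An open set on which both maps are injective. -/
structure IsGoodOpen (π : N → M) (d : N → G) (U : Set N) : Prop where
  isOpen : IsOpen U
  injOn_left : Set.InjOn π U
  injOn_right : Set.InjOn d U

theorem IsGoodOpen.mono {U U' : Set N} (h : IsGoodOpen π d U) (ho : IsOpen U') (hU : U' ⊆ U) :
    IsGoodOpen π d U' :=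
  ⟨ho, h.injOn_left.mono hU, h.injOn_right.mono hU⟩

theorem exists_isGoodOpen (hπ : IsLocalHomeomorph π) (hd : IsLocalHomeomorph d) (x : N) :
    ∃ U, x ∈ U ∧ IsGoodOpen π d U := by
  obtain ⟨e, hx, rfl⟩ := hπ x
  obtain ⟨e', hx', rfl⟩ := hd x
  exact ⟨e.source ∩ e'.source, ⟨hx, hx'⟩, e.open_source.inter e'.open_source,
    e.injOn.mono Set.inter_subset_left, e'.injOn.mono Set.inter_subset_right⟩

theorem image_inter_preimage_of_injOn {U : Set N} {O : Set M} (hO : O ⊆ π '' U) :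
    π '' (U ∩ π ⁻¹' O) = O := by
  rw [Set.image_inter_preimage]
  exact Set.inter_eq_right.2 hO

/-- A finite measure induced by `μ` cannot be scaled by a lift to `N`. -/
theorem eq_one_of_induced [SecondCountableTopology M] [MeasurableSpace M] [BorelSpace M]
    [MeasurableSpace G] [BorelSpace G] [Nonempty N] (hπ : IsLocalHomeomorph π)
    (hπs : Function.Surjective π) (hd : IsLocalHomeomorph d) {μ : Measure G} [μ.IsOpenPosMeasure]
    {ν : Measure M} (hν : ∀ U, IsGoodOpen π d U → ν (π '' U) = μ (d '' U)) (hfin : ν Set.univ < ⊤)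
    {ψ : N ≃ₜ N} (hψπ : ∀ x y, π x = π y ↔ π (ψ x) = π (ψ y))
    (hψd : ∀ x y, d (ψ x) = d (ψ y) → d x = d y) {c : ℝ≥0}
    (hc : ∀ U, μ (d '' (ψ '' U)) = c * μ (d '' U)) : c = 1 := by
  have hfm : IsFiniteMeasure ν := ⟨hfin⟩
  have hq : Topology.IsQuotientMap π := hπ.isOpenMap.isQuotientMap hπ.continuous hπs
  -- A homeomorphism of N preserving the fibres of the quotient map π descends to M; applied to ψ
  -- and its inverse, this yields mutually inverse maps f and g.
  have hlift : ∀ θ : N ≃ₜ N, (∀ x y, π x = π y → π (θ x) = π (θ y)) →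
      ∃ f : M → M, Continuous f ∧ ∀ x, f (π x) = π (θ x) := by
    intro θ hθ
    have h1 : ∀ x, π (θ (Function.surjInv hπs (π x))) = π (θ x) := fun x =>
      hθ _ _ (Function.surjInv_eq hπs _)
    refine ⟨fun m => π (θ (Function.surjInv hπs m)), ?_, h1⟩
    rw [hq.continuous_iff]
    have : (fun m => π (θ (Function.surjInv hπs m))) ∘ π = fun x => π (θ x) := funext h1
    rw [this]
    exact hπ.continuous.comp θ.continuous
  obtain ⟨f, hf, hfπ⟩ := hlift ψ fun x y => (hψπ x y).1
  obtain ⟨g, hg, hgπ⟩ := hlift ψ.symm fun x y hxy => by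
    rw [hψπ, ψ.apply_symm_apply, ψ.apply_symm_apply]
    exact hxy
  have hfg : ∀ m, f (g m) = m := by
    intro m
    obtain ⟨x, rfl⟩ := hπs m
    rw [hgπ, hfπ, ψ.apply_symm_apply]
  have hgf : ∀ m, g (f m) = m := by
    intro m
    obtain ⟨x, rfl⟩ := hπs m
    rw [hfπ, hgπ, ψ.symm_apply_apply]
  -- The preimage of O under g = f⁻¹ is f(O). On a good open set its measure is computed upstairs,
  -- where ψ scales by c.
  have hlocal : (map g ν).restrict Set.univ = (c • ν).restrict Set.univ := by
    refine restrict_congr_of_locally fun m _ => ?_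
    obtain ⟨x, rfl⟩ := hπs m
    obtain ⟨U, hxU, hU⟩ := exists_isGoodOpen hπ hd x
    have hπU : IsOpen (π '' U) := hπ.isOpenMap U hU.isOpen
    refine ⟨π '' U, hπU, ⟨x, hxU, rfl⟩, restrict_congr_of_isOpen hπU (measure_ne_top _ _) ?_⟩
    intro O hO hOU
    have hU' : IsGoodOpen π d (U ∩ π ⁻¹' O) :=
      hU.mono (hU.isOpen.inter (hO.preimage hπ.continuous)) Set.inter_subset_left
    have hU'' : IsGoodOpen π d (ψ '' (U ∩ π ⁻¹' O)) := by
      refine ⟨ψ.isOpenMap _ hU'.isOpen, ?_, ?_⟩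
      · rintro _ ⟨y, hy, rfl⟩ _ ⟨z, hz, rfl⟩ hyz
        rw [hU'.injOn_left hy hz ((hψπ y z).2 hyz)]
      · rintro _ ⟨y, hy, rfl⟩ _ ⟨z, hz, rfl⟩ hyz
        rw [hU'.injOn_right hy hz (hψd y z hyz)]
    have h1 : π '' (U ∩ π ⁻¹' O) = O := image_inter_preimage_of_injOn hOU
    have h2 : g ⁻¹' O = π '' (ψ '' (U ∩ π ⁻¹' O)) := by
      ext m
      constructor
      · intro hm
        rw [Set.mem_preimage, ← h1] at hm
        obtain ⟨y, hy, hym⟩ := hm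
        refine ⟨ψ y, ⟨y, hy, rfl⟩, ?_⟩
        rw [← hfπ, hym, hfg]
      · rintro ⟨_, ⟨y, hy, rfl⟩, rfl⟩
        rw [Set.mem_preimage, hgπ, ψ.symm_apply_apply]
        exact hy.2
    rw [map_apply hg.measurable hO.measurableSet, h2, hν _ hU'', hc, ← hν _ hU', h1]
    rfl
  have htot : ν Set.univ = c * ν Set.univ := by
    have h1 := congrArg (fun ρ : Measure M => ρ Set.univ) hlocal
    simp only [restrict_univ, map_apply hg.measurable MeasurableSet.univ, Set.preimage_univ] at h1
    exact h1
  have hpos : ν Set.univ ≠ 0 := by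
    obtain ⟨x⟩ := ‹Nonempty N›
    obtain ⟨U, hxU, hU⟩ := exists_isGoodOpen hπ hd x
    have h1 : 0 < μ (d '' U) := (hd.isOpenMap U hU.isOpen).measure_pos μ ⟨d x, x, hxU, rfl⟩
    rw [← hν U hU] at h1
    exact (h1.trans_le (measure_mono (Set.subset_univ _))).ne'
  have h2 : (c : ENNReal) = 1 := by
    have h3 : (c : ENNReal) * ν Set.univ = 1 * ν Set.univ := by rw [one_mul, ← htot]
    exact (ENNReal.mul_left_inj hpos hfin.ne).1 h3
  exact_mod_cast h2

variable [MeasurableSpace M] [BorelSpace M] [MeasurableSpace G] [BorelSpace G]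

/-- The measure induced by `μ` on the image of a good open set. -/
theorem exists_inducedMeasure (hπ : Continuous π) (hd : IsLocalHomeomorph d) (μ : Measure G)
    {U : Set N} (hU : IsGoodOpen π d U) :
    ∃ ν : Measure M, ∀ B, MeasurableSet B → ν B = μ (d '' (U ∩ π ⁻¹' B)) := by
  borelize N
  have he : Topology.IsOpenEmbedding fun x : U => d x := by
    refine Topology.IsOpenEmbedding.of_continuous_injective_isOpenMap
      (hd.continuous.comp continuous_subtype_val) (fun x y hxy => ?_)
      (hd.isOpenMap.comp hU.isOpen.isOpenMap_subtype_val)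
    exact Subtype.ext (hU.injOn_right x.2 y.2 hxy)
  have hm : Measurable fun x : U => π x := (hπ.comp continuous_subtype_val).measurable
  refine ⟨map (fun x : U => π x) (comap (fun x : U => d x) μ), fun B hB => ?_⟩
  rw [map_apply hm hB, he.measurableEmbedding.comap_apply]
  congr 1
  ext g
  constructor
  · rintro ⟨x, hx, rfl⟩
    exact ⟨x, ⟨x.2, hx⟩, rfl⟩
  · rintro ⟨x, ⟨hxU, hx⟩, rfl⟩
    exact ⟨⟨x, hxU⟩, hx, rfl⟩

variable [SecondCountableTopology M]

/-- The measures induced on two good open sets agree on the overlap. -/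
theorem inducedMeasure_compat (hπ : IsLocalHomeomorph π) (hd : IsLocalHomeomorph d) (μ : Measure G)
    (hdeck : ∀ x y, π x = π y → ∃ φ : N ≃ₜ N, φ x = y ∧ (∀ z, π (φ z) = π z) ∧
      ∀ A, μ (d '' (φ '' A)) = μ (d '' A))
    {U U' : Set N} (hU : IsGoodOpen π d U) (hU' : IsGoodOpen π d U') {B : Set M}
    (hB : MeasurableSet B) (hBU : B ⊆ π '' U) (hBU' : B ⊆ π '' U') :
    μ (d '' (U ∩ π ⁻¹' B)) = μ (d '' (U' ∩ π ⁻¹' B)) := by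
  obtain ⟨ν, hν⟩ := exists_inducedMeasure hπ.continuous hd μ hU
  obtain ⟨ν', hν'⟩ := exists_inducedMeasure hπ.continuous hd μ hU'
  have h : ν.restrict (π '' U ∩ π '' U') = ν'.restrict (π '' U ∩ π '' U') := by
    refine restrict_congr_of_locally ?_
    rintro _ ⟨⟨x, hx, rfl⟩, ⟨y, hy, hyx⟩⟩
    obtain ⟨φ, rfl, hφπ, hφ⟩ := hdeck x y hyx.symm
    have hV : IsOpen (U ∩ φ ⁻¹' U') := hU.isOpen.inter (hU'.isOpen.preimage φ.continuous)
    refine ⟨π '' (U ∩ φ ⁻¹' U'), hπ.isOpenMap _ hV, ⟨x, ⟨hx, hy⟩, rfl⟩, ?_⟩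
    ext C hC
    have hCm := hC.inter (hπ.isOpenMap _ hV).measurableSet
    rw [restrict_apply hC, restrict_apply hC, hν _ hCm, hν' _ hCm]
    -- Over this neighbourhood the sheet in U' is the image under φ of the sheet in U, and deck
    -- transformations do not change the developed measure.
    have h1 : U' ∩ π ⁻¹' (C ∩ π '' (U ∩ φ ⁻¹' U')) =
        φ '' (U ∩ π ⁻¹' (C ∩ π '' (U ∩ φ ⁻¹' U'))) := by
      ext z
      constructor
      · rintro ⟨hz, hzC, w, hw, hwz⟩
        have h2 : φ w = z := hU'.injOn_left hw.2 hz (by rw [hφπ, hwz])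
        refine ⟨w, ⟨hw.1, ?_⟩, h2⟩
        rw [Set.mem_preimage, hwz]
        exact ⟨hzC, w, hw, hwz⟩
      · rintro ⟨w, ⟨hwU, hwC, w', hw', hww⟩, rfl⟩
        have h2 : w' = w := hU.injOn_left hw'.1 hwU hww
        subst h2
        refine ⟨hw'.2, ?_⟩
        rw [Set.mem_preimage, hφπ]
        exact ⟨hwC, w', hw', rfl⟩
    rw [h1, hφ]
  have h3 := congrArg (fun ρ : Measure M => ρ B) h
  simp only [restrict_apply hB, Set.inter_eq_left.2 (Set.subset_inter hBU hBU')] at h3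
  rw [← hν B hB, ← hν' B hB, h3]

/-- Over a compact base there is a finite induced measure. -/
theorem exists_finite_inducedMeasure [CompactSpace M] (hπ : IsLocalHomeomorph π)
    (hπs : Function.Surjective π) (hd : IsLocalHomeomorph d) (μ : Measure G)
    [IsLocallyFiniteMeasure μ]
    (hdeck : ∀ x y, π x = π y → ∃ φ : N ≃ₜ N, φ x = y ∧ (∀ z, π (φ z) = π z) ∧
      ∀ A, μ (d '' (φ '' A)) = μ (d '' A)) :
    ∃ ν : Measure M, ν Set.univ < ⊤ ∧ ∀ U, IsGoodOpen π d U → ν (π '' U) = μ (d '' U) := by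
  have key : ∃ (ν : Measure M) (O : Set M), ν Set.univ < ⊤ ∧ IsOpen O ∧ Set.univ ⊆ O ∧
      ∀ U, IsGoodOpen π d U → ∀ B, MeasurableSet B → B ⊆ O → B ⊆ π '' U →
        ν B = μ (d '' (U ∩ π ⁻¹' B)) := by
    -- The predicate carries an open set O containing S, so that local measures can be glued over
    -- finite unions.
    refine isCompact_univ.induction_on (p := fun S => ∃ (ν : Measure M) (O : Set M),
      ν Set.univ < ⊤ ∧ IsOpen O ∧ S ⊆ O ∧ ∀ U, IsGoodOpen π d U → ∀ B, MeasurableSet B → B ⊆ O →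
        B ⊆ π '' U → ν B = μ (d '' (U ∩ π ⁻¹' B))) ?_ ?_ ?_ ?_
    · refine ⟨0, ∅, by simp, isOpen_empty, le_rfl, fun U _ B _ hB _ => ?_⟩
      rw [Set.subset_empty_iff.1 hB]
      simp
    · rintro S T hST ⟨ν, O, h1, h2, h3, h4⟩
      exact ⟨ν, O, h1, h2, hST.trans h3, h4⟩
    · rintro S T ⟨ν, O, h1, h2, h3, h4⟩ ⟨ν', O', h1', h2', h3', h4'⟩
      -- The first measure is kept on O and the second used off O; additivity on a good open set
      -- shows that nothing is lost.
      refine ⟨ν.restrict O + ν'.restrict Oᶜ, O ∪ O', ?_, h2.union h2', Set.union_subset_union h3 h3',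
        fun U hU B hB hBO hBU => ?_⟩
      · rw [add_apply, restrict_apply_univ, restrict_apply_univ]
        exact ENNReal.add_lt_top.2 ⟨(measure_mono (Set.subset_univ _)).trans_lt h1,
          (measure_mono (Set.subset_univ _)).trans_lt h1'⟩
      · obtain ⟨νU, hνU⟩ := exists_inducedMeasure hπ.continuous hd μ hU
        have hm : MeasurableSet (B ∩ O) := hB.inter h2.measurableSet
        have hm' : MeasurableSet (B ∩ Oᶜ) := hB.inter h2.measurableSet.compl
        rw [add_apply, restrict_apply hB, restrict_apply hB,
          h4 U hU _ hm Set.inter_subset_right (Set.inter_subset_left.trans hBU),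
          h4' U hU _ hm' (fun m hm => (hBO hm.1).resolve_left hm.2)
            (Set.inter_subset_left.trans hBU), ← hνU _ hm, ← hνU _ hm', ← hνU _ hB]
        exact measure_inter_add_diff B h2.measurableSet
    · intro m _
      obtain ⟨x, rfl⟩ := hπs m
      obtain ⟨U₁, hxU₁, hU₁⟩ := exists_isGoodOpen hπ hd x
      obtain ⟨O, hdO, hO, hOfin⟩ := μ.exists_isOpen_measure_lt_top (d x)
      have hU₀ : IsGoodOpen π d (U₁ ∩ d ⁻¹' O) :=
        hU₁.mono (hU₁.isOpen.inter (hO.preimage hd.continuous)) Set.inter_subset_left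
      obtain ⟨ν, hν⟩ := exists_inducedMeasure hπ.continuous hd μ hU₀
      have hopen := hπ.isOpenMap _ hU₀.isOpen
      refine ⟨π '' (U₁ ∩ d ⁻¹' O), mem_nhdsWithin_of_mem_nhds
        (hopen.mem_nhds ⟨x, ⟨hxU₁, hdO⟩, rfl⟩), ν, π '' (U₁ ∩ d ⁻¹' O), ?_, hopen, le_rfl, ?_⟩
      · rw [hν _ MeasurableSet.univ]
        refine (measure_mono ?_).trans_lt hOfin
        rintro _ ⟨y, ⟨hy, -⟩, rfl⟩
        exact hy.2
      · intro U hU B hB hBO hBU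
        rw [hν B hB]
        exact inducedMeasure_compat hπ hd μ hdeck hU₀ hU hB hBO hBU
  obtain ⟨ν, O, h1, -, h3, h4⟩ := key
  refine ⟨ν, h1, fun U hU => ?_⟩
  rw [h4 U hU _ (hπ.isOpenMap U hU.isOpen).measurableSet ((Set.subset_univ _).trans h3) le_rfl,
    Set.inter_eq_left.2 (Set.subset_preimage_image π U)]

end LocalMeasures

theorem measure_image_mul_mul {G : Type*} [Group G] [MeasurableSpace G] [MeasurableMul G]
    (μ : Measure G) [μ.IsMulLeftInvariant] [μ.IsMulRightInvariant] (p q : G) (A : Set G) :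
    μ ((fun g => p * g * q⁻¹) '' A) = μ A := by
  have h : (fun g => p * g * q⁻¹) '' A = (fun g => g * q) ⁻¹' ((fun g => p⁻¹ * g) ⁻¹' A) := by
    ext g
    constructor
    · rintro ⟨x, hx, rfl⟩
      simpa [mul_assoc] using hx
    · intro hg
      exact ⟨p⁻¹ * (g * q), hg, by group⟩
  rw [h, measure_preimage_mul_right, measure_preimage_mul]

/-! ### Structures on closed manifolds, and complete structures of finite volume. -/

section Structures

variable {F : Type*} [NormedAddCommGroup F] [NormedSpace ℝ F] [FiniteDimensional ℝ F]
  {M : Type*} [TopologicalSpace M] [ChartedSpace F M]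
  {N : Type*} [TopologicalSpace N] [ChartedSpace F N]
  {E : Type*} [NormedAddCommGroup E] [NormedSpace ℝ E]
  {G : Type*} [TopologicalSpace G] [ChartedSpace E G] [Group G] [IsTopologicalGroup G]
  [T2Space G] [LocallyCompactSpace G] [SecondCountableTopology G]
  {P Q U : Subgroup G} {a : ℝ → G} {π : N → M}

namespace BigCellStructure

theorem isLocalHomeomorph_coe_dev (S : BigCellStructure F E P Q π) :
    IsLocalHomeomorph fun x => (S.dev x : G) := S.isLocalDiffeomorph.isLocalHomeomorph

theorem isLocalHomeomorph_dev (S : BigCellStructure F E P Q π) (h : ContractingPair P Q U a) :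
    IsLocalHomeomorph S.dev :=
  IsLocalHomeomorph.of_comp S.isLocalHomeomorph_coe_dev
    h.isOpen_bigCell.isOpenEmbedding_subtypeVal.isLocalHomeomorph
    (Topology.IsInducing.subtypeVal.continuous_iff.2 S.isLocalHomeomorph_coe_dev.continuous)

/-- Deck transformations act on the big cell through P × Q, which commutes with the flow. -/
theorem dev_deck_flow (S : BigCellStructure F E P Q π) (h : ContractingPair P Q U a) {φ : N ≃ₜ N}
    (hφ : φ ∈ deckGroup π) (x y : N) (t : ℝ) (hxy : S.dev y = h.flow t (S.dev x)) :
    S.dev (φ y) = h.flow t (S.dev (φ x)) := by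
  refine Subtype.ext ?_
  rw [h.coe_flow_equivariant t (S.hol ⟨φ, hφ⟩).1.2 (S.hol ⟨φ, hφ⟩).2.2
    (S.equivariant ⟨φ, hφ⟩ x), S.equivariant ⟨φ, hφ⟩ y, hxy]

theorem measure_image_deck [MeasurableSpace G] [BorelSpace G] (S : BigCellStructure F E P Q π)
    (μ : Measure G) [μ.IsMulLeftInvariant] [μ.IsMulRightInvariant] {φ : N ≃ₜ N}
    (hφ : φ ∈ deckGroup π) (A : Set N) :
    μ ((fun x => (S.dev x : G)) '' (φ '' A)) = μ ((fun x => (S.dev x : G)) '' A) := by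
  rw [← measure_image_mul_mul μ (S.hol ⟨φ, hφ⟩).1 (S.hol ⟨φ, hφ⟩).2
    ((fun x => (S.dev x : G)) '' A), Set.image_image, Set.image_image]
  congr 1
  refine Set.image_congr fun x _ => ?_
  exact S.equivariant ⟨φ, hφ⟩ x

/-- There is no finite induced measure if the flow lines lift. -/
theorem false_of_hasFlowLift [T2Space M] [SecondCountableTopology M] [MeasurableSpace M]
    [BorelSpace M] [MeasurableSpace G] [BorelSpace G] (hπ : IsUniversalCover F π)
    (S : BigCellStructure F E P Q π) (h : ContractingPair P Q U a) (μ : Measure G)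
    [μ.IsHaarMeasure] [μ.IsMulRightInvariant] {ν : Measure M}
    (hν : ∀ U, IsGoodOpen π (fun x => (S.dev x : G)) U →
      ν (π '' U) = μ ((fun x => (S.dev x : G)) '' U)) (hfin : ν Set.univ < ⊤) {ε : ℝ} (hε : 0 < ε)
    (hlift : ∀ x, ∀ s : ℝ, |s| ≤ ε → HasFlowLift (fun t => h.flow t) S.dev s x) : False := by
  have := hπ.simplyConnected
  have : LocallyPathConnectedSpace N := ChartedSpace.locallyPathConnectedSpace F N
  have : T2Space N := t2Space_of_isCoveringMap hπ.isCoveringMap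
  obtain ⟨ψ, hψ, hψφ⟩ := exists_homeomorph_lift (S.isLocalHomeomorph_dev h)
    h.continuous_flow_uncurry h.flow_add_apply (fun x => hlift x ε (abs_of_pos hε).le)
    (fun x => hlift x (-ε) (by rw [abs_neg, abs_of_pos hε]))
  obtain ⟨c, -, hc1, hc⟩ := h.exists_measure_flow_image μ hε
  refine hc1 (eq_one_of_induced hπ.isCoveringMap.isLocalHomeomorph hπ.surjective
    S.isLocalHomeomorph_coe_dev hν hfin (ψ := ψ) (fun x y => ⟨fun hxy => ?_, fun hxy => ?_⟩)
    (fun x y hxy => ?_) (c := c) fun A => ?_)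
  · obtain ⟨φ, hφ, rfl⟩ := exists_mem_deckGroup hπ.isCoveringMap hxy
    rw [← hψφ φ (S.dev_deck_flow h hφ), hφ]
  · obtain ⟨φ, hφ, hφx⟩ := exists_mem_deckGroup hπ.isCoveringMap hxy
    rw [hψφ φ (S.dev_deck_flow h hφ)] at hφx
    rw [← ψ.injective hφx, hφ]
  · have h1 : S.dev (ψ x) = S.dev (ψ y) := Subtype.ext hxy
    rw [hψ, hψ] at h1
    rw [(h.flow ε).injective h1]
  · have h1 : ∀ B : Set N, (fun x => (S.dev x : G)) '' B = Subtype.val '' (S.dev '' B) :=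
      fun B => (Set.image_image _ _ _).symm
    rw [h1, h1, ← hc]
    congr 2
    rw [Set.image_image, Set.image_image]
    exact Set.image_congr fun x _ => hψ x

/-- Path lifting through the covering `dev` gives flow lines for every time, so ε = 1 will do. -/
theorem not_hasFiniteVolume [T2Space M] [SecondCountableTopology M] [MeasurableSpace M]
    [BorelSpace M] [MeasurableSpace G] [BorelSpace G] (hπ : IsUniversalCover F π)
    (S : BigCellStructure F E P Q π) (h : ContractingPair P Q U a) (μ : Measure G)
    [μ.IsHaarMeasure] [μ.IsMulRightInvariant] (hS : S.IsComplete) : ¬ S.HasFiniteVolume μ := by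
  rintro ⟨ν, hν, hfin⟩
  refine S.false_of_hasFlowLift hπ h μ (fun U hU => ?_) hfin one_pos fun x s _ =>
    hasFlowLift_of_isCoveringMap hS h.continuous_flow_uncurry h.flow_zero_apply s x
  exact hν U hU.isOpen hU.injOn_left fun x hx y hy hxy =>
    hU.injOn_right hx hy (congrArg Subtype.val hxy)

/-- Compactness is used twice: for a uniform time over which flow lines lift, and for the finiteness
of the induced measure. -/
theorem isEmpty_of_compactSpace [T2Space M] [CompactSpace M] [MeasurableSpace G] [BorelSpace G]
    (hπ : IsUniversalCover F π) (h : ContractingPair P Q U a) (μ : Measure G)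
    [μ.IsHaarMeasure] [μ.IsMulRightInvariant] : IsEmpty (BigCellStructure F E P Q π) := by
  refine ⟨fun S => ?_⟩
  have := hπ.simplyConnected
  have : LocallyPathConnectedSpace N := ChartedSpace.locallyPathConnectedSpace F N
  have : ProperSpace F := FiniteDimensional.proper ℝ F
  have : SecondCountableTopology M := ChartedSpace.secondCountable_of_sigmaCompact F M
  borelize M
  have hlh := hπ.isCoveringMap.isLocalHomeomorph
  obtain ⟨ε, hε, hlift⟩ := exists_pos_hasFlowLift (F := fun t => h.flow t) hlh.isOpenMap
    hπ.surjective (S.isLocalHomeomorph_dev h) h.continuous_flow_uncurry h.flow_zero_apply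
    fun x y hxy => by
      obtain ⟨φ, hφ, hφx⟩ := exists_mem_deckGroup hπ.isCoveringMap hxy
      exact ⟨φ, hφx, S.dev_deck_flow h hφ⟩
  obtain ⟨ν, hfin, hν⟩ := exists_finite_inducedMeasure hlh hπ.surjective
    S.isLocalHomeomorph_coe_dev μ fun x y hxy => by
      obtain ⟨φ, hφ, hφx⟩ := exists_mem_deckGroup hπ.isCoveringMap hxy
      exact ⟨φ, hφx, hφ, S.measure_image_deck μ hφ⟩
  exact S.false_of_hasFlowLift hπ h μ hν hfin hε hlift

end BigCellStructure
end Structures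

/-! ### Discrete groups acting on G and on (G × G)/Diag(G). -/

/-- A countable measure-preserving action with a finite-volume set that meets each orbit finitely
often does not commute with a map scaling the measure. -/
theorem eq_one_of_map_eq_smul {X Γ : Type*} [MeasurableSpace X] [Group Γ] [Countable Γ]
    [MulAction Γ X] {μ : Measure X} (hμ : ∀ γ : Γ, MeasurePreserving (fun x : X => γ • x) μ μ)
    (hμ0 : μ Set.univ ≠ 0) {K : Set X} (hK : MeasurableSet K) (hKfin : μ K ≠ ⊤)
    (hKc : ∀ x, ∃ γ : Γ, γ • x ∈ K) (hKf : ∀ x, {γ : Γ | γ • x ∈ K}.Finite)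
    {Φ : X → X} (hΦm : Measurable Φ) (hΦ : ∀ (γ : Γ) x, Φ (γ • x) = γ • Φ x) {c : ℝ≥0}
    (hc : map Φ μ = c • μ) : c = 1 := by
  classical
  let k : X → ENNReal := K.indicator 1
  have hk : Measurable k := measurable_one.indicator hK
  let n : X → ENNReal := fun x => ∑' γ : Γ, k (γ • x)
  have hn : Measurable n := Measurable.tsum fun γ => hk.comp (hμ γ).measurable
  have hn_inv : ∀ (δ : Γ) x, n (δ • x) = n x := by
    intro δ x
    simp only [n, smul_smul]
    exact (Equiv.mulRight δ).tsum_eq (fun γ => k (γ • x))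
  have hn0 : ∀ x, n x ≠ 0 := by
    intro x
    obtain ⟨γ, hγ⟩ := hKc x
    have h1 : k (γ • x) ≤ n x := ENNReal.le_tsum γ
    rw [show k (γ • x) = 1 from Set.indicator_of_mem hγ _] at h1
    exact (zero_lt_one.trans_le h1).ne'
  have hntop : ∀ x, n x ≠ ⊤ := by
    intro x
    have h1 : n x = ∑ γ ∈ (hKf x).toFinset, k (γ • x) := by
      refine tsum_eq_sum fun γ hγ => Set.indicator_of_notMem ?_ _
      simpa using hγ
    rw [h1]
    refine ENNReal.sum_ne_top.2 fun γ hγ => ?_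
    rw [show k (γ • x) = 1 from Set.indicator_of_mem (by simpa using hγ) _]
    exact ENNReal.one_ne_top
  -- Dividing the indicator of K by the Γ-invariant number of returns to K gives a weight whose sum
  -- over every orbit, indexed by Γ, is 1. It plays the part of a fundamental domain.
  let w : X → ENNReal := fun x => k x * (n x)⁻¹
  have hw : Measurable w := hk.mul hn.inv
  have hsum : ∀ x, ∑' γ : Γ, w (γ • x) = 1 := by
    intro x
    simp only [w, hn_inv]
    rw [ENNReal.tsum_mul_right]
    exact ENNReal.mul_inv_cancel (hn0 x) (hntop x)
  have hsum' : ∀ x, ∑' γ : Γ, w (γ⁻¹ • x) = 1 := by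
    intro x
    rw [← hsum x]
    exact (Equiv.inv Γ).tsum_eq (fun γ => w (γ • x))
  have hIfin : ∫⁻ x, w x ∂μ ≠ ⊤ := by
    refine ne_top_of_le_ne_top hKfin ?_
    rw [← lintegral_indicator_one hK]
    refine lintegral_mono fun x => ?_
    change k x * (n x)⁻¹ ≤ k x
    by_cases hx : x ∈ K
    · refine mul_le_of_le_one_right' (ENNReal.inv_le_one.2 ?_)
      have h1 : k ((1 : Γ) • x) ≤ n x := ENNReal.le_tsum (f := fun γ : Γ => k (γ • x)) 1
      rw [one_smul, show k x = 1 from Set.indicator_of_mem hx _] at h1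
      exact h1
    · rw [show k x = 0 from Set.indicator_of_notMem hx _, zero_mul]
  have hI0 : ∫⁻ x, w x ∂μ ≠ 0 := by
    intro h0
    refine hμ0 ?_
    calc μ Set.univ = ∫⁻ x, ∑' γ : Γ, w (γ • x) ∂μ := by simp [hsum]
      _ = ∑' γ : Γ, ∫⁻ x, w (γ • x) ∂μ :=
        lintegral_tsum fun γ => (hw.comp (hμ γ).measurable).aemeasurable
      _ = ∑' γ : Γ, ∫⁻ x, w x ∂μ := tsum_congr fun γ => (hμ γ).lintegral_comp hw
      _ = 0 := by simp [h0]
  have h1 : ∫⁻ x, w (Φ x) ∂μ = c * ∫⁻ x, w x ∂μ := by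
    rw [← lintegral_map hw hΦm, hc]
    exact lintegral_smul_measure (c : ENNReal) w
  -- Unfolding: insert the sum of w(γ x), translate each term by γ⁻¹ using the invariance of μ and
  -- the equivariance of Φ, then sum the other factor to 1.
  have h2 : ∫⁻ x, w (Φ x) ∂μ = ∫⁻ x, w x ∂μ := by
    calc ∫⁻ x, w (Φ x) ∂μ = ∫⁻ x, ∑' γ : Γ, w (Φ x) * w (γ • x) ∂μ := by
          refine lintegral_congr fun x => ?_
          rw [ENNReal.tsum_mul_left, hsum, mul_one]
      _ = ∑' γ : Γ, ∫⁻ x, w (Φ x) * w (γ • x) ∂μ :=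
        lintegral_tsum fun γ => ((hw.comp hΦm).mul (hw.comp (hμ γ).measurable)).aemeasurable
      _ = ∑' γ : Γ, ∫⁻ x, w (γ⁻¹ • Φ x) * w x ∂μ := by
          refine tsum_congr fun γ => ?_
          have hm : Measurable fun x => w (γ⁻¹ • Φ x) * w x :=
            (hw.comp ((hμ γ⁻¹).measurable.comp hΦm)).mul hw
          rw [← (hμ γ).lintegral_comp hm]
          refine lintegral_congr fun x => ?_
          rw [hΦ, inv_smul_smul]
      _ = ∫⁻ x, ∑' γ : Γ, w (γ⁻¹ • Φ x) * w x ∂μ :=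
        (lintegral_tsum fun γ =>
          ((hw.comp ((hμ γ⁻¹).measurable.comp hΦm)).mul hw).aemeasurable).symm
      _ = ∫⁻ x, w x ∂μ := by
          refine lintegral_congr fun x => ?_
          rw [ENNReal.tsum_mul_right, hsum', one_mul]
  have h3 : (c : ENNReal) = 1 := by
    refine (ENNReal.mul_left_inj hI0 hIfin).1 ?_
    rw [← h1, h2, one_mul]
  exact_mod_cast h3

/-- A cocompact action on a locally compact space has a compact set meeting every orbit. -/
theorem exists_isCompact_forall_smul_mem {X Γ : Type*} [TopologicalSpace X] [LocallyCompactSpace X]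
    [Group Γ] [MulAction Γ X] [ContinuousConstSMul Γ X]
    [CompactSpace (MulAction.orbitRel.Quotient Γ X)] :
    ∃ K : Set X, IsCompact K ∧ ∀ x, ∃ γ : Γ, γ • x ∈ K := by
  let p : X → MulAction.orbitRel.Quotient Γ X := Quotient.mk _
  have hp : IsOpenMap p := isOpenMap_quotient_mk'_mul
  have key : ∃ K : Set X, IsCompact K ∧ (Set.univ : Set (MulAction.orbitRel.Quotient Γ X)) ⊆ p '' K := by
    refine isCompact_univ.induction_on (p := fun S => ∃ K : Set X, IsCompact K ∧ S ⊆ p '' K)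
      ⟨∅, isCompact_empty, by simp⟩ ?_ ?_ ?_
    · rintro S T hST ⟨K, hK, h⟩
      exact ⟨K, hK, hST.trans h⟩
    · rintro S T ⟨K, hK, h⟩ ⟨L, hL, h'⟩
      refine ⟨K ∪ L, hK.union hL, ?_⟩
      rw [Set.image_union]
      exact Set.union_subset_union h h'
    · intro m _
      obtain ⟨x, rfl⟩ := Quotient.exists_rep m
      obtain ⟨C, hC, hxC⟩ := exists_compact_mem_nhds x
      exact ⟨p '' C, mem_nhdsWithin_of_mem_nhds (hp.image_mem_nhds hxC), C, hC, le_rfl⟩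
  obtain ⟨K, hK, h⟩ := key
  refine ⟨K, hK, fun x => ?_⟩
  obtain ⟨y, hy, hyx⟩ := h (Set.mem_univ (p x))
  have h1 : y ∈ MulAction.orbit Γ x := MulAction.orbitRel_apply.1 (Quotient.exact hyx)
  obtain ⟨γ, hγ⟩ := h1
  exact ⟨γ, by change γ • x = y at hγ; rwa [hγ]⟩

section Discrete

variable {G : Type*} [TopologicalSpace G] [Group G] [IsTopologicalGroup G]
  [T2Space G] [LocallyCompactSpace G] [SecondCountableTopology G] {P Q U : Subgroup G} {a : ℝ → G}

/-- No discrete subgroup of `P × Q` acts properly discontinuously and cocompactly on a space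
equivariantly homeomorphic to `G`. -/
theorem ContractingPair.not_actsProperlyCocompactly [MeasurableSpace G] [BorelSpace G]
    (h : ContractingPair P Q U a) (μ : Measure G) [μ.IsHaarMeasure] [μ.IsMulRightInvariant]
    {Γ : Subgroup (G × G)} (hΓ : Γ ≤ P.prod Q) [DiscreteTopology Γ]
    {X : Type*} [TopologicalSpace X] [MulAction Γ X] (e : X ≃ₜ G)
    (he : ∀ (γ : Γ) x, e (γ • x) = (γ : G × G).1 * e x * (γ : G × G).2⁻¹) :
    ¬ ActsProperlyCocompactly Γ X := by
  rintro ⟨hpd, hcc⟩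
  have : Countable Γ := by
    have : SecondCountableTopology Γ :=
      TopologicalSpace.Subtype.secondCountableTopology (Γ : Set (G × G))
    exact TopologicalSpace.separableSpace_iff_countable.1 inferInstance
  have : ContinuousConstSMul Γ X := by
    refine ⟨fun γ => ?_⟩
    have h1 : (fun x : X => γ • x) = fun x => e.symm ((γ : G × G).1 * e x * (γ : G × G).2⁻¹) := by
      ext x
      rw [← he, e.symm_apply_apply]
    rw [h1]
    exact e.symm.continuous.comp ((continuous_const.mul e.continuous).mul continuous_const)
  have : LocallyCompactSpace X := e.isClosedEmbedding.locallyCompactSpace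
  obtain ⟨C, hC, hCc⟩ := exists_isCompact_forall_smul_mem (Γ := Γ) (X := X)
  let act : MulAction Γ (bigCell P Q) :=
    { smul := fun γ g => ⟨(γ : G × G).1 * g * (γ : G × G).2⁻¹, by
        obtain ⟨p, hp, q, hq, hg⟩ := g.2
        exact ⟨(γ : G × G).1 * p, P.mul_mem (hΓ γ.2).1 hp, q * (γ : G × G).2⁻¹,
          Q.mul_mem hq (Q.inv_mem (hΓ γ.2).2), by rw [hg]; group⟩⟩
      one_smul := fun g => Subtype.ext (show (1 : G) * g * (1 : G)⁻¹ = g by simp)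
      mul_smul := fun γ δ g => Subtype.ext
        (show ((γ : G × G).1 * (δ : G × G).1) * g * ((γ : G × G).2 * (δ : G × G).2)⁻¹ =
          (γ : G × G).1 * ((δ : G × G).1 * g * (δ : G × G).2⁻¹) * (γ : G × G).2⁻¹ by
            simp [mul_assoc]) }
  have hact : ∀ (γ : Γ) (g : bigCell P Q), ((γ • g : bigCell P Q) : G) =
      (γ : G × G).1 * g * (γ : G × G).2⁻¹ := fun γ g => rfl
  have hme : MeasurableEmbedding (Subtype.val : bigCell P Q → G) :=
    MeasurableEmbedding.subtype_coe h.isOpen_bigCell.measurableSet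
  -- The trace on Ω of a compact set of G: it need not be compact in Ω, but it has finite measure
  -- and meets every orbit in Ω.
  let K : Set (bigCell P Q) := Subtype.val ⁻¹' (e '' C)
  have hesymm : ∀ (γ : Γ) (g : bigCell P Q), e.symm ((γ • g : bigCell P Q) : G) =
      γ • e.symm (g : G) := by
    intro γ g
    rw [e.symm_apply_eq, he, e.apply_symm_apply, hact]
  have hmemK : ∀ g : bigCell P Q, g ∈ K ↔ e.symm (g : G) ∈ C := by
    intro g
    refine ⟨?_, fun hg => ⟨_, hg, e.apply_symm_apply _⟩⟩
    rintro ⟨x, hx, hxg⟩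
    rwa [← hxg, e.symm_apply_apply]
  obtain ⟨c, -, hc1, hc⟩ := h.exists_measure_flow_image μ one_pos
  have hcontsmul : ∀ γ : Γ, Continuous fun g : bigCell P Q => γ • g := fun γ =>
    Continuous.subtype_mk (by fun_prop) _
  -- The inverse of the flow is used for Φ, since its pushforward gives a set the measure of its
  -- image under the forward flow.
  refine hc1 (eq_one_of_map_eq_smul (Γ := Γ) (μ := μ.comap (Subtype.val : bigCell P Q → G))
    (fun γ => ⟨(hcontsmul γ).measurable, ?_⟩) ?_ (K := K) ?_ ?_ (fun g => ?_) (fun g => ?_)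
    (Φ := (h.flow 1).symm) (h.flow 1).symm.continuous.measurable (fun γ g => ?_) ?_)
  · ext A hA
    rw [map_apply (hcontsmul γ).measurable hA, hme.comap_apply, hme.comap_apply,
      ← measure_image_mul_mul μ (γ : G × G).1 (γ : G × G).2, Set.image_image]
    congr 1
    ext g
    constructor
    · rintro ⟨x, hx, rfl⟩
      exact ⟨γ • x, hx, rfl⟩
    · rintro ⟨x, hx, rfl⟩
      refine ⟨γ⁻¹ • x, by rwa [Set.mem_preimage, smul_inv_smul], ?_⟩
      change ((γ • γ⁻¹ • x : bigCell P Q) : G) = x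
      rw [smul_inv_smul]
  · rw [hme.comap_apply]
    have h1 : (1 : G) ∈ bigCell P Q := ⟨1, P.one_mem, 1, Q.one_mem, (mul_one 1).symm⟩
    rw [Set.image_univ, Subtype.range_val]
    exact (h.isOpen_bigCell.measure_pos μ ⟨1, h1⟩).ne'
  · exact ((hC.image e.continuous).isClosed.preimage continuous_subtype_val).measurableSet
  · rw [hme.comap_apply]
    refine ne_top_of_le_ne_top (hC.image e.continuous).measure_lt_top.ne (measure_mono ?_)
    exact Set.image_preimage_subset _ _
  · obtain ⟨γ, hγ⟩ := hCc (e.symm (g : G))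
    exact ⟨γ, by rwa [hmemK, hesymm]⟩
  -- Finiteness of returns is proper discontinuity on all of X, applied to one point and the compact
  -- set C.
  · refine (hpd.finite_disjoint_inter_image (isCompact_singleton (x := e.symm (g : G))) hC).subset ?_
    intro γ hγ
    refine ⟨γ • e.symm (g : G), ⟨_, rfl, rfl⟩, ?_⟩
    rwa [Set.mem_setOf_eq, hmemK, hesymm] at hγ
  · rw [Homeomorph.symm_apply_eq]
    refine Subtype.ext ?_
    have h1 := h.coe_flow_equivariant 1 (x := (h.flow 1).symm g) (y := γ • (h.flow 1).symm g)
      (hΓ γ.2).1 (hΓ γ.2).2 (hact γ _)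
    rw [h1, Homeomorph.apply_symm_apply, hact]
  · ext A hA
    rw [map_apply (h.flow 1).symm.continuous.measurable hA, hme.comap_apply,
      ← Homeomorph.image_eq_preimage_symm, hc]
    change (c : ENNReal) * _ = (c : ENNReal) * μ.comap Subtype.val A
    rw [hme.comap_apply]

theorem ContractingPair.not_actsProperlyCocompactlyOnGroup [MeasurableSpace G] [BorelSpace G]
    (h : ContractingPair P Q U a) (μ : Measure G) [μ.IsHaarMeasure] [μ.IsMulRightInvariant]
    {Γ : Subgroup (G × G)} (hΓ : Γ ≤ P.prod Q) [DiscreteTopology Γ] :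
    ¬ ActsProperlyCocompactlyOnGroup Γ := by
  let act : MulAction (G × G) G := leftRightAction G
  exact h.not_actsProperlyCocompactly μ hΓ (Homeomorph.refl G) fun γ x => rfl

theorem mem_diagSubgroup {z : G × G} : z ∈ diagSubgroup G ↔ z.1 = z.2 := by
  constructor
  · rintro ⟨g, rfl⟩
    rfl
  · intro hz
    exact ⟨z.1, Prod.ext rfl hz⟩

/-- The homeomorphism `(G × G) / Diag(G) ≃ G`, `(a, b) ↦ a b⁻¹`. -/
def quotientDiagHomeomorph : (G × G) ⧸ diagSubgroup G ≃ₜ G where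
  toFun := Quotient.lift (fun z : G × G => z.1 * z.2⁻¹) (by
    intro z w hzw
    have h1 := mem_diagSubgroup.1 (QuotientGroup.leftRel_apply.1 hzw)
    change z.1⁻¹ * w.1 = z.2⁻¹ * w.2 at h1
    have h2 : w.1 = z.1 * (z.2⁻¹ * w.2) := by rw [← h1, mul_inv_cancel_left]
    change z.1 * z.2⁻¹ = w.1 * w.2⁻¹
    rw [h2]
    group)
  invFun g := QuotientGroup.mk (g, 1)
  left_inv := by
    intro x
    obtain ⟨z, rfl⟩ := QuotientGroup.mk_surjective x
    refine QuotientGroup.eq.2 (mem_diagSubgroup.2 ?_)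
    change (z.1 * z.2⁻¹)⁻¹ * z.1 = 1⁻¹ * z.2
    group
  right_inv g := by
    change g * 1⁻¹ = g
    simp
  continuous_toFun := Continuous.quotient_lift (by fun_prop) _
  continuous_invFun := by
    change Continuous fun g : G => (QuotientGroup.mk (g, (1 : G)) : (G × G) ⧸ diagSubgroup G)
    exact QuotientGroup.continuous_mk.comp (by fun_prop)

theorem ContractingPair.not_actsProperlyCocompactly_quotient [MeasurableSpace G] [BorelSpace G]
    (h : ContractingPair P Q U a) (μ : Measure G) [μ.IsHaarMeasure] [μ.IsMulRightInvariant]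
    {Γ : Subgroup (G × G)} (hΓ : Γ ≤ P.prod Q) [DiscreteTopology Γ] :
    ¬ ActsProperlyCocompactly Γ ((G × G) ⧸ diagSubgroup G) := by
  refine h.not_actsProperlyCocompactly μ hΓ quotientDiagHomeomorph fun γ x => ?_
  obtain ⟨z, rfl⟩ := QuotientGroup.mk_surjective x
  change ((γ : G × G).1 * z.1) * ((γ : G × G).2 * z.2)⁻¹ =
    (γ : G × G).1 * (z.1 * z.2⁻¹) * (γ : G × G).2⁻¹
  group

end Discrete
end BigCell

end

/-! ### The three statements for opposite parabolic subgroups. -/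

open BigCell MeasureTheory in
theorem theorem7p1
    {E : Type*} [NormedAddCommGroup E] [NormedSpace ℝ E] [FiniteDimensional ℝ E]
    {V : Type*} [NormedAddCommGroup V] [InnerProductSpace ℝ V] [FiniteDimensional ℝ V]
    {G : Type*} [TopologicalSpace G] [ChartedSpace E G] [Group G] [LieGroup 𝓘(ℝ, E) ∞ G]
    [ConnectedSpace G]
    (ρ : G →* (V →L[ℝ] V)ˣ) (hρ : IsLinearReductive (E := E) ρ)
    (P Pstar : Subgroup G) (hopp : AreOppositeParabolics (E := E) ρ P Pstar) (hP : P ≠ ⊤) :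
    -- a closed manifold admits no `(P × P*, Ω)`-structure
    (∀ (F : Type*) [NormedAddCommGroup F] [NormedSpace ℝ F] [FiniteDimensional ℝ F]
      (M : Type*) [TopologicalSpace M] [ChartedSpace F M] [IsManifold 𝓘(ℝ, F) ∞ M]
      [T2Space M] [ConnectedSpace M] [CompactSpace M]
      (N : Type*) [TopologicalSpace N] [ChartedSpace F N] [IsManifold 𝓘(ℝ, F) ∞ N]
      (π : N → M), IsUniversalCover F π →
        IsEmpty (BigCellStructure F E P Pstar π)) ∧
    -- no manifold admits a complete `(P × P*, Ω)`-structure of finite volume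
    (∀ (F : Type*) [NormedAddCommGroup F] [NormedSpace ℝ F] [FiniteDimensional ℝ F]
      (M : Type*) [TopologicalSpace M] [ChartedSpace F M] [IsManifold 𝓘(ℝ, F) ∞ M]
      [T2Space M] [SecondCountableTopology M] [ConnectedSpace M]
      [MeasurableSpace M] [BorelSpace M]
      (N : Type*) [TopologicalSpace N] [ChartedSpace F N] [IsManifold 𝓘(ℝ, F) ∞ N]
      (π : N → M), IsUniversalCover F π →
      ∀ [MeasurableSpace G] [BorelSpace G] (μ : Measure G) [μ.IsHaarMeasure]
        (S : BigCellStructure F E P Pstar π), S.IsComplete → ¬ S.HasFiniteVolume μ) ∧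
    -- no discrete subgroup of `P × P*` acts properly discontinuously and cocompactly on `G`,
    -- or on `(G × G) / Diag(G)`
    (∀ Γ : Subgroup (G × G), Γ ≤ P.prod Pstar → DiscreteTopology Γ →
      ¬ ActsProperlyCocompactlyOnGroup Γ ∧
      ¬ ActsProperlyCocompactly Γ ((G × G) ⧸ diagSubgroup G)) := by
  have : IsTopologicalGroup G := topologicalGroup_of_lieGroup 𝓘(ℝ, E) ∞
  have : T2Space G := t2Space_of_isLinearReductive hρ
  have : LocallyCompactSpace G := ChartedSpace.locallyCompactSpace E G
  have : SecondCountableTopology G := secondCountableTopology_of_isLinearReductive hρ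
  obtain ⟨U, a, h⟩ := hopp.exists_contractingPair hρ hP
  refine ⟨?_, ?_, ?_⟩
  · intro F _ _ _ M _ _ _ _ _ _ N _ _ _ π hπ
    borelize G
    have := isMulRightInvariant_of_isLinearReductive hρ (Measure.haar : Measure G)
    exact BigCellStructure.isEmpty_of_compactSpace hπ h Measure.haar
  · intro F _ _ _ M _ _ _ _ _ _ _ _ N _ _ _ π hπ _ _ μ _ S hS
    have := isMulRightInvariant_of_isLinearReductive hρ μ
    exact S.not_hasFiniteVolume hπ h μ hS
  · intro Γ hΓ hd
    borelize G
    have := isMulRightInvariant_of_isLinearReductive hρ (Measure.haar : Measure G)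
    exact ⟨h.not_actsProperlyCocompactlyOnGroup Measure.haar hΓ,
      h.not_actsProperlyCocompactly_quotient Measure.haar hΓ⟩
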